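/- **Setting.** A *discretized Poisson problem* $G=(N,A,B)$ comes from a conforming mesh of finitely many non-degenerate triangles (with pairwise distinct vertex sets) of a connected planar domain, with nodes $x_1,\dots,x_N\in\mathbb R^2$. The edges of the mesh that lie in one triangle only are its boundary edges; the nodes on them are the boundary nodes, each lies on exactly two boundary edges, and each is declared Dirichlet or Neumann, with at least one Dirichlet node in total. The other nodes are interior. The matrix $A$ has the row $e_i^{\top}$ at a Dirichlet node $i$ and the row $a_{ij}=\int\nabla\varphi_i\cdot\nabla\varphi_j$ of the first-order Lagrange stiffness matrix at any other node. The vector $B\in\mathbb R^N$ holds the prescribed value at each Dirichlet node and the discretized force term at each other node; it is arbitrary. Let $U^*(G)$ be the minimizer over $U\in\mathbb R^N$ of $\frac1N\sum_i\big(-b_i+\sum_j a_{ij}u_j\big)^2$. Let $\mathcal D$ be a *compact* family of such problems: the numbers of nodes are bounded and, for each connectivity table with node types, the pairs (node positions, $B$) of its problems form a compact set. **Architecture.** "Perceptron" means a multi-layer perceptron with $L$ hidden layers of width $w$ and affine output; the hidden activation is $\mathrm{ReLU}$ unless said otherwise. Let $d$ be the latent dimension, $\mathcal N(i)$ the nodes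 sharing a triangle with $i$ (other than $i$), $d_{ij}=|x_i-x_j|$, $t_i\in\{0,1\}^3$ the one-hot node type, $\mathbf b_i=b_it_i\in\mathbb R^3$, and $n_i$ the outward unit normal at a Neumann node (the normalized sum of the outward unit normals of its two boundary edges). The location $x_i$ is a node descriptor. For an initial $U^0\in\mathbb R^N$ that takes the prescribed values at the Dirichlet nodes, put $H^0_i=E_\theta(u^0_i,x_i)\in\mathbb R^d$. Freeze $H_i=H^0_i$ at the Dirichlet nodes. The state $H$ consists of the $H_i\in\mathbb R^d$ at the interior and Neumann nodes, with the Euclidean distance $\mathrm{dist}$. Set $\phi^{\circlearrowleft}_i=\Phi^{\circlearrowleft}(H_i,t_i)$. * At an interior node, with $\phi^{\to}_i=\sum_{j\in\mathcal N(i)}\Phi^{I}_{\to}(H_i,H_j,d_{ij})$, $\phi^{\leftarrow}_i=\sum_{j\in\mathcal N(i)}\Phi^{I}_{\leftarrow}(H_i,H_j,d_{ij})$ and $m_i=(\mathbf b_i,x_i,\phi^{\to}_i,\phi^{\leftarrow}_i,\phi^{\circlearrowleft}_i)$, put $\alpha_i=\Psi^1(H_i,m_i)$, $\beta_i=\Psi^2(H_i,m_i)$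 (sigmoid activation), $\zeta_i=\Psi^3(\beta_i*H_i,m_i)$ ($\tanh$ activation) and $z_i=H_i+\alpha_i*\zeta_i$, where $*$ is the entrywise product. * At a Neumann node, $z_i=\Psi^4\big(H_i,\mathbf b_i,x_i,n_i,\sum_{j\in\mathcal N(i)}\Phi^N_{\leftarrow}(H_i,H_j,d_{ij}),\phi^{\circlearrowleft}_i\big)$. Then $h_\theta(H,G)_i=\mathrm{LN}(z_i)$, where LN is layer normalization over the $d$ features with learned gain and bias and with a fixed constant $\eta\ge 0$ added to the variance (if the variance plus $\eta$ is $0$, LN returns the bias). All messages take values in $\mathbb R^d$. A state $H$ is decoded to $D_\theta(H)\in\mathbb R^N$, node by node, with the frozen $H^0_i$ at the Dirichlet nodes. The parameter $\theta$ collects all weights of $E_\theta$, $D_\theta$, the $\Phi$'s and $\Psi$'s, and the gain and bias. **Theorem (Universal Approximation Property).** Let $\mathcal D$ be a compact family of discretized Poisson problems, $\eta\ge0$ and $\varepsilon>0$. For sufficiently large layers, that is, for some $L,d_0$, for every $d\ge d_0$, for some $w_0$ and every $w\ge w_0$, there are a parameterization $\theta$ and $\mu\in[0,1)$ such that for every $G\in\mathcal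 D$ and every $U^0$ with the prescribed Dirichlet values the following holds. 1. ("Mainly contractive") $\mathrm{dist}(h_\theta(H,G),h_\theta(H',G))\le\mu\,\mathrm{dist}(H,H')$ for all states $H,H'$ with $\mathrm{dist}(H,H')>\sqrt\varepsilon$. 2. $h_\theta(\cdot,G)$ has a unique fixed point $H^*_G$. For each state $H$, the $k$-th iterate $H^{(k)}$ of $h_\theta(\cdot,G)$ from $H$ satisfies $\mathrm{dist}(H^{(k)},H^*_G)\le\max\big(\mu^k\,\mathrm{dist}(H,H^*_G),\sqrt\varepsilon\big)$ for all $k\ge 0$. For all large $k$ it lies within $\sqrt\varepsilon$ of $H^*_G$, and $\|D_\theta(H^{(k)})-U^*(G)\|\le\varepsilon+\sqrt\varepsilon$. 3. The minimizer $U^*(G)$ exists and is unique, and $\|D_\theta(H^*_G)-U^*(G)\|\le\varepsilon$ in the Euclidean norm. -/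

import Mathlib

noncomputable section

/-! ### Discretized Poisson problems with mixed boundary conditions -/

/-- The three kinds of mesh nodes. -/
inductive NodeKind : Type
  | interior
  | dirichlet
  | neumann
  deriving DecidableEq

/-- The plane, with its Euclidean norm. -/
abbrev Plane : Type := EuclideanSpace ℝ (Fin 2)

/-- The combinatorial part of a triangular mesh: a connectivity table, in which `tri a r` is the
`r`-th vertex of the `a`-th triangle, and the kind of every node. -/
structure MeshTable : Type where
  numNodes : ℕ
  numTri : ℕ
  tri : Fin numTri → Fin 3 → Fin numNodes
  kind : Fin numNodes → NodeKind

/-- The data of a discretized Poisson problem: a triangular mesh in the plane, and the vector `B`.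
At a Dirichlet node, `B` is the prescribed boundary value; at any other node it is the
discretized force term. Well-formedness of the mesh is `PoissonProblem.IsMesh`. -/
structure PoissonProblem extends MeshTable where
  pos : Fin numNodes → Plane
  B : Fin numNodes → ℝ

/-- The planar cross product. -/
def planeCross (v w : Plane) : ℝ := v 0 * w 1 - v 1 * w 0

/-- Rotation by a right angle. -/
def planeRot (v : Plane) : Plane := !₂[-(v 1), v 0]

namespace PoissonProblem

variable (G : PoissonProblem)

/-- Position of the `r`-th vertex of the triangle `a`. -/
def vertex (a : Fin G.numTri) (r : Fin 3) : Plane := G.pos (G.tri a r)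

/-- Twice the signed area of the triangle `a`. -/
def det (a : Fin G.numTri) : ℝ :=
  planeCross (G.vertex a 1 - G.vertex a 0) (G.vertex a 2 - G.vertex a 0)

/-- Area of the triangle `a`. -/
def area (a : Fin G.numTri) : ℝ := |G.det a| / 2

/-- Gradient, on the triangle `a`, of the affine function that is `1` at the vertex `r` and `0` at
the two other vertices (indices are taken modulo 3). -/
def hatGrad (a : Fin G.numTri) (r : Fin 3) : Plane :=
  (G.det a)⁻¹ • planeRot (G.vertex a (r + 2) - G.vertex a (r + 1))

/-- First-order Lagrange stiffness matrix `∫ ∇φ_i · ∇φ_j`, assembled triangle by triangle. -/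
def stiffness (i j : Fin G.numNodes) : ℝ :=
  ∑ a, ∑ r, ∑ s, if G.tri a r = i ∧ G.tri a s = j then
    G.area a * inner ℝ (G.hatGrad a r) (G.hatGrad a s) else 0

/-- The matrix `A` of the discretized problem: an identity row at every Dirichlet node, a row of the
stiffness matrix at every other node (homogeneous Neumann conditions are natural). -/
def A : Matrix (Fin G.numNodes) (Fin G.numNodes) ℝ := fun i j =>
  if G.kind i = NodeKind.dirichlet then (if i = j then 1 else 0) else G.stiffness i j

/-- Residual loss: the mean square error of `A U - B`. -/
def residualLoss (U : EuclideanSpace ℝ (Fin G.numNodes)) : ℝ :=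
  (1 / (G.numNodes : ℝ)) * ∑ i, (-(G.B i) + ∑ j, G.A i j * U j) ^ 2

/-- `U` minimizes the residual loss. -/
def IsResidualMinimizer (U : EuclideanSpace ℝ (Fin G.numNodes)) : Prop :=
  ∀ V, G.residualLoss U ≤ G.residualLoss V

/-- The one-hop neighbourhood relation: distinct nodes of a common triangle. -/
def graph : SimpleGraph (Fin G.numNodes) where
  Adj i j := i ≠ j ∧ ∃ a r s, G.tri a r = i ∧ G.tri a s = j
  symm := ⟨fun _ _ h => ⟨h.1.symm, h.2.elim fun a ha => ha.elim fun r hr => hr.elim fun s hs =>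
    ⟨a, s, r, hs.2, hs.1⟩⟩⟩
  loopless := ⟨fun _ h => h.1 rfl⟩

/-- The edge of the triangle `a` opposite to its vertex `r` belongs to no other triangle. -/
def IsBoundaryEdge (a : Fin G.numTri) (r : Fin 3) : Prop :=
  ∀ b, (∃ s, G.tri b s = G.tri a (r + 1)) → (∃ s, G.tri b s = G.tri a (r + 2)) → b = a

open Classical in
/-- The boundary edges that end at the node `i`; the pair `(a, r)` stands for the edge of the
triangle `a` opposite to its vertex `r`. -/
def boundaryEdgesAt (i : Fin G.numNodes) : Finset (Fin G.numTri × Fin 3) :=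
  Finset.univ.filter fun e => G.IsBoundaryEdge e.1 e.2 ∧
    (G.tri e.1 (e.2 + 1) = i ∨ G.tri e.1 (e.2 + 2) = i)

/-- Outward unit normal of the edge of `a` opposite to its vertex `r`. -/
def edgeNormal (a : Fin G.numTri) (r : Fin 3) : Plane :=
  -(‖G.hatGrad a r‖⁻¹ • G.hatGrad a r)

/-- Outward unit normal at a boundary node: the normalized sum of the outward unit normals of
the boundary edges at this node. -/
def normal (i : Fin G.numNodes) : Plane :=
  ‖∑ e ∈ G.boundaryEdgesAt i, G.edgeNormal e.1 e.2‖⁻¹ •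
    ∑ e ∈ G.boundaryEdgesAt i, G.edgeNormal e.1 e.2

/-- The data form a conforming triangulation of a connected planar domain bounded by closed
polygons, whose interior nodes are exactly those off the boundary, and there is a Dirichlet node. -/
structure IsMesh : Prop where
  nondegenerate : ∀ a, G.det a ≠ 0
  distinct : ∀ a b, a ≠ b → Set.range (G.tri a) ≠ Set.range (G.tri b)
  conforming : ∀ a b, a ≠ b →
    convexHull ℝ (Set.range (G.vertex a)) ∩ convexHull ℝ (Set.range (G.vertex b)) ⊆
      convexHull ℝ (G.pos '' (Set.range (G.tri a) ∩ Set.range (G.tri b)))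
  connected : G.graph.Connected
  interior_iff : ∀ i, G.kind i = NodeKind.interior ↔ G.boundaryEdgesAt i = ∅
  boundary_polygon : ∀ i, G.kind i ≠ NodeKind.interior → (G.boundaryEdgesAt i).card = 2
  exists_dirichlet : ∃ i, G.kind i = NodeKind.dirichlet

/-- The nodes whose latent variables are updated: interior and Neumann nodes. -/
abbrev Free : Type := {i : Fin G.numNodes // G.kind i ≠ NodeKind.dirichlet}

/-- `U` takes the prescribed values at the Dirichlet nodes. -/
def MeetsDirichlet (U : Fin G.numNodes → ℝ) : Prop :=
  ∀ i, G.kind i = NodeKind.dirichlet → U i = G.B i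

/-- One-hot encoding of the node kind. -/
def oneHot (i : Fin G.numNodes) : Fin 3 → ℝ :=
  match G.kind i with
  | NodeKind.interior => ![1, 0, 0]
  | NodeKind.dirichlet => ![0, 1, 0]
  | NodeKind.neumann => ![0, 0, 1]

/-- The entry `B i`, written in the slot of the node kind. -/
def bVec (i : Fin G.numNodes) : Fin 3 → ℝ := fun k => G.B i * G.oneHot i k

/-- Compactness of a set of problems, for the topology in which the connectivity table and the
node kinds are discrete: the numbers of nodes are bounded, and for each table the node positions
and the vectors `B` form a compact set. -/
def IsCompactFamily (𝒟 : Set PoissonProblem) : Prop :=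
  (∃ n : ℕ, ∀ G ∈ 𝒟, G.numNodes ≤ n) ∧
  ∀ T : MeshTable, IsCompact
    {q : (Fin T.numNodes → Plane) × (Fin T.numNodes → ℝ) |
      ({ toMeshTable := T, pos := q.1, B := q.2 } : PoissonProblem) ∈ 𝒟}

end PoissonProblem

/-! ### Multi-layer perceptrons -/

/-- Weights and biases of a multi-layer perceptron with `L` hidden layers of `w` neurons each,
inputs indexed by `ι` and outputs indexed by `κ`. -/
def MLP : ℕ → ℕ → Type → Type → Type
  | 0, _, ι, κ => Matrix κ ι ℝ × (κ → ℝ)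
  | L + 1, w, ι, κ => (Matrix (Fin w) ι ℝ × (Fin w → ℝ)) × MLP L w (Fin w) κ

/-- The function computed by a perceptron: the activation `σ` acts on the hidden layers, the output
layer is affine. -/
def MLP.eval (σ : ℝ → ℝ) {κ : Type} {w : ℕ} :
    {L : ℕ} → {ι : Type} → [Fintype ι] → MLP L w ι κ → (ι → ℝ) → κ → ℝ
  | 0, _, _, (W, b), x => W.mulVec x + b
  | _ + 1, _, _, ((W, b), net), x => MLP.eval σ net fun k => σ ((W.mulVec x + b) k)

/-- The rectified linear unit. -/
def relu (x : ℝ) : ℝ := max x 0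

/-- Layer normalization of a feature vector `z`, with the constant `η` added to the variance, and
with learned gain and bias. -/
def layerNorm (η : ℝ) {d : ℕ} (gain bias z : Fin d → ℝ) : Fin d → ℝ :=
  let mean := (1 / (d : ℝ)) * ∑ c, z c
  let var := (1 / (d : ℝ)) * ∑ c, (z c - mean) ^ 2
  fun c => gain c * ((z c - mean) / √(var + η)) + bias c

/-! ### The Ψ-GNN architecture -/

/-- Inputs of a message function: the two latent vectors and the distance. -/
abbrev MsgIn (d : ℕ) : Type := Fin d ⊕ Fin d ⊕ Unit

/-- Inputs of an interior update: latent vector, `b_i`, location, and three messages. -/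
abbrev InteriorIn (d : ℕ) : Type := Fin d ⊕ Fin 3 ⊕ Fin 2 ⊕ Fin d ⊕ Fin d ⊕ Fin d

/-- Inputs of a Neumann update: latent vector, `b_i`, location, normal, and two messages. -/
abbrev NeumannIn (d : ℕ) : Type := Fin d ⊕ Fin 3 ⊕ Fin 2 ⊕ Fin 2 ⊕ Fin d ⊕ Fin d

/-- The trainable parameters, for latent dimension `d` and perceptrons with `L` hidden layers of
width `w`. -/
structure PsiGNN (L w d : ℕ) : Type where
  /-- encoder, applied to the initial value and the location of a node -/
  enc : MLP L w (Unit ⊕ Fin 2) (Fin d)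
  /-- decoder -/
  dec : MLP L w (Fin d) Unit
  /-- outgoing messages of interior nodes -/
  msgOutI : MLP L w (MsgIn d) (Fin d)
  /-- incoming messages of interior nodes -/
  msgInI : MLP L w (MsgIn d) (Fin d)
  /-- incoming messages of Neumann nodes -/
  msgInN : MLP L w (MsgIn d) (Fin d)
  /-- self-loop messages -/
  msgLoop : MLP L w (Fin d ⊕ Fin 3) (Fin d)
  /-- first gate -/
  upd1 : MLP L w (InteriorIn d) (Fin d)
  /-- second gate -/
  upd2 : MLP L w (InteriorIn d) (Fin d)
  /-- candidate update of interior nodes -/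
  upd3 : MLP L w (InteriorIn d) (Fin d)
  /-- update of Neumann nodes -/
  upd4 : MLP L w (NeumannIn d) (Fin d)
  /-- gain of the layer normalization -/
  gain : Fin d → ℝ
  /-- bias of the layer normalization -/
  bias : Fin d → ℝ

/-- Latent states of the processor, with the Euclidean metric. -/
abbrev LatentState (G : PoissonProblem) (d : ℕ) : Type := EuclideanSpace ℝ (G.Free × Fin d)

namespace PsiGNN

variable {L w d : ℕ} (θ : PsiGNN L w d) (G : PoissonProblem)

/-- The encoder, node by node. -/
def encode (U₀ : Fin G.numNodes → ℝ) (i : Fin G.numNodes) : Fin d → ℝ :=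
  θ.enc.eval relu (Sum.elim (fun _ => U₀ i) (G.pos i))

/-- The latent vectors of all nodes: the encoded initial values at the Dirichlet nodes, the latent
state `H` at the other nodes. -/
def combine (U₀ : Fin G.numNodes → ℝ) (H : LatentState G d) (i : Fin G.numNodes) : Fin d → ℝ :=
  if h : G.kind i = NodeKind.dirichlet then θ.encode G U₀ i else fun c => H (⟨i, h⟩, c)

open Classical in
/-- Sum over the one-hop neighbours `j` of `i` of the messages `Φ (K i, K j, d_ij)`. -/
def aggregate (Φ : MLP L w (MsgIn d) (Fin d)) (K : Fin G.numNodes → Fin d → ℝ)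
    (i : Fin G.numNodes) : Fin d → ℝ :=
  ∑ j ∈ Finset.univ.filter (G.graph.Adj i),
    Φ.eval relu (Sum.elim (K i) (Sum.elim (K j) fun _ => dist (G.pos i) (G.pos j)))

/-- The self-loop message. -/
def loopMsg (K : Fin G.numNodes → Fin d → ℝ) (i : Fin G.numNodes) : Fin d → ℝ :=
  θ.msgLoop.eval relu (Sum.elim (K i) (G.oneHot i))

/-- The update of interior nodes, by a modified GRU cell. -/
def interiorUpdate (K : Fin G.numNodes → Fin d → ℝ) (i : Fin G.numNodes) : Fin d → ℝ :=
  let input : (Fin d → ℝ) → InteriorIn d → ℝ := fun x =>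
    Sum.elim x (Sum.elim (G.bVec i) (Sum.elim (G.pos i) (Sum.elim (aggregate G θ.msgOutI K i)
      (Sum.elim (aggregate G θ.msgInI K i) (θ.loopMsg G K i)))))
  let α := θ.upd1.eval Real.sigmoid (input (K i))
  let β := θ.upd2.eval Real.sigmoid (input (K i))
  let ζ := θ.upd3.eval Real.tanh (input (β * K i))
  K i + α * ζ

/-- The update of Neumann nodes. -/
def neumannUpdate (K : Fin G.numNodes → Fin d → ℝ) (i : Fin G.numNodes) : Fin d → ℝ :=
  θ.upd4.eval relu (Sum.elim (K i) (Sum.elim (G.bVec i) (Sum.elim (G.pos i)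
    (Sum.elim (G.normal i) (Sum.elim (aggregate G θ.msgInN K i) (θ.loopMsg G K i))))))

/-- The function `h_θ(·, G)` of the processor. It acts on the latent variables of the interior and
Neumann nodes; those of the Dirichlet nodes are frozen at their encoded initial values. -/
def process (η : ℝ) (U₀ : Fin G.numNodes → ℝ) (H : LatentState G d) : LatentState G d :=
  WithLp.toLp 2 fun p =>
    layerNorm η θ.gain θ.bias
      (if G.kind p.1 = NodeKind.interior then θ.interiorUpdate G (θ.combine G U₀ H) p.1
        else θ.neumannUpdate G (θ.combine G U₀ H) p.1) p.2

/-- The decoder, applied node by node to the combined latent variables. -/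
def decode (U₀ : Fin G.numNodes → ℝ) (H : LatentState G d) : EuclideanSpace ℝ (Fin G.numNodes) :=
  WithLp.toLp 2 fun i => θ.dec.eval relu (θ.combine G U₀ H i) ()

end PsiGNN

end

noncomputable section


/-! ### Planar vectors -/

/-! The contraction clause costs little: with a tiny gain in the layer normalization, any two
outputs of the processor are within `√ε / 2`, so the factor `1 / 2` serves for states farther apart
than `√ε`. The work is to make such a small image carry the information that the solution needs, and
to force a unique attracting fixed point.

What the latent vectors must carry. Every free node holds static data (location, `b`, kind, normal)
and features that solve a damped one-hop equation: the value at `i` is the sum over the neighbours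
`j` of `l` times the value at `j` plus a rectified affine function of the static data of the pair.
The family of all these features determines a positive measure on pairs of node data that charges
the edges at the free nodes joined to `i` (`eq_zero_of_relu_integrals`). Locations separate the
nodes of a mesh, and neighbours, kind and normal of a free node determine the triangles around it
(`IsMesh.starTri_iff`): two fans on the same neighbours can differ only at gaps, and the normal
points into the gap. Hence the stiffness rows of the component are known, and by unique solvability
so is the solution at `i` (`solution_eq_of_feature`). Compactness and the density of rectified
networks then give one network that reads finitely many features and approximates the solution at
all nodes of all problems (`exists_decoder`). This is the decoder.

How they are carried. A latent vector has a zero reference slot, a slot with a large constant `M`,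
and a slot for each feature. The constant dominates the variance, so normalization is nearly a
division by a fixed scale `κ` followed by multiplication with the gain `g`. Differences to the
reference slot, multiplied by `s = κ / g`, recover the features up to a small error; the residual
term and the rescaled tanh add further small errors. Seen through these readouts, the processor is a
perturbation of the damped propagation. It contracts a weighted gauge on an absorbing region
(`gauge_step_le`, `exists_iterate_mem_region`), so a unique fixed point attracts all states, and its
readouts are close to the exact features (`read_fixedPoint_le`). -/

lemma plane_ext {v w : Plane} (h0 : v 0 = w 0) (h1 : v 1 = w 1) : v = w := by
  ext i; fin_cases i <;> assumption

lemma planeCross_swap (v w : Plane) : planeCross w v = -planeCross v w := by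
  simp only [planeCross]; ring

lemma planeCross_self (v : Plane) : planeCross v v = 0 := by
  simp only [planeCross]; ring

/-- Cramer's rule in the plane. -/
lemma plane_cramer {y z : Plane} (h : planeCross y z ≠ 0) (v : Plane) :
    v = (planeCross v z / planeCross y z) • y + (planeCross y v / planeCross y z) • z := by
  have key : ∀ c, planeCross y z * v c = planeCross v z * y c + planeCross y v * z c := by
    intro c; simp only [planeCross]; fin_cases c <;> simp <;> ring
  refine plane_ext ?_ ?_ <;>
  · simp only [PiLp.add_apply, PiLp.smul_apply, smul_eq_mul]
    rw [div_mul_eq_mul_div, div_mul_eq_mul_div, ← add_div, eq_div_iff h, ← key]; ring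

lemma planeCross_comb_left (s t : ℝ) (y z : Plane) :
    planeCross (s • y + t • z) z = s * planeCross y z := by
  simp only [planeCross, PiLp.add_apply, PiLp.smul_apply, smul_eq_mul]; ring

lemma planeCross_comb_right (s t : ℝ) (y z : Plane) :
    planeCross y (s • y + t • z) = t * planeCross y z := by
  simp only [planeCross, PiLp.add_apply, PiLp.smul_apply, smul_eq_mul]; ring

lemma planeCross_smul_left (s : ℝ) (y z : Plane) :
    planeCross (s • y) z = s * planeCross y z := by
  simp only [planeCross, PiLp.smul_apply, smul_eq_mul]; ring

lemma planeCross_smul_right (s : ℝ) (y z : Plane) :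
    planeCross y (s • z) = s * planeCross y z := by
  simp only [planeCross, PiLp.smul_apply, smul_eq_mul]; ring

lemma plane_norm_sq (v : Plane) : ‖v‖ ^ 2 = v 0 ^ 2 + v 1 ^ 2 := by
  rw [EuclideanSpace.norm_sq_eq]; simp [Fin.sum_univ_two]

lemma plane_inner (v w : Plane) : inner ℝ v w = v 0 * w 0 + v 1 * w 1 := by
  simp [PiLp.inner_apply, Fin.sum_univ_two]; ring

/-- Lagrange's identity: the squared cross product is exactly the defect in the Cauchy–Schwarz
inequality. -/
lemma plane_inner_lt {y z : Plane} (h : planeCross y z ≠ 0) :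
    y 0 * z 0 + y 1 * z 1 < ‖y‖ * ‖z‖ := by
  have h1 : (y 0 * z 0 + y 1 * z 1) ^ 2 < (‖y‖ * ‖z‖) ^ 2 := by
    rw [mul_pow, plane_norm_sq, plane_norm_sq]
    have : 0 < planeCross y z ^ 2 := by positivity
    simp only [planeCross] at this
    nlinarith
  exact lt_of_abs_lt ((sq_lt_sq.mp h1).trans_eq (abs_of_nonneg (by positivity)))

/-! ### Fans of triangles around a point -/

/-- The triangles of a planar mesh around a point: `P` is the set of the neighbours, as vectors from
the point, and `E y z` says that `y` and `z` span a triangle with the point. -/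
structure IsFan (P : Set Plane) (E : Plane → Plane → Prop) : Prop where
  symm : ∀ {y z}, E y z → E z y
  mem : ∀ {y z}, E y z → y ∈ P
  cross_ne : ∀ {y z}, E y z → planeCross y z ≠ 0
  cone : ∀ {y z p}, E y z → p ∈ P → ∀ s t : ℝ, 0 ≤ s → 0 ≤ t → p = s • y + t • z → p = y ∨ p = z
  exists_nbr : ∀ {p}, p ∈ P → ∃ q, E p q

/-- `p` spans a single triangle of the fan. -/
def FanBoundary (P : Set Plane) (E : Plane → Plane → Prop) (p : Plane) : Prop :=
  p ∈ P ∧ ∀ q r, E p q → E p r → q = r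

/-- Unit normal of `p` that points away from `q`. -/
def edgeOut (p q : Plane) : Plane := -((SignType.sign (planeCross p q) : ℝ) / ‖p‖) • planeRot p

/-- The fan has exactly two boundary edges, and `N` is the sum of their outward unit normals. -/
def IsNormalSum (P : Set Plane) (E : Plane → Plane → Prop) (N : Plane) : Prop :=
  ∃ p₁ p₂ q₁ q₂, p₁ ≠ p₂ ∧ E p₁ q₁ ∧ E p₂ q₂ ∧ (∀ p, FanBoundary P E p ↔ p = p₁ ∨ p = p₂) ∧
    N = edgeOut p₁ q₁ + edgeOut p₂ q₂

section Fan

variable {P : Set Plane} {E E' : Plane → Plane → Prop}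

/-- Of two rays on the same side of `p`, the one nearer to `p` in angle lies in the cone of `p` and
the other, and such a cone contains no further neighbour. The sign of the first Cramer coefficient
tells which ray is nearer. -/
lemma IsFan.same_side (hE : IsFan P E) (hE' : IsFan P E') {p q q' : Plane} (h : E p q)
    (h' : E' p q') (hs : 0 < planeCross p q * planeCross p q') : q = q' := by
  have c := hE.cross_ne h
  have c' := hE'.cross_ne h'
  have hβ : 0 < planeCross p q' / planeCross p q := by
    rw [← mul_div_mul_left _ _ c]; exact div_pos hs (mul_self_pos.2 c)
  have hβ' : 0 < planeCross p q / planeCross p q' := by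
    rw [← inv_div]; exact inv_pos.2 hβ
  rcases le_or_gt 0 (planeCross q' q / planeCross p q) with hα | hα
  · rcases hE.cone h (hE'.mem (hE'.symm h')) _ _ hα hβ.le (plane_cramer c q') with e | e
    · rw [e, planeCross_self] at c'; exact absurd rfl c'
    · exact e.symm
  · have hα' : 0 ≤ planeCross q q' / planeCross p q' := by
      have : planeCross q q' / planeCross p q' =
          (-(planeCross q' q / planeCross p q)) * (planeCross p q / planeCross p q') := by
        rw [planeCross_swap q' q]; field_simp
      rw [this]; exact mul_nonneg (by linarith) hβ'.le
    rcases hE'.cone h' (hE.mem (hE.symm h)) _ _ hα' hβ'.le (plane_cramer c' q) with e | e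
    · rw [e, planeCross_self] at c; exact absurd rfl c
    · exact e

lemma IsFan.opposite (hE : IsFan P E) (hE' : IsFan P E') {y z q : Plane} (h : E y z)
    (h' : E' y q) (hne : z ≠ q) : planeCross y z * planeCross y q < 0 := by
  rcases lt_trichotomy (planeCross y z * planeCross y q) 0 with h1 | h1 | h1
  · exact h1
  · exact absurd h1 (mul_ne_zero (hE.cross_ne h) (hE'.cross_ne h'))
  · exact absurd (hE.same_side hE' h h' h1) hne

/-- If the triangle on `y` and `z` is missing from `E'`, every `E'`-neighbour of `y` lies across `y`
from `z`. Two of them are then on the same side of `y` and coincide. -/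
lemma IsFan.boundary_of_not (hE : IsFan P E) (hE' : IsFan P E') {y z : Plane} (h : E y z)
    (h' : ¬E' y z) : FanBoundary P E' y := by
  refine ⟨hE.mem h, fun q q' hq hq' => ?_⟩
  have h1 := hE.opposite hE' h hq (fun e => h' (e ▸ hq))
  have h2 := hE.opposite hE' h hq' (fun e => h' (e ▸ hq'))
  refine hE'.same_side hE' hq hq' ?_
  have := mul_pos_of_neg_of_neg h1 h2
  have h3 : 0 < planeCross y z ^ 2 * (planeCross y q * planeCross y q') :=
    this.trans_eq (by ring)
  exact pos_of_mul_pos_right h3 (sq_nonneg _)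

/-- Two fans without boundary on the same set of neighbours are equal. -/
lemma IsFan.eq_of_closed (hE : IsFan P E) (hE' : IsFan P E') (hb : ∀ p, ¬FanBoundary P E p)
    (hb' : ∀ p, ¬FanBoundary P E' p) (y z : Plane) : E y z ↔ E' y z :=
  ⟨fun h => by_contra fun h' => hb' _ (hE.boundary_of_not hE' h h'),
    fun h => by_contra fun h' => hb _ (hE'.boundary_of_not hE h h')⟩

lemma edgeOut_eq_of_neg {y z q : Plane} (h : planeCross y z * planeCross y q < 0) :
    edgeOut y q = ((SignType.sign (planeCross y z) : ℝ) / ‖y‖) • planeRot y := by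
  unfold edgeOut
  rcases mul_neg_iff.1 h with ⟨h1, h2⟩ | ⟨h1, h2⟩ <;> simp [h1, h2, neg_div]

/-- Since `q` lies across `y` from `z`, the normal of `y` points to the side of `z`, and likewise at
`z`. Each normal alone may leave the cone; in the sum, the Cramer coefficients are positive by the
strict Cauchy–Schwarz inequality. -/
lemma edgeOut_add_mem_cone {y z q r : Plane} (h : planeCross y z * planeCross y q < 0)
    (h' : planeCross z y * planeCross z r < 0) : ∃ s t : ℝ, 0 < s ∧ 0 < t ∧
      edgeOut y q + edgeOut z r = s • y + t • z := by
  have hc : planeCross y z ≠ 0 := fun e => by simp [e] at h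
  have hy : 0 < ‖y‖ := norm_pos_iff.2 fun e => hc (by simp [e, planeCross])
  have hz : 0 < ‖z‖ := norm_pos_iff.2 fun e => hc (by simp [e, planeCross])
  have hlt := plane_inner_lt hc
  have hy2 := plane_norm_sq y
  have hz2 := plane_norm_sq z
  rw [edgeOut_eq_of_neg h, edgeOut_eq_of_neg h', planeCross_swap y z, Left.sign_neg]
  set σ : ℝ := (SignType.sign (planeCross y z) : ℝ) with hσ
  have hσ1 : σ / planeCross y z = |planeCross y z|⁻¹ := by
    have := sign_mul_abs (planeCross y z)
    rw [← hσ] at this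
    have ha : |planeCross y z| ≠ 0 := abs_ne_zero.2 hc
    field_simp
    exact this
  refine ⟨(‖y‖ * ‖z‖ - (y 0 * z 0 + y 1 * z 1)) / ‖y‖ * |planeCross y z|⁻¹,
    (‖y‖ * ‖z‖ - (y 0 * z 0 + y 1 * z 1)) / ‖z‖ * |planeCross y z|⁻¹,
    mul_pos (div_pos (by linarith) hy) (inv_pos.2 (abs_pos.2 hc)),
    mul_pos (div_pos (by linarith) hz) (inv_pos.2 (abs_pos.2 hc)), ?_⟩
  rw [plane_cramer hc ((σ / ‖y‖) • planeRot y + (((-SignType.sign (planeCross y z) : SignType) : ℝ)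
    / ‖z‖) • planeRot z)]
  have e : ((-SignType.sign (planeCross y z) : SignType) : ℝ) = -σ := by simp [hσ]
  rw [e]
  congr 2
  · rw [← hσ1, ← mul_div_assoc]
    congr 1
    simp only [planeCross, planeRot, PiLp.add_apply, PiLp.smul_apply, smul_eq_mul]
    simp
    field_simp
    linear_combination σ * ‖y‖ * (-hz2)
  · rw [← hσ1, ← mul_div_assoc]
    congr 1
    simp only [planeCross, planeRot, PiLp.add_apply, PiLp.smul_apply, smul_eq_mul]
    simp
    field_simp
    linear_combination σ * ‖z‖ * (-hy2)

/-- A triangle of one fan that is missing from the other fills the gap of the latter: its sides are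
the two boundary edges, and the sum of the normals points into the gap. -/
lemma IsFan.normal_mem_cone (hE : IsFan P E) (hE' : IsFan P E') {y z N : Plane} (h : E y z)
    (h' : ¬E' y z) (hN : IsNormalSum P E' N) :
    (∃ s t : ℝ, 0 < s ∧ 0 < t ∧ N = s • y + t • z) ∧ ∀ p, FanBoundary P E' p → p = y ∨ p = z := by
  obtain ⟨p₁, p₂, q₁, q₂, hne, h1, h2, hb, rfl⟩ := hN
  have h'' : ¬E' z y := fun e => h' (hE'.symm e)
  have hy := (hb y).1 (hE.boundary_of_not hE' h h')
  have hz := (hb z).1 (hE.boundary_of_not hE' (hE.symm h) h'')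
  have hyz : y ≠ z := fun e => hE.cross_ne h (by rw [e, planeCross_self])
  have main : ∀ {q r}, E' y q → E' z r → ∃ s t : ℝ, 0 < s ∧ 0 < t ∧
      edgeOut y q + edgeOut z r = s • y + t • z := fun hq hr =>
    edgeOut_add_mem_cone (hE.opposite hE' h hq fun e => h' (e ▸ hq))
      (hE.opposite hE' (hE.symm h) hr fun e => h'' (e ▸ hr))
  rcases hy with rfl | rfl <;> rcases hz with rfl | rfl
  · exact absurd rfl hyz
  · exact ⟨main h1 h2, fun p hp => (hb p).1 hp⟩
  · rw [add_comm]
    exact ⟨main h2 h1, fun p hp => ((hb p).1 hp).symm⟩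
  · exact absurd rfl hyz

/-- Counterclockwise the order is `y`, `y'`, `n`, with `n` inside the cone of `y` and `z`. So `y'`
lies in this cone, and it is not `z`, which comes after `n`. -/
lemma IsFan.left_eq_of_common (hE : IsFan P E) {y z y' n : Plane} (h : E y z) (hy' : y' ∈ P)
    (hn : ∃ s t : ℝ, 0 < s ∧ 0 < t ∧ n = s • y + t • z) (hc : 0 < planeCross y z)
    (hn' : 0 < planeCross y' n) (hyy : 0 ≤ planeCross y y') : y' = y := by
  obtain ⟨s, t, hs, ht, hst⟩ := hn
  have h1 : 0 < planeCross y n := by rw [hst, planeCross_comb_right]; positivity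
  have h2 : planeCross z n < 0 := by
    rw [hst, planeCross_swap, planeCross_comb_left]; nlinarith
  have h3 := plane_cramer h1.ne' y'
  have h4 : y' = (planeCross y' n / planeCross y n + planeCross y y' / planeCross y n * s) • y +
      (planeCross y y' / planeCross y n * t) • z :=
    calc y' = (planeCross y' n / planeCross y n) • y +
        (planeCross y y' / planeCross y n) • (s • y + t • z) := by rw [← hst]; exact h3
      _ = _ := by module
  rcases hE.cone h hy' _ _ (by positivity) (by positivity) h4 with e | e
  · exact e
  · rw [e] at hn'; linarith

/-- Of `y` and `y'`, whichever comes second counterclockwise lies in the cone of the other triangle,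
before `n`. -/
lemma IsFan.eq_of_common (hE : IsFan P E) (hE' : IsFan P E') {y z y' z' n : Plane} (h : E y z)
    (h' : E' y' z') (hn : ∃ s t : ℝ, 0 < s ∧ 0 < t ∧ n = s • y + t • z)
    (hn' : ∃ s t : ℝ, 0 < s ∧ 0 < t ∧ n = s • y' + t • z') (hc : 0 < planeCross y z)
    (hc' : 0 < planeCross y' z') : y = y' := by
  have pos : ∀ {a b : Plane}, 0 < planeCross a b → (∃ s t : ℝ, 0 < s ∧ 0 < t ∧ n = s • a + t • b) →
      0 < planeCross a n := by
    rintro a b hab ⟨s, t, hs, ht, rfl⟩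
    rw [planeCross_comb_right]; positivity
  rcases le_total 0 (planeCross y y') with h0 | h0
  · exact (hE.left_eq_of_common h (hE'.mem h') hn hc (pos hc' hn') h0).symm
  · exact hE'.left_eq_of_common h' (hE.mem h) hn' hc' (pos hc hn)
      (by rw [planeCross_swap]; linarith)

lemma IsFan.right_eq_of_common (hE : IsFan P E) {y z z' n : Plane} (h : E y z) (hz' : z' ∈ P)
    (hn : ∃ s t : ℝ, 0 < s ∧ 0 < t ∧ n = s • y + t • z) (hc : 0 < planeCross y z)
    (hn' : 0 < planeCross n z') (hzz : 0 ≤ planeCross z' z) : z' = z := by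
  obtain ⟨s, t, hs, ht, hst⟩ := hn
  have h1 : 0 < planeCross n z := by rw [hst, planeCross_comb_left]; positivity
  have h2 : planeCross n y < 0 := by
    rw [hst, planeCross_swap, planeCross_comb_right]; nlinarith
  have h3 := plane_cramer h1.ne' z'
  have h4 : z' = (planeCross z' z / planeCross n z * s) • y +
      (planeCross n z' / planeCross n z + planeCross z' z / planeCross n z * t) • z :=
    calc z' = (planeCross z' z / planeCross n z) • (s • y + t • z) +
        (planeCross n z' / planeCross n z) • z := by rw [← hst]; exact h3
      _ = _ := by module
  rcases hE.cone h hz' _ _ (by positivity) (by positivity) h4 with e | e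
  · rw [e] at hn'; linarith
  · exact e

lemma IsFan.eq_of_common' (hE : IsFan P E) (hE' : IsFan P E') {y z y' z' n : Plane} (h : E y z)
    (h' : E' y' z') (hn : ∃ s t : ℝ, 0 < s ∧ 0 < t ∧ n = s • y + t • z)
    (hn' : ∃ s t : ℝ, 0 < s ∧ 0 < t ∧ n = s • y' + t • z') (hc : 0 < planeCross y z)
    (hc' : 0 < planeCross y' z') : z = z' := by
  have pos : ∀ {a b : Plane}, 0 < planeCross a b → (∃ s t : ℝ, 0 < s ∧ 0 < t ∧ n = s • a + t • b) →
      0 < planeCross n b := by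
    rintro a b hab ⟨s, t, hs, ht, rfl⟩
    rw [planeCross_comb_left]; positivity
  rcases le_total 0 (planeCross z' z) with h0 | h0
  · exact (hE.right_eq_of_common h (hE'.mem (hE'.symm h')) hn hc (pos hc' hn') h0).symm
  · exact hE'.right_eq_of_common h' (hE.mem (hE.symm h)) hn' hc' (pos hc hn)
      (by rw [planeCross_swap]; linarith)

/-- Open cones of triangles over the same set of neighbours are equal or disjoint. The four cases
are the orientations of the two triangles. -/
lemma IsFan.of_common_cone (hE : IsFan P E) (hE' : IsFan P E') {y z y' z' n : Plane} (h : E y z)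
    (h' : E' y' z') (hn : ∃ s t : ℝ, 0 < s ∧ 0 < t ∧ n = s • y + t • z)
    (hn' : ∃ s t : ℝ, 0 < s ∧ 0 < t ∧ n = s • y' + t • z') : E' y z := by
  have swap : ∀ {a b : Plane}, (∃ s t : ℝ, 0 < s ∧ 0 < t ∧ n = s • a + t • b) →
      ∃ s t : ℝ, 0 < s ∧ 0 < t ∧ n = s • b + t • a := by
    rintro a b ⟨s, t, hs, ht, e⟩
    exact ⟨t, s, ht, hs, by rw [e, add_comm]⟩
  have neg : ∀ {a b : Plane}, planeCross a b < 0 → 0 < planeCross b a := fun hab => by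
    rw [planeCross_swap]; linarith
  rcases lt_or_gt_of_ne (hE.cross_ne h) with hc | hc <;>
    rcases lt_or_gt_of_ne (hE'.cross_ne h') with hc' | hc'
  · rw [hE.eq_of_common hE' (hE.symm h) (hE'.symm h') (swap hn) (swap hn') (neg hc) (neg hc'),
      hE.eq_of_common' hE' (hE.symm h) (hE'.symm h') (swap hn) (swap hn') (neg hc) (neg hc')]
    exact h'
  · rw [hE.eq_of_common hE' (hE.symm h) h' (swap hn) hn' (neg hc) hc',
      hE.eq_of_common' hE' (hE.symm h) h' (swap hn) hn' (neg hc) hc']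
    exact hE'.symm h'
  · rw [hE.eq_of_common hE' h (hE'.symm h') hn (swap hn') hc (neg hc'),
      hE.eq_of_common' hE' h (hE'.symm h') hn (swap hn') hc (neg hc')]
    exact hE'.symm h'
  · rw [hE.eq_of_common hE' h h' hn hn' hc hc', hE.eq_of_common' hE' h h' hn hn' hc hc']
    exact h'

lemma cone_normalize {y z N : Plane} (hc : planeCross y z ≠ 0)
    (hN : ∃ s t : ℝ, 0 < s ∧ 0 < t ∧ N = s • y + t • z) :
    ∃ s t : ℝ, 0 < s ∧ 0 < t ∧ ‖N‖⁻¹ • N = s • y + t • z := by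
  obtain ⟨s, t, hs, ht, e⟩ := hN
  have h0 : 0 < ‖N‖⁻¹ := by
    refine inv_pos.2 (norm_pos_iff.2 fun h => ?_)
    have := planeCross_comb_left s t y z
    rw [← e, h] at this
    simp [planeCross] at this
    rcases this with h | h
    · exact hs.ne' h
    · exact hc (by simpa [planeCross] using h)
  exact ⟨‖N‖⁻¹ * s, ‖N‖⁻¹ * t, by positivity, by positivity, by
    calc ‖N‖⁻¹ • N = ‖N‖⁻¹ • (s • y + t • z) := by rw [← e]
      _ = _ := by module⟩

/-- A triangle of `E` missing from `E'` shows the gap of `E'`, and the common normal points into it.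
If `E'` also has a triangle missing from `E`, the normal lies in both open cones and the triangles
coincide. Otherwise `E'` is contained in `E`; a boundary edge of `E` is then a side of the missing
triangle and belongs to no other, so that `E'` has no triangle there. -/
lemma IsFan.subset_of_normal (hE : IsFan P E) (hE' : IsFan P E') {N N' : Plane}
    (hN : IsNormalSum P E N) (hN' : IsNormalSum P E' N') (hn : ‖N‖⁻¹ • N = ‖N'‖⁻¹ • N')
    {y z : Plane} (h : E y z) : E' y z := by
  by_contra h'
  obtain ⟨hcone, hbd⟩ := hE.normal_mem_cone hE' h h' hN'
  by_cases hsub : ∀ a b, E' a b → E a b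
  · obtain ⟨p, p₂, q₁, q₂, -, -, -, hb, -⟩ := hN
    have hp := (hb p).2 (Or.inl rfl)
    have hp' : FanBoundary P E' p :=
      ⟨hp.1, fun q q' hq hq' => hp.2 q q' (hsub _ _ hq) (hsub _ _ hq')⟩
    obtain ⟨q, hq⟩ := hE'.exists_nbr hp.1
    rcases hbd p hp' with rfl | rfl
    · exact h' (hp.2 q z (hsub _ _ hq) h ▸ hq)
    · exact h' (hE'.symm (hp.2 q y (hsub _ _ hq) (hE.symm h) ▸ hq))
  · push Not at hsub
    obtain ⟨a, b, hab', hab⟩ := hsub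
    obtain ⟨hcone', -⟩ := hE'.normal_mem_cone hE hab' hab hN
    have h1 := cone_normalize (hE.cross_ne h) hcone
    have h2 := cone_normalize (hE'.cross_ne hab') hcone'
    rw [hn] at h2
    exact h' (hE.of_common_cone hE' h hab' h1 h2)

/-- Two fans with boundary on the same set of neighbours and with the same normal are equal. -/
lemma IsFan.eq_of_normal (hE : IsFan P E) (hE' : IsFan P E') {N N' : Plane}
    (hN : IsNormalSum P E N) (hN' : IsNormalSum P E' N') (hn : ‖N‖⁻¹ • N = ‖N'‖⁻¹ • N')
    (y z : Plane) : E y z ↔ E' y z :=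
  ⟨hE.subset_of_normal hE' hN hN' hn, hE'.subset_of_normal hE hN' hN hn.symm⟩

/-- The sum of the two boundary normals does not vanish: the fan has no opposite boundary edges with
triangles on opposite sides. -/
lemma IsNormalSum.ne_zero (hE : IsFan P E) (hP : P.Finite) {N : Plane}
    (hN : IsNormalSum P E N) : N ≠ 0 := by
  obtain ⟨p₁, p₂, q₁, q₂, hne, h1, h2, hb, rfl⟩ := hN
  intro h0
  have hc1 := hE.cross_ne h1
  have hc2 := hE.cross_ne h2
  have hp1 : p₁ ≠ 0 := fun e => hc1 (by simp [e, planeCross])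
  have hp2 : p₂ ≠ 0 := fun e => hc2 (by simp [e, planeCross])
  set σ : ℝ := (SignType.sign (planeCross p₁ q₁) : ℝ) with hσ
  set τ : ℝ := (SignType.sign (planeCross p₂ q₂) : ℝ) with hτ
  have hσσ : σ * σ = 1 := by
    rcases lt_or_gt_of_ne hc1 with h | h <;> simp [hσ, h]
  have hττ : τ * τ = 1 := by
    rcases lt_or_gt_of_ne hc2 with h | h <;> simp [hτ, h]
  have hσp : 0 < σ * planeCross p₁ q₁ := by
    rcases lt_or_gt_of_ne hc1 with h | h <;> simp [hσ, h]
  have hτp : 0 < τ * planeCross p₂ q₂ := by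
    rcases lt_or_gt_of_ne hc2 with h | h <;> simp [hτ, h]
  have n1 : 0 < ‖p₁‖ := norm_pos_iff.2 hp1
  have n2 : 0 < ‖p₂‖ := norm_pos_iff.2 hp2
  have hpar : p₂ = (-(τ * σ) * ‖p₂‖ / ‖p₁‖) • p₁ := by
    have e0 := congrFun (congrArg WithLp.ofLp h0) 0
    have e1 := congrFun (congrArg WithLp.ofLp h0) 1
    simp [edgeOut, planeRot, ← hσ, ← hτ] at e0 e1
    field_simp at e0 e1
    refine plane_ext ?_ ?_ <;> simp only [PiLp.smul_apply, smul_eq_mul] <;> field_simp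
    · linear_combination (-τ) * e1 - ‖p₁‖ * p₂ 0 * hττ
    · linear_combination τ * e0 - ‖p₁‖ * p₂ 1 * hττ
  have hmem1 := hE.mem h1
  have hmem2 := hE.mem h2
  -- With different signs `p₂` would be a positive multiple of `p₁`, hence in the cone of the first
  -- triangle. So the two edges point in opposite directions.
  have hστ : τ = σ := by
    by_contra hst
    have : τ * σ = -1 := by
      have : (τ - σ) * (τ * σ + 1) = 0 := by linear_combination σ * hττ - τ * hσσ
      rcases mul_eq_zero.1 this with h | h
      · exact absurd (sub_eq_zero.1 h) hst
      · linarith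
    rw [this] at hpar
    rcases hE.cone h1 hmem2 (- -1 * ‖p₂‖ / ‖p₁‖) 0 (by positivity) le_rfl
      (by simpa using hpar) with e | e
    · exact hne e.symm
    · apply hc1; rw [← e, hpar, planeCross_smul_right, planeCross_self, mul_zero]
  rw [hστ, hσσ] at hpar
  rw [hστ] at hτp
  -- `f` is the signed side of the line through the two edges, positive at `q₁`; the point `q₂` lies
  -- on the other side.
  set f : Plane → ℝ := fun v => σ * planeCross p₁ v with hf
  have hq2 : f q₂ < 0 := by
    rw [hpar, planeCross_smul_left] at hτp
    have : σ * (-1 * ‖p₂‖ / ‖p₁‖ * planeCross p₁ q₂) = -(‖p₂‖ / ‖p₁‖) * f q₂ := by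
      simp only [hf]; ring
    rw [this] at hτp
    have : 0 < ‖p₂‖ / ‖p₁‖ := by positivity
    nlinarith
  -- Among the neighbours strictly on the negative side, `p` is the closest to `p₁` in angle: the
  -- quotient is the cotangent of this angle.
  obtain ⟨p, ⟨hpP, hpf⟩, hmax⟩ := Set.exists_max_image {p ∈ P | f p < 0}
    (fun p => (p₁ 0 * p 0 + p₁ 1 * p 1) / (-f p)) (hP.subset fun p hp => hp.1)
    ⟨q₂, hE.mem (hE.symm h2), hq2⟩
  have hnb : ¬FanBoundary P E p := by
    rw [hb]
    rintro (rfl | rfl)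
    · simp [hf, planeCross_self] at hpf
    · simp only [hf] at hpf
      rw [hpar, planeCross_smul_right, planeCross_self] at hpf; simp at hpf
  have hcross : planeCross p p₁ ≠ 0 := fun e => by
    rw [planeCross_swap, neg_eq_zero] at e; simp [hf, e] at hpf
  -- An edge off the boundary has triangles on both sides; `r` spans the one towards `p₁`.
  obtain ⟨r, hr, hrs⟩ : ∃ r, E p r ∧ 0 < planeCross p r * planeCross p p₁ := by
    simp only [FanBoundary, not_and, not_forall] at hnb
    obtain ⟨r, r', hr, hr', hrr⟩ := hnb hpP
    have := hE.opposite hE hr hr' hrr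
    rcases lt_trichotomy (planeCross p r * planeCross p p₁) 0 with h | h | h
    · refine ⟨r', hr', ?_⟩
      have h3 := mul_pos_of_neg_of_neg this h
      have : 0 < planeCross p r ^ 2 * (planeCross p r' * planeCross p p₁) := h3.trans_eq (by ring)
      exact pos_of_mul_pos_right this (sq_nonneg _)
    · exact absurd h (mul_ne_zero (hE.cross_ne hr) hcross)
    · exact ⟨r, hr, h⟩
  obtain ⟨β, hβ⟩ : ∃ β, β = planeCross p r / planeCross p p₁ := ⟨_, rfl⟩
  obtain ⟨α, hα⟩ : ∃ α, α = planeCross r p₁ / planeCross p p₁ := ⟨_, rfl⟩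
  have hrexp : r = α • p + β • p₁ := by rw [hα, hβ]; exact plane_cramer hcross r
  have hβ0 : 0 < β := by
    rw [hβ, ← mul_div_mul_right _ _ hcross]; exact div_pos hrs (mul_self_pos.2 hcross)
  have hfr : f r = α * f p := by
    simp only [hf]
    conv_lhs => rw [hrexp, add_comm, planeCross_comb_right]
    ring
  -- Either `r` is still on the negative side and closer to `p₁` than `p`, or `p₁` lies in the cone
  -- of `p` and `r`. In the latter case `r = p₁`, and `p₁` has a second triangle, on the side away
  -- from `q₁`.
  rcases lt_or_ge 0 α with hα0 | hα0
  · have hfr0 : f r < 0 := by rw [hfr]; exact mul_neg_of_pos_of_neg hα0 hpf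
    have := hmax r ⟨hE.mem (hE.symm hr), hfr0⟩
    simp only at this
    rw [div_le_div_iff₀ (by linarith) (by linarith), hfr] at this
    have e : p₁ 0 * r 0 + p₁ 1 * r 1 = α * (p₁ 0 * p 0 + p₁ 1 * p 1) + β * ‖p₁‖ ^ 2 := by
      rw [plane_norm_sq, hrexp]; simp; ring
    rw [e] at this
    have : 0 < β * ‖p₁‖ ^ 2 * -f p := mul_pos (by positivity) (by linarith)
    nlinarith
  · have e : p₁ = (-α / β) • p + (1 / β) • r := by
      rw [hrexp]
      have : (-α / β) • p + (1 / β) • (α • p + β • p₁) = (β / β) • p₁ := by module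
      rw [this, div_self hβ0.ne', one_smul]
    rcases hE.cone hr hmem1 _ _ (div_nonneg (by linarith) hβ0.le) (by positivity) e with e | e
    · simp [← e, hf, planeCross_self] at hpf
    · rw [← e] at hr
      have := ((hb p₁).2 (Or.inl rfl)).2 q₁ p h1 (hE.symm hr)
      rw [← this] at hpf
      linarith

end Fan

/-! ### The fan of a mesh node -/

lemma fin3_cases (r s : Fin 3) : s = r ∨ s = r + 1 ∨ s = r + 2 := by
  revert r s; decide

lemma fin3_third {r s : Fin 3} (h : r ≠ s) : ∃ t, r ≠ t ∧ s ≠ t ∧ ∀ u, u = r ∨ u = s ∨ u = t := by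
  revert r s; decide

lemma fin3_succ_ne (r : Fin 3) : r ≠ r + 1 ∧ r ≠ r + 2 ∧ r + 1 ≠ r + 2 := by
  revert r; decide

lemma fin3_pair {r s t : Fin 3} (h1 : r ≠ s) (h2 : r ≠ t) (h3 : s ≠ t) :
    (s = r + 1 ∧ t = r + 2) ∨ (s = r + 2 ∧ t = r + 1) := by
  revert r s t; decide

lemma fin3_unique {r s t t' : Fin 3} (h1 : r ≠ s) (h2 : r ≠ t) (h3 : s ≠ t) (h4 : r ≠ t')
    (h5 : s ≠ t') : t = t' := by
  revert r s t t'; decide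

lemma planeRot_norm (v : Plane) : ‖planeRot v‖ = ‖v‖ := by
  rw [← sq_eq_sq₀ (norm_nonneg _) (norm_nonneg _), plane_norm_sq, plane_norm_sq]
  simp [planeRot]; ring

namespace PoissonProblem

variable {G G' : PoissonProblem}

lemma det_rotate (a : Fin G.numTri) (r : Fin 3) : G.det a =
    planeCross (G.vertex a (r + 1) - G.vertex a r) (G.vertex a (r + 2) - G.vertex a r) := by
  fin_cases r <;> simp [det, planeCross] <;> ring

namespace IsMesh

lemma cross_ne (hG : G.IsMesh) (a : Fin G.numTri) (r : Fin 3) :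
    planeCross (G.vertex a (r + 1) - G.vertex a r) (G.vertex a (r + 2) - G.vertex a r) ≠ 0 :=
  det_rotate a r ▸ hG.nondegenerate a

lemma vertex_injective (hG : G.IsMesh) (a : Fin G.numTri) : Function.Injective (G.vertex a) := by
  intro r s h
  have h1 := hG.cross_ne a r
  rcases fin3_cases r s with rfl | rfl | rfl
  · rfl
  · rw [h] at h1; simp [planeCross] at h1
  · rw [h] at h1; simp [planeCross] at h1

lemma tri_injective (hG : G.IsMesh) (a : Fin G.numTri) : Function.Injective (G.tri a) :=
  fun r s h => hG.vertex_injective a (by rw [vertex, vertex, h])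

lemma exists_tri_of_mem_boundaryEdgesAt {i : Fin G.numNodes} {e : Fin G.numTri × Fin 3}
    (he : e ∈ G.boundaryEdgesAt i) : ∃ r, G.tri e.1 r = i := by
  simp only [boundaryEdgesAt, Finset.mem_filter] at he
  rcases he.2.2 with h | h
  exacts [⟨_, h⟩, ⟨_, h⟩]

lemma exists_tri (hG : G.IsMesh) (i : Fin G.numNodes) : ∃ a r, G.tri a r = i := by
  by_cases hi : G.kind i = NodeKind.interior
  · obtain ⟨j, hj⟩ := hG.exists_dirichlet
    have hij : i ≠ j := fun e => by rw [e, hj] at hi; exact absurd hi (by decide)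
    obtain ⟨w⟩ := hG.connected.preconnected i j
    cases w with
    | nil => exact absurd rfl hij
    | cons h _ =>
      obtain ⟨-, a, r, s, h1, -⟩ := h
      exact ⟨a, r, h1⟩
  · have h2 := hG.boundary_polygon i hi
    obtain ⟨e, he⟩ := Finset.card_pos.1 (h2.symm ▸ two_pos)
    obtain ⟨r, hr⟩ := exists_tri_of_mem_boundaryEdgesAt he
    exact ⟨_, r, hr⟩

lemma vertex_mem_hull (a : Fin G.numTri) (r : Fin 3) :
    G.vertex a r ∈ convexHull ℝ (Set.range (G.vertex a)) :=
  subset_convexHull ℝ _ ⟨r, rfl⟩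

/-- A common point of two triangles lies in the hull of their common vertices. If the vertex of the
first triangle were not a vertex of the second, this hull would lie in the opposite edge of the
first, which misses that vertex. -/
lemma pos_injective (hG : G.IsMesh) : Function.Injective G.pos := by
  intro i j hij
  obtain ⟨a, r, rfl⟩ := hG.exists_tri i
  obtain ⟨b, s, rfl⟩ := hG.exists_tri j
  change G.vertex a r = G.vertex b s at hij
  by_cases hab : a = b
  · subst hab; rw [hG.vertex_injective a hij]
  have hmem := hG.conforming a b hab ⟨vertex_mem_hull a r, hij ▸ vertex_mem_hull b s⟩
  by_cases hc : G.tri a r ∈ Set.range (G.tri b)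
  · obtain ⟨t, ht⟩ := hc
    have : G.vertex b t = G.vertex b s := by rw [← hij, vertex, ht, vertex]
    rw [← ht, hG.vertex_injective b this]
  · have hsub : G.pos '' (Set.range (G.tri a) ∩ Set.range (G.tri b)) ⊆
        {G.vertex a (r + 1), G.vertex a (r + 2)} := by
      rintro _ ⟨_, ⟨⟨t, rfl⟩, ht⟩, rfl⟩
      rcases fin3_cases r t with rfl | rfl | rfl
      · exact absurd ht hc
      · exact Or.inl rfl
      · exact Or.inr rfl
    have h2 := convexHull_mono hsub hmem
    rw [convexHull_pair] at h2
    obtain ⟨s, t, -, -, hst, h3⟩ := h2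
    have h4 := hG.cross_ne a r
    rw [← h3] at h4
    exfalso
    apply h4
    have e : t = 1 - s := by linarith
    subst e
    simp [planeCross]; ring

/-- A neighbour of a node in the closed cone of a triangle at this node is a vertex of the
triangle. -/
lemma cone (hG : G.IsMesh) {a b : Fin G.numTri} {r s s' : Fin 3} (hab : G.tri a r = G.tri b s)
    (hs : s ≠ s') {S T : ℝ} (hS : 0 ≤ S) (hT : 0 ≤ T)
    (h : G.vertex b s' - G.vertex b s =
      S • (G.vertex a (r + 1) - G.vertex a r) + T • (G.vertex a (r + 2) - G.vertex a r)) :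
    G.tri b s' = G.tri a (r + 1) ∨ G.tri b s' = G.tri a (r + 2) := by
  have hv : G.vertex a r = G.vertex b s := by rw [vertex, hab, vertex]
  by_cases hc : G.tri b s' ∈ Set.range (G.tri a)
  · obtain ⟨t, ht⟩ := hc
    rcases fin3_cases r t with rfl | rfl | rfl
    · exact absurd (hG.tri_injective b (hab.symm.trans ht)) hs
    · exact Or.inl ht.symm
    · exact Or.inr ht.symm
  exfalso
  have hne : a ≠ b := by rintro rfl; exact hc ⟨s', rfl⟩
  obtain ⟨s'', hs1, hs2, hs''⟩ := fin3_third hs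
  have hτ : 0 < 1 + S + T := by positivity
  -- Scaled by `(1 + S + T)⁻¹`, the vector ends in the triangle `a`, and it still ends on an edge of
  -- `b`; so the point is common to both triangles.
  have hX : G.vertex b s + (1 + S + T)⁻¹ • (G.vertex b s' - G.vertex b s) ∈
      convexHull ℝ (Set.range (G.vertex a)) ∩ convexHull ℝ (Set.range (G.vertex b)) := by
    constructor
    · rw [h, ← hv]
      have := (convex_convexHull ℝ (Set.range (G.vertex a))).sum_mem
        (t := Finset.univ) (w := ![(1 + S + T)⁻¹, (1 + S + T)⁻¹ * S, (1 + S + T)⁻¹ * T])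
        (z := ![G.vertex a r, G.vertex a (r + 1), G.vertex a (r + 2)])
        (by intro i _; fin_cases i <;> simp <;> positivity)
        (by simp [Fin.sum_univ_three]; field_simp)
        (by intro i _; fin_cases i <;> exact vertex_mem_hull a _)
      convert this using 1
      simp only [Fin.sum_univ_three, Matrix.cons_val]
      have e : (1 : ℝ) = (1 + S + T)⁻¹ + (1 + S + T)⁻¹ * S + (1 + S + T)⁻¹ * T := by field_simp
      have : G.vertex a r =
          ((1 + S + T)⁻¹ + (1 + S + T)⁻¹ * S + (1 + S + T)⁻¹ * T) • G.vertex a r :=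
        by rw [← e, one_smul]
      calc G.vertex a r + (1 + S + T)⁻¹ • (S • (G.vertex a (r + 1) - G.vertex a r) +
            T • (G.vertex a (r + 2) - G.vertex a r))
          = ((1 + S + T)⁻¹ + (1 + S + T)⁻¹ * S + (1 + S + T)⁻¹ * T) • G.vertex a r +
            (1 + S + T)⁻¹ • (S • (G.vertex a (r + 1) - G.vertex a r) +
            T • (G.vertex a (r + 2) - G.vertex a r)) := by rw [← this]
        _ = _ := by module
    · have h1 : (1 + S + T)⁻¹ ≤ 1 := inv_le_one_of_one_le₀ (by linarith)
      exact (convex_convexHull ℝ _).add_smul_sub_mem (vertex_mem_hull b s) (vertex_mem_hull b s')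
        ⟨by positivity, h1⟩
  have hsub : G.pos '' (Set.range (G.tri a) ∩ Set.range (G.tri b)) ⊆
      {G.vertex b s, G.vertex b s''} := by
    rintro _ ⟨_, ⟨ha, ⟨t, rfl⟩⟩, rfl⟩
    rcases hs'' t with rfl | rfl | rfl
    · exact Or.inl rfl
    · exact absurd ha hc
    · exact Or.inr rfl
  have h2 := convexHull_mono hsub (hG.conforming a b hne hX)
  rw [convexHull_pair] at h2
  obtain ⟨α, β, -, -, hαβ, h3⟩ := h2
  -- By conformity the common point also lies on the edge of `b` from `s` to `s''`, so two edges of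
  -- `b` are parallel.
  have h4 : G.vertex b s' - G.vertex b s = ((1 + S + T) * β) • (G.vertex b s'' - G.vertex b s) := by
    have e : α = 1 - β := by linarith
    subst e
    have h5 : (1 + S + T)⁻¹ • (G.vertex b s' - G.vertex b s) =
        β • (G.vertex b s'' - G.vertex b s) := by
      have : (1 + S + T)⁻¹ • (G.vertex b s' - G.vertex b s) =
          (1 - β) • G.vertex b s + β • G.vertex b s'' - G.vertex b s := by
        rw [h3, add_sub_cancel_left]
      rw [this]; module
    rw [mul_smul, ← h5, smul_smul, mul_inv_cancel₀ hτ.ne', one_smul]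
  have h5 := hG.cross_ne b s
  rcases fin3_pair hs hs1 hs2 with ⟨rfl, rfl⟩ | ⟨rfl, rfl⟩
  · rw [h4, planeCross_smul_left, planeCross_self, mul_zero] at h5; exact h5 rfl
  · rw [h4, planeCross_smul_right, planeCross_self, mul_zero] at h5; exact h5 rfl

end IsMesh

/-- The neighbours of a node, as vectors from this node. -/
def starNbrs (G : PoissonProblem) (i : Fin G.numNodes) : Set Plane :=
  {v | ∃ k, G.graph.Adj i k ∧ v = G.pos k - G.pos i}

/-- The two vectors span a triangle with the node `i`. -/
def StarTri (G : PoissonProblem) (i : Fin G.numNodes) (y z : Plane) : Prop :=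
  ∃ a r, G.tri a r = i ∧ ((y = G.vertex a (r + 1) - G.pos i ∧ z = G.vertex a (r + 2) - G.pos i) ∨
    (y = G.vertex a (r + 2) - G.pos i ∧ z = G.vertex a (r + 1) - G.pos i))

lemma StarTri.symm {i : Fin G.numNodes} {y z : Plane} (h : G.StarTri i y z) : G.StarTri i z y := by
  obtain ⟨a, r, h1, h2⟩ := h
  exact ⟨a, r, h1, h2.symm.imp And.symm And.symm⟩

lemma starTri_of_tri {a : Fin G.numTri} {r s t : Fin 3} (hrs : r ≠ s) (hrt : r ≠ t) (hst : s ≠ t) :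
    G.StarTri (G.tri a r) (G.vertex a s - G.pos (G.tri a r))
      (G.vertex a t - G.pos (G.tri a r)) := by
  refine ⟨a, r, rfl, ?_⟩
  rcases fin3_pair hrs hrt hst with ⟨rfl, rfl⟩ | ⟨rfl, rfl⟩
  exacts [Or.inl ⟨rfl, rfl⟩, Or.inr ⟨rfl, rfl⟩]

/-- A pair of adjacent neighbours comes from a triangle with distinct indices. -/
lemma StarTri.exists_indices {i : Fin G.numNodes} {y z : Plane} (h : G.StarTri i y z) :
    ∃ a r s t, r ≠ s ∧ r ≠ t ∧ s ≠ t ∧ G.tri a r = i ∧ y = G.vertex a s - G.pos i ∧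
      z = G.vertex a t - G.pos i := by
  obtain ⟨a, r, h1, h2⟩ := h
  have e := fin3_succ_ne r
  rcases h2 with h2 | h2
  · exact ⟨a, r, r + 1, r + 2, e.1, e.2.1, e.2.2, h1, h2.1, h2.2⟩
  · exact ⟨a, r, r + 2, r + 1, e.2.1, e.1, e.2.2.symm, h1, h2.1, h2.2⟩

lemma starNbrs_finite (i : Fin G.numNodes) : (G.starNbrs i).Finite :=
  (Set.finite_range fun k => G.pos k - G.pos i).subset fun _ ⟨k, _, h⟩ => ⟨k, h.symm⟩

namespace IsMesh

lemma adj_of_tri (hG : G.IsMesh) {a : Fin G.numTri} {r s : Fin 3} (h : r ≠ s) :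
    G.graph.Adj (G.tri a r) (G.tri a s) :=
  ⟨fun e => h (hG.tri_injective a e), a, r, s, rfl, rfl⟩

lemma isFan (hG : G.IsMesh) (i : Fin G.numNodes) : IsFan (G.starNbrs i) (G.StarTri i) where
  symm := StarTri.symm
  mem h := by
    obtain ⟨a, r, s, t, hrs, -, -, rfl, rfl, -⟩ := h.exists_indices
    exact ⟨_, hG.adj_of_tri hrs, rfl⟩
  cross_ne h := by
    obtain ⟨a, r, rfl, ⟨rfl, rfl⟩ | ⟨rfl, rfl⟩⟩ := h
    · exact hG.cross_ne a r
    · rw [planeCross_swap]; exact neg_ne_zero.2 (hG.cross_ne a r)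
  cone {y z p} h hp S T hS hT e := by
    obtain ⟨k, ⟨hne, b, s, s', hs, rfl⟩, rfl⟩ := hp
    have hss : s ≠ s' := by rintro rfl; exact hne hs.symm
    obtain ⟨a, r, hr, h⟩ := h
    have key : ∀ {S T : ℝ}, 0 ≤ S → 0 ≤ T → G.pos (G.tri b s') - G.pos i =
        S • (G.vertex a (r + 1) - G.pos i) + T • (G.vertex a (r + 2) - G.pos i) →
        G.tri b s' = G.tri a (r + 1) ∨ G.tri b s' = G.tri a (r + 2) := by
      intro S T hS hT e
      refine hG.cone (hr.trans hs.symm) hss hS hT ?_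
      have e1 : G.vertex a r = G.pos i := by rw [vertex, hr]
      have e2 : G.vertex b s = G.pos i := by rw [vertex, hs]
      rw [e1, e2]; exact e
    rcases h with ⟨rfl, rfl⟩ | ⟨rfl, rfl⟩
    · rcases key hS hT e with h | h
      · left; rw [h, vertex]
      · right; rw [h, vertex]
    · rw [add_comm] at e
      rcases key hT hS e with h | h
      · right; rw [h, vertex]
      · left; rw [h, vertex]
  exists_nbr := by
    rintro _ ⟨k, ⟨hne, a, r, s, rfl, rfl⟩, rfl⟩
    have hrs : r ≠ s := by rintro rfl; exact hne rfl
    obtain ⟨t, hrt, hst, -⟩ := fin3_third hrs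
    exact ⟨_, starTri_of_tri hrs hrt hst⟩

/-! Boundary edges -/

lemma mem_boundaryEdgesAt {i : Fin G.numNodes} {e : Fin G.numTri × Fin 3} :
    e ∈ G.boundaryEdgesAt i ↔ G.IsBoundaryEdge e.1 e.2 ∧
    ∃ s t, e.2 ≠ s ∧ e.2 ≠ t ∧ s ≠ t ∧ G.tri e.1 s = i := by
  simp only [boundaryEdgesAt, Finset.mem_filter, Finset.mem_univ, true_and]
  refine and_congr_right fun _ => ⟨?_, ?_⟩
  · have key : ∀ r : Fin 3, r ≠ r + 1 ∧ r ≠ r + 2 ∧ r + 1 ≠ r + 2 := by decide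
    have ⟨h1, h2, h3⟩ := fin3_succ_ne e.2
    rintro (h | h)
    · exact ⟨_, _, h1, h2, h3, h⟩
    · exact ⟨_, _, h2, h1, h3.symm, h⟩
  · rintro ⟨s, t, h1, h2, h3, h⟩
    rcases fin3_cases e.2 s with h' | h' | h'
    · exact absurd h'.symm h1
    · left; rw [← h', h]
    · right; rw [← h', h]

lemma isBoundaryEdge_iff {a : Fin G.numTri} {r s t : Fin 3} (h1 : r ≠ s) (h2 : r ≠ t) (h3 : s ≠ t) :
    G.IsBoundaryEdge a r ↔
      ∀ b, (∃ u, G.tri b u = G.tri a s) → (∃ u, G.tri b u = G.tri a t) → b = a := by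
  rcases fin3_pair h1 h2 h3 with ⟨rfl, rfl⟩ | ⟨rfl, rfl⟩
  · rfl
  · exact forall_congr' fun b => ⟨fun h x y => h y x, fun h x y => h y x⟩

lemma edgeNormal_eq_sign (hG : G.IsMesh) (a : Fin G.numTri) (r : Fin 3) : G.edgeNormal a r =
    -((SignType.sign (G.det a) : ℝ) / ‖G.vertex a (r + 2) - G.vertex a (r + 1)‖) •
      planeRot (G.vertex a (r + 2) - G.vertex a (r + 1)) := by
  have hd := hG.nondegenerate a
  have h := sign_mul_abs (G.det a)
  rw [edgeNormal, hatGrad, norm_smul, planeRot_norm, smul_smul, neg_smul]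
  congr 2
  have ha : |G.det a| ≠ 0 := abs_ne_zero.2 hd
  rw [norm_inv, Real.norm_eq_abs, mul_inv, inv_inv, eq_div_of_mul_eq ha h]
  field_simp
  rw [sq_abs]

/-- The gradient of the hat function of `r` points from the opposite edge towards `r`, so its
negative direction is the fan normal seen from either end of this edge. -/
lemma edgeNormal_eq (hG : G.IsMesh) {a : Fin G.numTri} {r s t : Fin 3} (h1 : r ≠ s) (h2 : r ≠ t)
    (h3 : s ≠ t) : G.edgeNormal a r =
      edgeOut (G.vertex a t - G.vertex a s) (G.vertex a r - G.vertex a s) := by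
  rw [hG.edgeNormal_eq_sign, det_rotate a r, edgeOut]
  have hc : planeCross (G.vertex a (r + 1) - G.vertex a r) (G.vertex a (r + 2) - G.vertex a r) =
      planeCross (G.vertex a (r + 2) - G.vertex a (r + 1)) (G.vertex a r - G.vertex a (r + 1)) := by
    simp [planeCross]; ring
  rcases fin3_pair h1 h2 h3 with ⟨rfl, rfl⟩ | ⟨rfl, rfl⟩
  · rw [hc]
  · have hc' : planeCross (G.vertex a (r + 1) - G.vertex a (r + 2))
        (G.vertex a r - G.vertex a (r + 2)) = -planeCross (G.vertex a (r + 1) - G.vertex a r)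
        (G.vertex a (r + 2) - G.vertex a r) := by
      simp [planeCross]; ring
    rw [hc', norm_sub_rev (G.vertex a (r + 1)), Left.sign_neg]
    have : planeRot (G.vertex a (r + 1) - G.vertex a (r + 2)) =
        -planeRot (G.vertex a (r + 2) - G.vertex a (r + 1)) := by
      refine plane_ext ?_ ?_ <;> simp [planeRot]
    rw [this]
    simp [neg_div]

/-- The boundary edge at `i` is a boundary edge of the fan. -/
lemma fanBoundary_of_edge (hG : G.IsMesh) {a : Fin G.numTri} {r s t : Fin 3}
    (h1 : r ≠ s) (h2 : r ≠ t) (h3 : s ≠ t) (h : G.IsBoundaryEdge a r) :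
    FanBoundary (G.starNbrs (G.tri a s)) (G.StarTri (G.tri a s))
      (G.vertex a t - G.pos (G.tri a s)) := by
  rw [isBoundaryEdge_iff h1 h2 h3] at h
  have key : ∀ q, G.StarTri (G.tri a s) (G.vertex a t - G.pos (G.tri a s)) q →
      q = G.vertex a r - G.pos (G.tri a s) := by
    intro q hq
    obtain ⟨b, r', s', t', hrs, hrt, hst, hr, hs, ht⟩ := hq.exists_indices
    have e : G.tri b s' = G.tri a t := hG.pos_injective (sub_left_injective hs).symm
    have hb := h b ⟨_, hr⟩ ⟨_, e⟩
    subst hb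
    have e1 := hG.tri_injective b hr
    have e2 := hG.tri_injective b e
    subst e1 e2
    rw [ht, fin3_unique hrs hrt hst h1.symm h2.symm]
  exact ⟨⟨_, hG.adj_of_tri h3, rfl⟩, fun q q' hq hq' => (key q hq).trans (key q' hq').symm⟩

/-- A boundary edge of the fan comes from a boundary edge of the mesh. -/
lemma edge_of_fanBoundary (hG : G.IsMesh) {i : Fin G.numNodes} {p : Plane}
    (h : FanBoundary (G.starNbrs i) (G.StarTri i) p) :
    ∃ a r s t, r ≠ s ∧ r ≠ t ∧ s ≠ t ∧ G.tri a s = i ∧ p = G.vertex a t - G.pos i ∧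
      G.IsBoundaryEdge a r := by
  obtain ⟨⟨k, ⟨hne, a, s, t, rfl, rfl⟩, rfl⟩, huniq⟩ := h
  have hst : s ≠ t := by rintro rfl; exact hne rfl
  obtain ⟨r, hs, ht, hall⟩ := fin3_third hst
  refine ⟨a, r, s, t, hs.symm, ht.symm, hst, rfl, rfl, ?_⟩
  rw [isBoundaryEdge_iff hs.symm ht.symm hst]
  rintro b ⟨s', hs'⟩ ⟨t', ht'⟩
  have hst' : s' ≠ t' := by rintro rfl; exact hst (hG.tri_injective a (hs'.symm.trans ht'))
  obtain ⟨r', hr1, hr2, hall'⟩ := fin3_third hst'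
  have h1 := starTri_of_tri (a := a) hst hs ht
  have h2 := starTri_of_tri (a := b) hst' hr1 hr2
  simp only [vertex, hs', ht'] at h1 h2
  -- Uniqueness of the fan neighbour makes the third vertices equal, so the two triangles have the
  -- same vertex set.
  have h3 := hG.pos_injective (sub_left_injective (huniq _ _ h1 h2))
  by_contra hne
  refine hG.distinct b a hne ?_
  ext k
  constructor
  · rintro ⟨u, rfl⟩
    rcases hall' u with rfl | rfl | rfl
    exacts [⟨s, hs'.symm⟩, ⟨t, ht'.symm⟩, ⟨r, h3⟩]
  · rintro ⟨u, rfl⟩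
    rcases hall u with rfl | rfl | rfl
    exacts [⟨s', hs'⟩, ⟨t', ht'⟩, ⟨r', h3.symm⟩]

lemma not_fanBoundary (hG : G.IsMesh) {i : Fin G.numNodes} (hi : G.kind i = NodeKind.interior)
    (p : Plane) : ¬FanBoundary (G.starNbrs i) (G.StarTri i) p := by
  intro h
  obtain ⟨a, r, s, t, h1, h2, h3, hs, -, hb⟩ := hG.edge_of_fanBoundary h
  have : (a, r) ∈ G.boundaryEdgesAt i := mem_boundaryEdgesAt.2 ⟨hb, s, t, h1, h2, h3, hs⟩
  rw [(hG.interior_iff i).1 hi] at this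
  simp at this

/-- Each boundary edge at `i` gives a boundary vector of the fan, and distinct edges give distinct
vectors because a boundary edge lies in one triangle only. -/
lemma isNormalSum (hG : G.IsMesh) {i : Fin G.numNodes} (hi : G.kind i ≠ NodeKind.interior) :
    IsNormalSum (G.starNbrs i) (G.StarTri i) (∑ e ∈ G.boundaryEdgesAt i, G.edgeNormal e.1 e.2) := by
  obtain ⟨⟨a, r⟩, ⟨b, u⟩, hne, hset⟩ := Finset.card_eq_two.1 (hG.boundary_polygon i hi)
  have ha : (a, r) ∈ G.boundaryEdgesAt i := by rw [hset]; simp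
  have hb : (b, u) ∈ G.boundaryEdgesAt i := by rw [hset]; simp
  obtain ⟨hba, s, t, h1, h2, h3, hs⟩ := mem_boundaryEdgesAt.1 ha
  obtain ⟨hbb, v, w, h1', h2', h3', hv⟩ := mem_boundaryEdgesAt.1 hb
  simp only at hba h1 h2 hs hbb h1' h2' hv
  have hda := hG.fanBoundary_of_edge h1 h2 h3 hba
  have hdb := hG.fanBoundary_of_edge h1' h2' h3' hbb
  have ea := hG.edgeNormal_eq (a := a) h1 h2 h3
  have eb := hG.edgeNormal_eq (a := b) h1' h2' h3'
  have ta := starTri_of_tri (a := a) h3 h1.symm h2.symm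
  have tb := starTri_of_tri (a := b) h3' h1'.symm h2'.symm
  have va : G.vertex a s = G.pos i := by rw [vertex, hs]
  have vb : G.vertex b v = G.pos i := by rw [vertex, hv]
  rw [hs] at hda ta
  rw [hv] at hdb tb
  rw [va] at ea
  rw [vb] at eb
  have uniq : ∀ {a b : Fin G.numTri} {r s t u v w : Fin 3}, r ≠ s → r ≠ t → s ≠ t → u ≠ v → u ≠ w →
      v ≠ w → G.IsBoundaryEdge a r → G.tri a s = i → G.tri b v = i →
      G.vertex a t - G.pos i = G.vertex b w - G.pos i → (a, r) = (b, u) := by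
    intro a b r s t u v w h1 h2 h3 h1' h2' h3' hb hs hv e
    have e' := hG.pos_injective (sub_left_injective e)
    have hab := (isBoundaryEdge_iff h1 h2 h3).1 hb b ⟨v, hv.trans hs.symm⟩ ⟨w, e'.symm⟩
    subst hab
    have e1 := hG.tri_injective b (hs.trans hv.symm)
    have e2 := hG.tri_injective b e'
    subst e1 e2
    rw [fin3_unique h3 h1.symm h2.symm h1'.symm h2'.symm]
  refine ⟨_, _, _, _, fun e => hne (uniq h1 h2 h3 h1' h2' h3' hba hs hv e), ta, tb, ?_, ?_⟩
  · intro p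
    refine ⟨fun hp => ?_, ?_⟩
    · obtain ⟨c, r', s', t', k1, k2, k3, hs', rfl, hbc⟩ := hG.edge_of_fanBoundary hp
      have : (c, r') ∈ G.boundaryEdgesAt i := mem_boundaryEdgesAt.2 ⟨hbc, s', t', k1, k2, k3, hs'⟩
      rw [hset, Finset.mem_insert, Finset.mem_singleton] at this
      rcases this with h | h <;> obtain ⟨rfl, rfl⟩ := Prod.mk.inj h
      · obtain rfl := hG.tri_injective _ (hs'.trans hs.symm)
        left; rw [fin3_unique k1 k2 k3 h2 h3]
      · obtain rfl := hG.tri_injective _ (hs'.trans hv.symm)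
        right; rw [fin3_unique k1 k2 k3 h2' h3']
    · rintro (rfl | rfl)
      exacts [hda, hdb]
  · rw [hset, Finset.sum_pair hne, ea, eb]

lemma normalSum_ne_zero (hG : G.IsMesh) {i : Fin G.numNodes} (hi : G.kind i ≠ NodeKind.interior) :
    ∑ e ∈ G.boundaryEdgesAt i, G.edgeNormal e.1 e.2 ≠ 0 :=
  (hG.isNormalSum hi).ne_zero (hG.isFan i) (starNbrs_finite i)

/-- The triangles at a free node are determined by the neighbours, the kind and the normal. -/
lemma starTri_iff (hG : G.IsMesh) (hG' : G'.IsMesh) {i : Fin G.numNodes} {i' : Fin G'.numNodes}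
    (hk : G.kind i = G'.kind i') (hn : G.kind i ≠ NodeKind.interior → G.normal i = G'.normal i')
    (hP : G.starNbrs i = G'.starNbrs i') (y z : Plane) : G.StarTri i y z ↔ G'.StarTri i' y z := by
  have h1 := hG.isFan i
  have h2 := hG'.isFan i'
  rw [← hP] at h2
  by_cases hi : G.kind i = NodeKind.interior
  · refine h1.eq_of_closed h2 (hG.not_fanBoundary hi) ?_ y z
    rw [hP]; exact hG'.not_fanBoundary (hk ▸ hi)
  · have h3 := hG'.isNormalSum (hk ▸ hi)
    rw [← hP] at h3
    exact h1.eq_of_normal h2 (hG.isNormalSum hi) h3 (hn hi) y z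

end IsMesh
end PoissonProblem

/-! ### Stiffness rows, read off the triangles at a node, and the energy identity. -/

lemma fin3_sum {M : Type*} [AddCommMonoid M] (f : Fin 3 → M) (r : Fin 3) :
    ∑ s, f s = f r + f (r + 1) + f (r + 2) := by
  rw [Fin.sum_univ_three]
  fin_cases r
  · rfl
  · change f 0 + f 1 + f 2 = f 1 + f 2 + f 0
    abel
  · change f 0 + f 1 + f 2 = f 2 + f 0 + f 1
    abel

lemma fin3_add (r : Fin 3) :
    r + 1 + 2 = r ∧ r + 1 + 1 = r + 2 ∧ r + 2 + 2 = r + 1 ∧ r + 2 + 1 = r := by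
  revert r; decide

namespace PoissonProblem

variable {G G' : PoissonProblem}

/-- Gradient, on the triangle `a`, of the finite element function with nodal values `u`. -/
def feGrad (G : PoissonProblem) (u : Fin G.numNodes → ℝ) (a : Fin G.numTri) : Plane :=
  ∑ s, u (G.tri a s) • G.hatGrad a s

lemma stiffness_row (i : Fin G.numNodes) (u : Fin G.numNodes → ℝ) :
    ∑ j, G.stiffness i j * u j = ∑ e : Fin G.numTri × Fin 3, if G.tri e.1 e.2 = i then
      G.area e.1 * inner ℝ (G.hatGrad e.1 e.2) (G.feGrad u e.1) else 0 := by
  simp only [stiffness, Finset.sum_mul]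
  rw [Finset.sum_comm, Fintype.sum_prod_type]
  refine Finset.sum_congr rfl fun a _ => ?_
  rw [Finset.sum_comm]
  refine Finset.sum_congr rfl fun r _ => ?_
  rw [Finset.sum_comm]
  by_cases h : G.tri a r = i
  · simp only [h, true_and, if_true, ite_mul, zero_mul, Finset.sum_ite_eq, Finset.mem_univ]
    rw [feGrad, inner_sum, Finset.mul_sum]
    refine Finset.sum_congr rfl fun s _ => ?_
    rw [inner_smul_right]; ring
  · simp [h]

/-- The discrete Dirichlet energy. It turns vanishing residuals into vanishing gradients. -/
lemma stiffness_energy (u : Fin G.numNodes → ℝ) :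
    ∑ i, u i * ∑ j, G.stiffness i j * u j = ∑ a, G.area a * ‖G.feGrad u a‖ ^ 2 := by
  simp only [stiffness_row, Finset.mul_sum]
  rw [Finset.sum_comm, Fintype.sum_prod_type]
  refine Finset.sum_congr rfl fun a _ => ?_
  simp only [mul_ite, mul_zero, Finset.sum_ite_eq, Finset.mem_univ, if_true]
  rw [← real_inner_self_eq_norm_sq]
  conv_rhs => rw [feGrad, sum_inner, Finset.mul_sum]
  refine Finset.sum_congr rfl fun s _ => ?_
  rw [real_inner_smul_left]
  simp only [feGrad]; ring

lemma stiffness_eq_zero {i j : Fin G.numNodes} (hij : i ≠ j) (h : ¬G.graph.Adj i j) :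
    G.stiffness i j = 0 :=
  Finset.sum_eq_zero fun a _ => Finset.sum_eq_zero fun r _ => Finset.sum_eq_zero fun s _ =>
    if_neg fun e => h ⟨hij, a, r, s, e⟩

/-- The contribution of one triangle with the vertices `x`, `x + y`, `x + z` to the stiffness row of
its vertex `x`. -/
def starContrib (x : Plane) (V : Plane → ℝ) (y z : Plane) : ℝ :=
  (2 * |planeCross y z|)⁻¹ * inner ℝ (z - y) (V x • (z - y) - V (x + y) • z + V (x + z) • y)

lemma starContrib_symm (x : Plane) (V : Plane → ℝ) (y z : Plane) :
    starContrib x V y z = starContrib x V z y := by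
  rw [starContrib, starContrib, planeCross_swap, abs_neg]
  congr 1
  simp only [plane_inner, PiLp.sub_apply, PiLp.add_apply, PiLp.smul_apply, smul_eq_mul]
  ring

lemma starContrib_eq {i : Fin G.numNodes} (V : Plane → ℝ) {a : Fin G.numTri} {r : Fin 3}
    (h : G.tri a r = i) :
    G.area a * inner ℝ (G.hatGrad a r) (G.feGrad (fun k => V (G.pos k)) a) =
      starContrib (G.pos i) V (G.vertex a (r + 1) - G.pos i) (G.vertex a (r + 2) - G.pos i) := by
  obtain ⟨e1, e2, e3, e4⟩ := fin3_add r
  have hx : G.pos i = G.vertex a r := by rw [← h]; rfl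
  rw [hx, starContrib, feGrad, fin3_sum _ r, ← det_rotate a r]
  simp only [hatGrad, e1, e2, e3, e4]
  change _ * inner ℝ _ (V (G.vertex a r) • _ + V (G.vertex a (r + 1)) • _ +
    V (G.vertex a (r + 2)) • _) = _
  rw [add_sub_cancel, add_sub_cancel]
  have hD : G.area a * (G.det a)⁻¹ * (G.det a)⁻¹ = (2 * |G.det a|)⁻¹ := by
    rw [area]
    rcases eq_or_ne (G.det a) 0 with h0 | h0
    · simp [h0]
    · have ha : |G.det a| ≠ 0 := abs_ne_zero.2 h0
      field_simp
      rw [sq_abs]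
  rw [← hD]
  simp only [plane_inner, PiLp.sub_apply, PiLp.add_apply, PiLp.smul_apply, smul_eq_mul, planeRot,
    Matrix.cons_val_zero, Matrix.cons_val_one]
  ring

/-- The edge of `e.1` opposite to its vertex `e.2`, as a pair of vectors from `i`. -/
def starPair (G : PoissonProblem) (i : Fin G.numNodes) (e : Fin G.numTri × Fin 3) : Sym2 Plane :=
  s(G.vertex e.1 (e.2 + 1) - G.pos i, G.vertex e.1 (e.2 + 2) - G.pos i)

/-- The triangles at the node `i`, with the index of this vertex. -/
def starIdx (G : PoissonProblem) (i : Fin G.numNodes) : Finset (Fin G.numTri × Fin 3) :=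
  Finset.univ.filter fun e => G.tri e.1 e.2 = i

lemma starTri_iff_mem {i : Fin G.numNodes} {y z : Plane} :
    G.StarTri i y z ↔ ∃ e ∈ G.starIdx i, G.starPair i e = s(y, z) := by
  simp only [StarTri, starIdx, starPair, Finset.mem_filter, Finset.mem_univ, true_and, Prod.exists,
    Sym2.eq_iff]
  refine exists_congr fun a => exists_congr fun r => and_congr_right fun _ => ?_
  constructor <;> rintro (⟨h1, h2⟩ | ⟨h1, h2⟩)
  exacts [Or.inl ⟨h1.symm, h2.symm⟩, Or.inr ⟨h2.symm, h1.symm⟩, Or.inl ⟨h1.symm, h2.symm⟩,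
    Or.inr ⟨h2.symm, h1.symm⟩]

lemma stiffness_row_star (i : Fin G.numNodes) (V : Plane → ℝ) :
    ∑ j, G.stiffness i j * V (G.pos j) = ∑ e ∈ G.starIdx i,
      Sym2.lift ⟨starContrib (G.pos i) V, starContrib_symm _ _⟩ (G.starPair i e) := by
  rw [stiffness_row i (fun k => V (G.pos k)), ← Finset.sum_filter]
  refine Finset.sum_congr rfl fun e he => ?_
  rw [starContrib_eq V (Finset.mem_filter.1 he).2, starPair, Sym2.lift_mk]

namespace IsMesh

/-- Distinct triangles have distinct vertex sets, so a row can be summed over unordered pairs of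
vectors instead of indices. The range of summation then depends on the fan alone, which makes rows
of different problems comparable. -/
lemma starPair_injOn (hG : G.IsMesh) (i : Fin G.numNodes) :
    Set.InjOn (G.starPair i) (G.starIdx i) := by
  rintro ⟨a, r⟩ ha ⟨b, s⟩ hb h
  simp only [starIdx, Finset.coe_filter, Finset.mem_univ, true_and, Set.mem_ofPred_eq] at ha hb
  have hab : a = b := by
    by_contra hne
    refine hG.distinct a b hne ?_
    have hr : ∀ (c : Fin G.numTri) (t : Fin 3), Set.range (G.tri c) =
        {G.tri c t, G.tri c (t + 1), G.tri c (t + 2)} := by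
      intro c t
      ext k
      constructor
      · rintro ⟨u, rfl⟩
        rcases fin3_cases t u with rfl | rfl | rfl <;> simp
      · rintro (rfl | rfl | rfl) <;> exact ⟨_, rfl⟩
    rw [hr a r, hr b s, ha, hb]
    simp only [starPair, Sym2.eq_iff] at h
    rcases h with ⟨h1, h2⟩ | ⟨h1, h2⟩
    · rw [hG.pos_injective (sub_left_injective h1), hG.pos_injective (sub_left_injective h2)]
    · rw [hG.pos_injective (sub_left_injective h1), hG.pos_injective (sub_left_injective h2),
        Set.pair_comm]
  subst hab
  rw [hG.tri_injective a (ha.trans hb.symm)]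

open Classical in
lemma stiffness_row_image (hG : G.IsMesh) (i : Fin G.numNodes) (V : Plane → ℝ) :
    ∑ j, G.stiffness i j * V (G.pos j) = ∑ p ∈ (G.starIdx i).image (G.starPair i),
      Sym2.lift ⟨starContrib (G.pos i) V, starContrib_symm _ _⟩ p := by
  rw [stiffness_row_star, Finset.sum_image (hG.starPair_injOn i)]

/-- The stiffness rows of free nodes with the same location, neighbours, kind and normal agree. -/
lemma stiffness_row_eq (hG : G.IsMesh) (hG' : G'.IsMesh) {i : Fin G.numNodes}
    {i' : Fin G'.numNodes} (hx : G.pos i = G'.pos i')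
    (hk : G.kind i = G'.kind i') (hn : G.kind i ≠ NodeKind.interior → G.normal i = G'.normal i')
    (hP : G.starNbrs i = G'.starNbrs i') (V : Plane → ℝ) :
    ∑ j, G.stiffness i j * V (G.pos j) = ∑ j, G'.stiffness i' j * V (G'.pos j) := by
  classical
  rw [hG.stiffness_row_image, hG'.stiffness_row_image, hx]
  refine Finset.sum_congr ?_ fun _ _ => rfl
  ext p
  induction p with
  | h y z =>
    rw [Finset.mem_image, Finset.mem_image, ← starTri_iff_mem, ← starTri_iff_mem]
    exact hG.starTri_iff hG' hk hn hP y z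

/-! ### Solvability -/

lemma area_pos (hG : G.IsMesh) (a : Fin G.numTri) : 0 < G.area a :=
  half_pos (abs_pos.2 (hG.nondegenerate a))

lemma eq_of_feGrad_eq_zero (hG : G.IsMesh) {u : Fin G.numNodes → ℝ} {a : Fin G.numTri}
    (h : G.feGrad u a = 0) (r s : Fin 3) : u (G.tri a r) = u (G.tri a s) := by
  have hd := hG.nondegenerate a
  have key : ∀ c : Fin 2, (u (G.tri a 2) - u (G.tri a 0)) * (G.vertex a 1 c - G.vertex a 0 c) +
      (u (G.tri a 0) - u (G.tri a 1)) * (G.vertex a 2 c - G.vertex a 0 c) = 0 := by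
    intro c
    have h0 := congrFun (congrArg WithLp.ofLp h) 0
    have h1 := congrFun (congrArg WithLp.ofLp h) 1
    simp [feGrad, Fin.sum_univ_three, hatGrad, planeRot] at h0 h1
    field_simp at h0 h1
    fin_cases c
    · simp; linear_combination h1
    · simp; linear_combination -h0
  have k0 := key 0
  have k1 := key 1
  have h2 : (u (G.tri a 2) - u (G.tri a 0)) * G.det a = 0 := by
    simp only [det, planeCross, PiLp.sub_apply]
    linear_combination (G.vertex a 2 1 - G.vertex a 0 1) * k0 -
      (G.vertex a 2 0 - G.vertex a 0 0) * k1
  have h1 : (u (G.tri a 0) - u (G.tri a 1)) * G.det a = 0 := by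
    simp only [det, planeCross, PiLp.sub_apply]
    linear_combination (G.vertex a 1 0 - G.vertex a 0 0) * k1 -
      (G.vertex a 1 1 - G.vertex a 0 1) * k0
  have e2 := sub_eq_zero.1 ((mul_eq_zero.1 h2).resolve_right hd)
  have e1 := sub_eq_zero.1 ((mul_eq_zero.1 h1).resolve_right hd)
  have all : ∀ r, u (G.tri a r) = u (G.tri a 0) := by
    intro r; fin_cases r
    exacts [rfl, e1.symm, e2]
  rw [all r, all s]

/-- The entries vanish at the Dirichlet nodes and the residuals elsewhere, so the energy is zero and
`u` is constant on each triangle. A walk to a Dirichlet node shows that the constant is zero. -/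
lemma eq_zero_of_mulVec (hG : G.IsMesh) {u : Fin G.numNodes → ℝ} (h : G.A.mulVec u = 0) :
    u = 0 := by
  have hD : ∀ i, G.kind i = NodeKind.dirichlet → u i = 0 := by
    intro i hi
    have := congrFun h i
    simpa [Matrix.mulVec, dotProduct, A, hi] using this
  have hS : ∀ i, u i * ∑ j, G.stiffness i j * u j = 0 := by
    intro i
    by_cases hi : G.kind i = NodeKind.dirichlet
    · rw [hD i hi, zero_mul]
    · have := congrFun h i
      simp only [Matrix.mulVec, dotProduct, A, hi, if_false, Pi.zero_apply] at this
      rw [this, mul_zero]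
  have hE := stiffness_energy u
  rw [Finset.sum_eq_zero fun i _ => hS i] at hE
  have hz : ∀ a, G.feGrad u a = 0 := by
    intro a
    have := (Finset.sum_eq_zero_iff_of_nonneg fun a _ =>
      mul_nonneg (hG.area_pos a).le (sq_nonneg _)).1 hE.symm a (Finset.mem_univ a)
    simpa [(hG.area_pos a).ne'] using this
  obtain ⟨d, hd⟩ := hG.exists_dirichlet
  have hw : ∀ i j, G.graph.Walk i j → u i = u j := by
    intro i j w
    induction w with
    | nil => rfl
    | cons hadj _ ih =>
      obtain ⟨-, a, r, s, rfl, rfl⟩ := hadj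
      rw [← ih]; exact hG.eq_of_feGrad_eq_zero (hz a) r s
  funext i
  obtain ⟨w⟩ := hG.connected.preconnected i d
  rw [hw i d w, hD d hd, Pi.zero_apply]

lemma det_A_ne_zero (hG : G.IsMesh) : G.A.det ≠ 0 := by
  intro h
  obtain ⟨v, hv, h0⟩ := Matrix.exists_mulVec_eq_zero_iff.2 h
  exact hv (hG.eq_zero_of_mulVec h0)

end IsMesh

/-- The exact solution of the linear system. -/
def solution (G : PoissonProblem) : Fin G.numNodes → ℝ := G.A⁻¹.mulVec G.B

namespace IsMesh

lemma mulVec_eq_iff (hG : G.IsMesh) {u : Fin G.numNodes → ℝ} :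
    G.A.mulVec u = G.B ↔ u = G.solution := by
  have hu : IsUnit G.A.det := isUnit_iff_ne_zero.2 hG.det_A_ne_zero
  constructor
  · rintro h
    rw [solution, ← h, Matrix.mulVec_mulVec, Matrix.nonsing_inv_mul _ hu, Matrix.one_mulVec]
  · rintro rfl
    rw [solution, Matrix.mulVec_mulVec, Matrix.mul_nonsing_inv _ hu, Matrix.one_mulVec]

lemma solution_dirichlet (hG : G.IsMesh) {i : Fin G.numNodes}
    (hi : G.kind i = NodeKind.dirichlet) : G.solution i = G.B i := by
  have := congrFun (hG.mulVec_eq_iff.2 rfl) i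
  simpa [Matrix.mulVec, dotProduct, A, hi] using this

lemma solution_free (hG : G.IsMesh) {i : Fin G.numNodes} (hi : G.kind i ≠ NodeKind.dirichlet) :
    ∑ j, G.stiffness i j * G.solution j = G.B i := by
  have := congrFun (hG.mulVec_eq_iff.2 rfl) i
  simpa [Matrix.mulVec, dotProduct, A, hi] using this

lemma numNodes_pos (hG : G.IsMesh) : 0 < G.numNodes := by
  obtain ⟨i, -⟩ := hG.exists_dirichlet
  exact i.pos

/-- The system is solvable, so the least value of the loss is zero, and the loss vanishes only at
the solution. -/
lemma isResidualMinimizer_iff (hG : G.IsMesh) (U : EuclideanSpace ℝ (Fin G.numNodes)) :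
    G.IsResidualMinimizer U ↔ U = WithLp.toLp 2 G.solution := by
  have hN : (0 : ℝ) < 1 / G.numNodes := by have := hG.numNodes_pos; positivity
  have hnn : ∀ V, 0 ≤ G.residualLoss V := fun V =>
    mul_nonneg hN.le (Finset.sum_nonneg fun i _ => sq_nonneg _)
  have hz : ∀ V : EuclideanSpace ℝ (Fin G.numNodes),
      G.residualLoss V = 0 ↔ V = WithLp.toLp 2 G.solution := by
    intro V
    rw [residualLoss, mul_eq_zero_iff_left hN.ne',
      Finset.sum_eq_zero_iff_of_nonneg fun i _ => sq_nonneg _]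
    have : V = WithLp.toLp 2 G.solution ↔ V.ofLp = G.solution := by
      constructor
      · rintro rfl; rfl
      · intro h; rw [← h]
    rw [this, ← hG.mulVec_eq_iff, funext_iff]
    refine forall_congr' fun i => ?_
    simp only [Finset.mem_univ, true_implies, Matrix.mulVec, dotProduct]
    rw [sq_eq_zero_iff, neg_add_eq_zero, eq_comm]
  constructor
  · intro h
    refine (hz U).1 (le_antisymm ?_ (hnn U))
    rw [← (hz (WithLp.toLp 2 G.solution)).2 rfl]; exact h _
  · rintro rfl V
    rw [(hz _).2 rfl]; exact hnn V

end IsMesh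
end PoissonProblem

/-! ### Reconstruction of the solution from propagated features. -/

/-- Finite signed measures are separated by their integrals of rectified affine functions. -/
lemma eq_zero_of_relu_integrals {ι : Type*} [Fintype ι] (ν : (ι → ℝ) →₀ ℝ)
    (h : ∀ (w : ι → ℝ) (b : ℝ),
      Finsupp.linearCombination ℝ (fun p => relu (w ⬝ᵥ p + b)) ν = 0) : ν = 0 := by
  by_contra hν
  -- A point of the support of largest norm is exposed: for a suitable `t < p ⬝ᵥ p`, the half-space
  -- `p ⬝ᵥ q > t` meets the support in `p` alone, and a single rectified function isolates its mass.
  obtain ⟨p, hp, hmax⟩ := ν.support.exists_max_image (fun p => p ⬝ᵥ p)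
    (Finsupp.support_nonempty_iff.2 hν)
  have hlt : ∀ q ∈ ν.support, q ≠ p → p ⬝ᵥ q < p ⬝ᵥ p := by
    intro q hq hqp
    have h1 : 0 < (p - q) ⬝ᵥ (p - q) := by
      refine lt_of_le_of_ne (Finset.sum_nonneg fun i _ => mul_self_nonneg _) fun e => hqp ?_
      have := dotProduct_self_eq_zero.1 e.symm
      exact (sub_eq_zero.1 this).symm
    have h2 := hmax q hq
    simp only [sub_dotProduct, dotProduct_sub] at h1
    rw [dotProduct_comm q p] at h1
    linarith
  obtain ⟨t, ht, hle⟩ : ∃ t < p ⬝ᵥ p, ∀ q ∈ ν.support, q ≠ p → p ⬝ᵥ q ≤ t := by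
    rcases (ν.support.erase p).eq_empty_or_nonempty with he | hne
    · refine ⟨p ⬝ᵥ p - 1, by linarith, fun q hq hqp => ?_⟩
      have : q ∈ ν.support.erase p := Finset.mem_erase.2 ⟨hqp, hq⟩
      rw [he] at this; simp at this
    · obtain ⟨q, hq, hm⟩ := (ν.support.erase p).exists_max_image (fun q => p ⬝ᵥ q) hne
      rw [Finset.mem_erase] at hq
      exact ⟨p ⬝ᵥ q, hlt q hq.2 hq.1, fun r hr hrp => hm r (Finset.mem_erase.2 ⟨hrp, hr⟩)⟩
  have := h p (-t)
  rw [Finsupp.linearCombination_apply, Finsupp.sum, Finset.sum_eq_single p] at this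
  · rw [smul_eq_mul, mul_eq_zero] at this
    rcases this with h | h
    · exact (Finsupp.mem_support_iff.1 hp) h
    · rw [relu, max_eq_left (by linarith)] at h; linarith
  · intro q hq hqp
    rw [relu, max_eq_right (by linarith [hle q hq hqp]), smul_zero]
  · intro h; exact absurd hp h

/-- Indices of the static data of a node: location, `b`, kind, normal. -/
abbrev NodeIdx : Type := Fin 2 ⊕ Fin 3 ⊕ Fin 3 ⊕ Fin 2

namespace PoissonProblem

variable {G G' : PoissonProblem}

/-- The static data of a node. The normal is replaced by zero outside of the Neumann nodes. -/
def nodeData (G : PoissonProblem) (i : Fin G.numNodes) : NodeIdx → ℝ :=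
  Sum.elim (fun c => G.pos i c) (Sum.elim (G.bVec i) (Sum.elim (G.oneHot i)
    (fun c => if G.kind i = NodeKind.neumann then G.normal i c else 0)))

lemma oneHot_injective {i : Fin G.numNodes} {i' : Fin G'.numNodes}
    (h : G.oneHot i = G'.oneHot i') : G.kind i = G'.kind i' := by
  have h0 := congrFun h 0
  have h1 := congrFun h 1
  rcases hk : G.kind i with _ | _ | _ <;> rcases hk' : G'.kind i' with _ | _ | _ <;>
    simp [oneHot, hk, hk'] at h0 h1 ⊢

lemma sum_bVec (i : Fin G.numNodes) : ∑ c, G.bVec i c = G.B i := by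
  rcases hk : G.kind i with _ | _ | _ <;> simp [bVec, oneHot, hk, Fin.sum_univ_three]

section NodeData

variable {i : Fin G.numNodes} {i' : Fin G'.numNodes} (h : G.nodeData i = G'.nodeData i')
include h

lemma pos_eq_of_nodeData : G.pos i = G'.pos i' := by
  ext c; exact congrFun h (Sum.inl c)

lemma kind_eq_of_nodeData : G.kind i = G'.kind i' :=
  oneHot_injective (funext fun c => congrFun h (Sum.inr (Sum.inr (Sum.inl c))))

lemma B_eq_of_nodeData : G.B i = G'.B i' := by
  rw [← sum_bVec, ← sum_bVec]
  exact Finset.sum_congr rfl fun c _ => congrFun h (Sum.inr (Sum.inl c))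

lemma normal_eq_of_nodeData (hi : G.kind i = NodeKind.neumann) : G.normal i = G'.normal i' := by
  have hi' := kind_eq_of_nodeData h ▸ hi
  ext c
  have := congrFun h (Sum.inr (Sum.inr (Sum.inr c)))
  simpa [nodeData, hi, hi'] using this

end NodeData

/-- The static data of a pair of nodes. -/
def edgeData (G : PoissonProblem) (i j : Fin G.numNodes) : NodeIdx ⊕ NodeIdx → ℝ :=
  Sum.elim (G.nodeData i) (G.nodeData j)

open Classical in
/-- The neighbours of a node. -/
def nbrFinset (G : PoissonProblem) (i : Fin G.numNodes) : Finset (Fin G.numNodes) :=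
  Finset.univ.filter (G.graph.Adj i)

lemma mem_nbrFinset {i j : Fin G.numNodes} : j ∈ G.nbrFinset i ↔ G.graph.Adj i j := by
  simp [nbrFinset]

open Classical in
/-- Adjacency matrix of the free nodes. -/
def freeAdj (G : PoissonProblem) : Matrix G.Free G.Free ℝ :=
  fun i j => if G.graph.Adj i j then 1 else 0

/-- The inverse of the damped adjacency operator. -/
def propagator (G : PoissonProblem) (l : ℝ) : Matrix G.Free G.Free ℝ :=
  (1 - l • G.freeAdj)⁻¹

/-- The sum over the edges at a node of a rectified affine function of their static data. -/
def edgeSum (G : PoissonProblem) (w : NodeIdx ⊕ NodeIdx → ℝ) (b : ℝ) (i : Fin G.numNodes) : ℝ :=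
  ∑ j ∈ G.nbrFinset i, relu (w ⬝ᵥ G.edgeData i j + b)

open Classical in
/-- The damped propagation of the edge sums over the free nodes, zero at a Dirichlet node. -/
def feature (G : PoissonProblem) (l : ℝ) (w : NodeIdx ⊕ NodeIdx → ℝ) (b : ℝ)
    (i : Fin G.numNodes) : ℝ :=
  if h : G.kind i ≠ NodeKind.dirichlet then
    ∑ j, G.propagator l ⟨i, h⟩ j * G.edgeSum w b j else 0

section Propagator

variable {l : ℝ} (hl : 0 < l) (hN : l * G.numNodes < 1)

include hl hN

lemma sum_freeAdj_lt (i : G.Free) : l * ∑ j, G.freeAdj i j < 1 := by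
  refine lt_of_le_of_lt ?_ hN
  refine mul_le_mul_of_nonneg_left ?_ hl.le
  calc ∑ j, G.freeAdj i j ≤ ∑ _j : G.Free, (1 : ℝ) :=
        Finset.sum_le_sum fun j _ => by unfold freeAdj; split_ifs <;> simp
    _ = Fintype.card G.Free := by simp
    _ ≤ G.numNodes := by
        exact_mod_cast (Fintype.card_subtype_le _).trans_eq (Fintype.card_fin _)

lemma isUnit_det_propagator : IsUnit (1 - l • G.freeAdj).det := by
  refine isUnit_iff_ne_zero.2 (det_ne_zero_of_sum_row_lt_diag fun k => ?_)
  have hd : G.freeAdj k k = 0 := by simp [freeAdj]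
  have : ‖(1 - l • G.freeAdj) k k‖ = 1 := by simp [hd]
  rw [this]
  refine lt_of_le_of_lt ?_ (sum_freeAdj_lt hl hN k)
  rw [Finset.mul_sum, ← Finset.add_sum_erase _ _ (Finset.mem_univ k), hd, mul_zero, zero_add]
  refine Finset.sum_le_sum fun j hj => ?_
  have hjk : k ≠ j := (Finset.ne_of_mem_erase hj).symm
  simp only [Matrix.sub_apply, Matrix.one_apply_ne hjk, Matrix.smul_apply, zero_sub, norm_neg,
    smul_eq_mul]
  rw [Real.norm_of_nonneg]
  refine mul_nonneg hl.le ?_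
  unfold freeAdj; split_ifs <;> simp

lemma propagator_eq_left (i j : G.Free) : G.propagator l i j =
    (1 : Matrix G.Free G.Free ℝ) i j + l * ∑ k, G.freeAdj i k * G.propagator l k j := by
  have := congrFun (congrFun (Matrix.mul_nonsing_inv _ (isUnit_det_propagator hl hN)) i) j
  rw [sub_mul, one_mul, smul_mul_assoc] at this
  simp only [Matrix.sub_apply, Matrix.smul_apply, smul_eq_mul, Matrix.mul_apply] at this
  rw [propagator]; linarith

lemma propagator_eq_right (i j : G.Free) : G.propagator l i j =
    (1 : Matrix G.Free G.Free ℝ) i j + l * ∑ k, G.propagator l i k * G.freeAdj k j := by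
  have := congrFun (congrFun (Matrix.nonsing_inv_mul _ (isUnit_det_propagator hl hN)) i) j
  rw [mul_sub, mul_one, mul_smul_comm] at this
  simp only [Matrix.sub_apply, Matrix.smul_apply, smul_eq_mul, Matrix.mul_apply] at this
  rw [propagator]; linarith

/-- Minimum principle: where a column is smallest, a negative value would be at least `l * ∑ k,
freeAdj m k < 1` times itself, and so larger than itself. -/
lemma propagator_nonneg (i j : G.Free) : 0 ≤ G.propagator l i j := by
  obtain ⟨m, -, hm⟩ := Finset.univ.exists_min_image (fun k => G.propagator l k j)
    ⟨i, Finset.mem_univ i⟩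
  refine le_trans ?_ (hm i (Finset.mem_univ i))
  by_contra! hneg
  have h1 := propagator_eq_left hl hN m j
  have h2 : (∑ k, G.freeAdj m k) * G.propagator l m j ≤
      ∑ k, G.freeAdj m k * G.propagator l k j := by
    rw [Finset.sum_mul]
    refine Finset.sum_le_sum fun k _ => mul_le_mul_of_nonneg_left (hm k (Finset.mem_univ k)) ?_
    unfold freeAdj; split_ifs <;> simp
  have h3 := sum_freeAdj_lt hl hN m
  have h4 : 0 ≤ (1 : Matrix G.Free G.Free ℝ) m j := by
    rw [Matrix.one_apply]; split_ifs <;> simp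
  have h5 := mul_le_mul_of_nonneg_left h2 hl.le
  have h6 : G.propagator l m j * 1 < G.propagator l m j * (l * ∑ k, G.freeAdj m k) :=
    mul_lt_mul_of_neg_left h3 hneg
  linarith

lemma propagator_self_pos (i : G.Free) : 0 < G.propagator l i i := by
  rw [propagator_eq_left hl hN, Matrix.one_apply_eq]
  have : 0 ≤ l * ∑ k, G.freeAdj i k * G.propagator l k i := by
    refine mul_nonneg hl.le (Finset.sum_nonneg fun k _ => mul_nonneg ?_
      (propagator_nonneg hl hN _ _))
    unfold freeAdj; split_ifs <;> simp
  linarith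

/-- Positivity spreads along edges, so row `i` charges every free node that is joined to `i` through
free nodes. -/
lemma propagator_pos_of_adj {i j k : G.Free} (h : 0 < G.propagator l i j)
    (hjk : G.graph.Adj j k) : 0 < G.propagator l i k := by
  rw [propagator_eq_right hl hN]
  have h4 : 0 ≤ (1 : Matrix G.Free G.Free ℝ) i k := by
    rw [Matrix.one_apply]; split_ifs <;> simp
  have hn : ∀ m, 0 ≤ G.propagator l i m * G.freeAdj m k := fun m =>
    mul_nonneg (propagator_nonneg hl hN _ _) (by unfold freeAdj; split_ifs <;> simp)
  have h5 : G.propagator l i j * G.freeAdj j k ≤ ∑ m, G.propagator l i m * G.freeAdj m k :=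
    Finset.single_le_sum (fun m _ => hn m) (Finset.mem_univ j)
  have h6 : G.freeAdj j k = 1 := by simp [freeAdj, hjk]
  rw [h6, mul_one] at h5
  have := mul_pos hl (h.trans_le h5)
  linarith

/-- The one-hop form of the feature, which message passing can iterate. A Dirichlet neighbour
contributes its edge term only, since the feature is zero there. -/
lemma feature_eq (w : NodeIdx ⊕ NodeIdx → ℝ) (b : ℝ) (i : G.Free) : G.feature l w b i =
    ∑ j ∈ G.nbrFinset i, (l * G.feature l w b j + relu (w ⬝ᵥ G.edgeData i j + b)) := by
  classical
  have hf : ∀ i : G.Free, G.feature l w b i = ∑ j, G.propagator l i j * G.edgeSum w b j :=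
    fun i => by rw [feature, dif_pos i.2]
  rw [Finset.sum_add_distrib, ← edgeSum, ← Finset.mul_sum, hf]
  have h1 : ∑ j ∈ G.nbrFinset i, G.feature l w b j = ∑ k : G.Free, G.freeAdj i k *
      G.feature l w b k := by
    have h2 : ∑ k ∈ Finset.univ.filter fun k => G.kind k ≠ NodeKind.dirichlet,
        (if G.graph.Adj i k then G.feature l w b k else 0) =
        ∑ k : G.Free, if G.graph.Adj i k then G.feature l w b k else 0 :=
      Finset.sum_subtype _ (by simp) _
    simp only [freeAdj, ite_mul, one_mul, zero_mul]
    rw [← h2, nbrFinset, Finset.sum_filter, Finset.sum_filter]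
    refine Finset.sum_congr rfl fun k _ => ?_
    by_cases hk : G.kind k = NodeKind.dirichlet <;> simp [feature, hk]
  rw [h1]
  simp only [hf]
  calc ∑ j, G.propagator l i j * G.edgeSum w b j
      = ∑ j, ((1 : Matrix G.Free G.Free ℝ) i j + l * ∑ k, G.freeAdj i k * G.propagator l k j) *
          G.edgeSum w b j :=
        Finset.sum_congr rfl fun j _ => by rw [← propagator_eq_left hl hN]
    _ = ∑ j, (1 : Matrix G.Free G.Free ℝ) i j * G.edgeSum w b j +
        l * ∑ j, ∑ k, G.freeAdj i k * (G.propagator l k j * G.edgeSum w b j) := by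
      rw [Finset.mul_sum, ← Finset.sum_add_distrib]
      refine Finset.sum_congr rfl fun j _ => ?_
      rw [add_mul, mul_assoc l, Finset.sum_mul]
      simp only [mul_assoc]
    _ = _ := by
      rw [Finset.sum_comm, add_comm]
      simp only [Finset.mul_sum, Matrix.one_apply, ite_mul, one_mul, zero_mul, Finset.sum_ite_eq,
        Finset.mem_univ, if_true]

end Propagator

/-- The edges of the component of `i`, as a measure on the static data of pairs of nodes. -/
def edgeMeasure (G : PoissonProblem) (l : ℝ) (i : G.Free) : (NodeIdx ⊕ NodeIdx → ℝ) →₀ ℝ :=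
  ∑ j : G.Free, ∑ k ∈ G.nbrFinset j, Finsupp.single (G.edgeData j k) (G.propagator l i j)

lemma linearCombination_edgeMeasure (l : ℝ) (i : G.Free) (w : NodeIdx ⊕ NodeIdx → ℝ) (b : ℝ) :
    Finsupp.linearCombination ℝ (fun p => relu (w ⬝ᵥ p + b)) (G.edgeMeasure l i) =
      G.feature l w b i := by
  rw [feature, dif_pos i.2, edgeMeasure]
  simp only [map_sum, Finsupp.linearCombination_single, smul_eq_mul, edgeSum, Finset.mul_sum]

/-- All masses are nonnegative, so masses at coinciding data cannot cancel. -/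
lemma edgeMeasure_pos {l : ℝ} (hl : 0 < l) (hN : l * G.numNodes < 1) {i j : G.Free}
    {k : Fin G.numNodes} (h : 0 < G.propagator l i j) (hjk : G.graph.Adj j k) :
    0 < G.edgeMeasure l i (G.edgeData j k) := by
  classical
  rw [edgeMeasure, Finsupp.finsetSum_apply]
  have hn : ∀ (j' : G.Free) (k' : Fin G.numNodes),
      0 ≤ Finsupp.single (G.edgeData j' k') (G.propagator l i j') (G.edgeData j k) := by
    intro j' k'
    rw [Finsupp.single_apply]; split_ifs
    exacts [propagator_nonneg hl hN _ _, le_rfl]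
  refine Finset.sum_pos' (fun j' _ => ?_) ⟨j, Finset.mem_univ j, ?_⟩
  · rw [Finsupp.finsetSum_apply]; exact Finset.sum_nonneg fun k' _ => hn _ _
  · rw [Finsupp.finsetSum_apply]
    refine Finset.sum_pos' (fun k' _ => hn _ _) ⟨k, mem_nbrFinset.2 hjk, ?_⟩
    simpa using h

lemma exists_of_edgeMeasure_ne {l : ℝ} {i : G.Free} {p : NodeIdx ⊕ NodeIdx → ℝ}
    (h : G.edgeMeasure l i p ≠ 0) :
    ∃ (j : G.Free) (k : Fin G.numNodes), G.propagator l i j ≠ 0 ∧ G.graph.Adj j k ∧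
      G.edgeData j k = p := by
  classical
  rw [edgeMeasure, Finsupp.finsetSum_apply] at h
  obtain ⟨j, -, hj⟩ := Finset.exists_ne_zero_of_sum_ne_zero h
  rw [Finsupp.finsetSum_apply] at hj
  obtain ⟨k, hk, hjk⟩ := Finset.exists_ne_zero_of_sum_ne_zero hj
  rw [Finsupp.single_apply] at hjk
  split_ifs at hjk with e
  · exact ⟨j, k, hjk, mem_nbrFinset.1 hk, e⟩
  · exact absurd rfl hjk

/-- Corresponding edges in two problems with the same edge measure. -/
lemma exists_edge {l : ℝ} (hl : 0 < l) (hN : l * G.numNodes < 1) (hN' : l * G'.numNodes < 1)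
    {i : G.Free} {i' : G'.Free} (hμ : G.edgeMeasure l i = G'.edgeMeasure l i') {j : G.Free}
    {k : Fin G.numNodes} (h : 0 < G.propagator l i j) (hjk : G.graph.Adj j k) :
    ∃ (j' : G'.Free) (k' : Fin G'.numNodes), 0 < G'.propagator l i' j' ∧ G'.graph.Adj j' k' ∧
      G.nodeData j = G'.nodeData j' ∧ G.nodeData k = G'.nodeData k' := by
  have h1 := (edgeMeasure_pos hl hN h hjk).ne'
  rw [hμ] at h1
  obtain ⟨j', k', h2, h3, h4⟩ := exists_of_edgeMeasure_ne h1
  have e := Sum.elim_eq_iff.1 h4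
  exact ⟨j', k', lt_of_le_of_ne (propagator_nonneg hl hN' _ _) h2.symm, h3, e.1.symm, e.2.symm⟩

namespace IsMesh

lemma exists_adj (hG : G.IsMesh) (i : Fin G.numNodes) : ∃ k, G.graph.Adj i k := by
  obtain ⟨a, r, rfl⟩ := hG.exists_tri i
  exact ⟨_, hG.adj_of_tri (fin3_succ_ne r).1⟩

/-- An edge at `j` has a partner at some node of `G'` with the data of `j`. Locations separate the
nodes of `G'`, so this node is `j'`. -/
lemma starNbrs_subset {l : ℝ} (hl : 0 < l) (hN : l * G.numNodes < 1)
    (hN' : l * G'.numNodes < 1) (hG' : G'.IsMesh)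
    {i : G.Free} {i' : G'.Free} (hμ : G.edgeMeasure l i = G'.edgeMeasure l i') {j : G.Free}
    (h : 0 < G.propagator l i j) {j' : G'.Free} (hj : G.nodeData j = G'.nodeData j') :
    G.starNbrs j ⊆ G'.starNbrs j' := by
  rintro _ ⟨k, hk, rfl⟩
  obtain ⟨j₁, k₁, -, h2, h3, h4⟩ := exists_edge hl hN hN' hμ h hk
  have : (j₁ : Fin G'.numNodes) = j' :=
    hG'.pos_injective ((pos_eq_of_nodeData h3).symm.trans (pos_eq_of_nodeData hj))
  exact ⟨k₁, this ▸ h2, by rw [pos_eq_of_nodeData h4, pos_eq_of_nodeData hj]⟩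

/-- The solution at a free node is determined by the static data of this node and the features. -/
theorem solution_eq_of_feature (hG : G.IsMesh) (hG' : G'.IsMesh) {l : ℝ} (hl : 0 < l)
    (hN : l * G.numNodes < 1) (hN' : l * G'.numNodes < 1) {i : G.Free} {i' : G'.Free}
    (hd : G.nodeData i = G'.nodeData i')
    (hf : ∀ w b, G.feature l w b i = G'.feature l w b i') :
    G.solution i = G'.solution i' := by
  classical
  have hμ : G.edgeMeasure l i = G'.edgeMeasure l i' := by
    rw [← sub_eq_zero]
    refine eq_zero_of_relu_integrals _ fun w b => ?_
    rw [map_sub, linearCombination_edgeMeasure, linearCombination_edgeMeasure, hf, sub_self]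
  -- The solution of `G'` as a function of location, to be evaluated at the nodes of `G`.
  set V : Plane → ℝ := Function.extend G'.pos G'.solution 0
  have hV : ∀ k', V (G'.pos k') = G'.solution k' := hG'.pos_injective.extend_apply _ _
  have hVsol : (fun k' => V (G'.pos k')) = G'.solution := funext hV
  set C : Fin G.numNodes → Prop := fun k => ∃ h : G.kind k ≠ NodeKind.dirichlet,
    0 < G.propagator l i ⟨k, h⟩
  -- The difference of the two solutions on the nodes seen by the measure of `i`, extended by zero.
  -- It solves the homogeneous system of `G` and hence vanishes.
  set W : Fin G.numNodes → ℝ := fun k => if C k then G.solution k - V (G.pos k) else 0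
  have hAW : G.A.mulVec W = 0 := by
    funext j
    simp only [Matrix.mulVec, dotProduct, A, Pi.zero_apply]
    by_cases hj : G.kind j = NodeKind.dirichlet
    · have : ¬C j := fun ⟨h, _⟩ => h hj
      simp only [hj, if_true, ite_mul, one_mul, zero_mul, Finset.sum_ite_eq, Finset.mem_univ]
      exact if_neg this
    simp only [hj, if_false]
    by_cases hC : C j
    · obtain ⟨hj', hpos⟩ := hC
      obtain ⟨k₀, hk₀⟩ := hG.exists_adj j
      obtain ⟨j', -, hpos', -, hjj, -⟩ := exists_edge (j := ⟨j, hj⟩) hl hN hN' hμ hpos hk₀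
      have hk := kind_eq_of_nodeData hjj
      have hP : G.starNbrs j = G'.starNbrs j' := Set.Subset.antisymm
        (starNbrs_subset (j := ⟨j, hj⟩) hl hN hN' hG' hμ hpos hjj)
        (starNbrs_subset (j' := ⟨j, hj⟩) hl hN' hN hG hμ.symm hpos' hjj.symm)
      have hn : G.kind j ≠ NodeKind.interior → G.normal j = G'.normal j' := by
        intro hi
        refine normal_eq_of_nodeData hjj ?_
        rcases h : G.kind j with _ | _ | _
        exacts [absurd h hi, absurd h hj, rfl]
      have hrow := hG.stiffness_row_eq hG' (pos_eq_of_nodeData hjj) hk hn hP V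
      have hterm : ∀ k, G.stiffness j k * W k =
          G.stiffness j k * G.solution k - G.stiffness j k * V (G.pos k) := by
        intro k
        rw [← mul_sub]
        by_cases hjk : j = k
        · subst hjk
          have : C j := ⟨hj, hpos⟩
          simp [W, this]
        by_cases hadj : G.graph.Adj j k
        · by_cases hkd : G.kind k = NodeKind.dirichlet
          -- At a Dirichlet neighbour both solutions equal the prescribed value, which is part of
          -- the data of the edge.
          · obtain ⟨-, k', -, -, -, hkk⟩ := exists_edge (j := ⟨j, hj⟩) hl hN hN' hμ hpos hadj
            have hkd' := kind_eq_of_nodeData hkk ▸ hkd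
            have : ¬C k := fun ⟨h, _⟩ => h hkd
            rw [pos_eq_of_nodeData hkk, hV, hG.solution_dirichlet hkd,
              hG'.solution_dirichlet hkd', B_eq_of_nodeData hkk]
            simp [W, this]
          · have : C k :=
              ⟨hkd, propagator_pos_of_adj (j := ⟨j, hj⟩) (k := ⟨k, hkd⟩) hl hN hpos hadj⟩
            simp [W, this]
        · rw [stiffness_eq_zero hjk hadj, zero_mul, zero_mul]
      rw [Finset.sum_congr rfl fun k _ => hterm k, Finset.sum_sub_distrib, hG.solution_free hj,
        hrow]
      simp only [hV]
      rw [hG'.solution_free j'.2, B_eq_of_nodeData hjj, sub_self]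
    -- A free node outside the component has no neighbour in it.
    · refine Finset.sum_eq_zero fun k _ => ?_
      by_cases hCk : C k
      · have hjk : j ≠ k := fun e => hC (e ▸ hCk)
        rw [stiffness_eq_zero hjk, zero_mul]
        intro hadj
        obtain ⟨hkd, hpos⟩ := hCk
        exact hC ⟨hj, propagator_pos_of_adj (j := ⟨k, hkd⟩) (k := ⟨j, hj⟩) hl hN hpos hadj.symm⟩
      · simp [W, hCk]
  have hW := congrFun (hG.eq_zero_of_mulVec hAW) i
  have hCi : C i := ⟨i.2, propagator_self_pos hl hN i⟩
  simp only [W, hCi, if_true, Pi.zero_apply] at hW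
  rw [pos_eq_of_nodeData hd, hV] at hW
  linarith

end IsMesh
end PoissonProblem

/-! ### Density of rectified networks with one hidden layer -/

lemma continuous_relu : Continuous relu := continuous_id.max continuous_const

lemma relu_of_nonneg {x : ℝ} (h : 0 ≤ x) : relu x = x := max_eq_left h

lemma relu_of_nonpos {x : ℝ} (h : x ≤ 0) : relu x = 0 := max_eq_right h

/-- Piecewise linear interpolation of a Lipschitz function. -/
lemma interpolation_bound (f : ℝ → ℝ) (s h L : ℝ) (hh : 0 < h) (hL : 0 ≤ L) (n : ℕ)
    (hf : ∀ x y, s ≤ x → x ≤ s + n * h → s ≤ y → y ≤ s + n * h → |f x - f y| ≤ L * |x - y|) :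
    (∀ t, s ≤ t → t ≤ s + n * h → |f t - (f s + ∑ k ∈ Finset.range n,
      (f (s + (k + 1) * h) - f (s + k * h)) / h *
        (relu (t - (s + k * h)) - relu (t - (s + (k + 1) * h))))| ≤ 2 * L * h) ∧
    ∀ t, s + n * h ≤ t → f s + ∑ k ∈ Finset.range n, (f (s + (k + 1) * h) - f (s + k * h)) / h *
        (relu (t - (s + k * h)) - relu (t - (s + (k + 1) * h))) = f (s + n * h) := by
  -- The second clause, constancy of the interpolant past its last node, carries the induction.
  induction n with
  | zero =>
    refine ⟨fun t h1 h2 => ?_, fun t _ => by simp⟩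
    have : t = s := le_antisymm (by simpa using h2) h1
    subst this
    simp only [Finset.range_zero, Finset.sum_empty, add_zero, sub_self, abs_zero]
    positivity
  | succ n ih =>
    have hle : s + n * h ≤ s + (n + 1 : ℕ) * h := by push_cast; nlinarith
    have hs : s ≤ s + n * h := le_add_of_nonneg_right (by positivity)
    obtain ⟨ih1, ih2⟩ := ih fun x y h1 h2 h3 h4 => hf x y h1 (h2.trans hle) h3 (h4.trans hle)
    have hb : |f (s + (n + 1) * h) - f (s + n * h)| ≤ L * h := by
      have := hf (s + (n + 1 : ℕ) * h) (s + n * h) (hs.trans hle) le_rfl hs hle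
      push_cast at this
      refine this.trans_eq ?_
      rw [show s + (n + 1) * h - (s + n * h) = h by ring, abs_of_pos hh]
    refine ⟨fun t h1 h2 => ?_, fun t h1 => ?_⟩
    · rw [Finset.sum_range_succ, ← add_assoc]
      push_cast at h2
      rcases le_total t (s + n * h) with ht | ht
      · rw [relu_of_nonpos (sub_nonpos.2 ht), relu_of_nonpos (by linarith), sub_zero, mul_zero,
          add_zero]
        exact ih1 t h1 ht
      · rw [ih2 t ht, relu_of_nonneg (sub_nonneg.2 ht), relu_of_nonpos (by linarith), sub_zero]
        have h3 := hf t (s + n * h) h1 (by push_cast; exact h2) hs hle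
        have h4 : |t - (s + n * h)| ≤ h := by
          rw [abs_of_nonneg (sub_nonneg.2 ht)]; linarith
        have h5 : |(f (s + (n + 1) * h) - f (s + n * h)) / h * (t - (s + n * h))| ≤ L * h := by
          rw [abs_mul, abs_div, abs_of_pos hh]
          calc _ ≤ L * h / h * h := by gcongr
            _ = L * h := by field_simp
        rw [← sub_sub]
        refine (abs_sub _ _).trans ?_
        have := mul_le_mul_of_nonneg_left h4 hL
        linarith
    · rw [Finset.sum_range_succ, ← add_assoc, ih2 t (hle.trans h1)]
      push_cast at h1 ⊢
      rw [relu_of_nonneg (by linarith), relu_of_nonneg (by linarith)]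
      field_simp
      ring

lemma exp_sub_exp_le (x y R : ℝ) (hx : x ≤ R) (hy : y ≤ R) :
    |Real.exp x - Real.exp y| ≤ Real.exp R * |x - y| := by
  wlog hxy : y ≤ x generalizing x y
  · rw [abs_sub_comm, abs_sub_comm x]; exact this y x hy hx (le_of_not_ge hxy)
  rw [abs_of_nonneg (sub_nonneg.2 (Real.exp_le_exp.2 hxy)), abs_of_nonneg (sub_nonneg.2 hxy)]
  have h1 := Real.add_one_le_exp (y - x)
  have h2 : Real.exp y = Real.exp x * Real.exp (y - x) := by rw [← Real.exp_add]; ring_nf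
  have h3 := Real.exp_le_exp.2 hx
  have h4 := Real.exp_pos x
  calc Real.exp x - Real.exp y = Real.exp x * (1 - Real.exp (y - x)) := by rw [h2]; ring
    _ ≤ Real.exp x * (x - y) := mul_le_mul_of_nonneg_left (by linarith) h4.le
    _ ≤ _ := mul_le_mul_of_nonneg_right h3 (by linarith)

section Density

variable {Z : Type*} [TopologicalSpace Z]

/-- Composition of a continuous function with `relu`. -/
def reluComp (f : C(Z, ℝ)) : C(Z, ℝ) := ⟨fun z => relu (f z), continuous_relu.comp f.continuous⟩

/-- Composition of a continuous function with the exponential. -/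
def expComp (f : C(Z, ℝ)) : C(Z, ℝ) :=
  ⟨fun z => Real.exp (f z), Real.continuous_exp.comp f.continuous⟩

variable (A : Submodule ℝ C(Z, ℝ))

/-- The functions computed by one hidden rectified layer over a space of inputs. -/
def reluSpan : Submodule ℝ C(Z, ℝ) := Submodule.span ℝ (reluComp '' (A : Set C(Z, ℝ)))

variable {A}

lemma reluComp_mem {f : C(Z, ℝ)} (hf : f ∈ A) : reluComp f ∈ reluSpan A :=
  Submodule.subset_span ⟨f, hf, rfl⟩

/-- A piecewise linear interpolant of the exponential is a combination of rectified translates, and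
translates of `f` stay in `A` because `A` contains the constants. -/
lemma expComp_mem_closure [CompactSpace Z] (h1 : (1 : C(Z, ℝ)) ∈ A) {f : C(Z, ℝ)} (hf : f ∈ A) :
    expComp f ∈ (reluSpan A).topologicalClosure := by
  refine Metric.mem_closure_iff.2 fun ε hε => ?_
  set R := ‖f‖ + 1 with hR
  have hR0 : 0 < R := by positivity
  -- Makes the interpolation error `2 * exp R * h`, with `h = 2 * R / n`, smaller than `ε`.
  obtain ⟨n, hn⟩ := exists_nat_gt (2 * Real.exp R * (2 * R) / ε)
  have hn0 : (0 : ℝ) < n := lt_of_le_of_lt (by positivity) hn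
  set h := 2 * R / n with hh
  have hh0 : 0 < h := by positivity
  have hnh : -R + n * h = R := by rw [hh]; field_simp; ring
  have key := (interpolation_bound Real.exp (-R) h (Real.exp R) hh0 (Real.exp_pos R).le n
    (fun x y _ hx _ hy =>
    exp_sub_exp_le x y R (hx.trans_eq hnh) (hy.trans_eq hnh))).1
  have hone : reluComp (1 : C(Z, ℝ)) = 1 := by
    ext z; exact relu_of_nonneg zero_le_one
  refine ⟨Real.exp (-R) • reluComp 1 + ∑ k ∈ Finset.range n,
    ((Real.exp (-R + (k + 1) * h) - Real.exp (-R + k * h)) / h) •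
      (reluComp (f - (-R + k * h) • 1) - reluComp (f - (-R + (k + 1) * h) • 1)), ?_, ?_⟩
  · refine add_mem (Submodule.smul_mem _ _ (reluComp_mem h1)) (sum_mem fun k _ =>
      Submodule.smul_mem _ _ (sub_mem (reluComp_mem ?_) (reluComp_mem ?_))) <;>
    exact sub_mem hf (Submodule.smul_mem _ _ h1)
  · rw [hone]
    refine (ContinuousMap.dist_lt_iff hε).2 fun z => ?_
    have hz : |f z| ≤ R := (f.norm_coe_le_norm z).trans (by linarith)
    have := key (f z) (abs_le.1 hz).1 ((abs_le.1 hz).2.trans_eq hnh.symm)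
    rw [Real.dist_eq]
    refine lt_of_le_of_lt (le_of_eq_of_le ?_ this) ?_
    · simp [expComp, reluComp, ContinuousMap.sum_apply]
    · rw [hh, ← mul_div_assoc, div_lt_iff₀ hn0]
      rw [div_lt_iff₀ hε] at hn; linarith

/-- One hidden rectified layer is dense. -/
theorem reluSpan_topologicalClosure [CompactSpace Z] (h1 : (1 : C(Z, ℝ)) ∈ A)
    (hsep : ∀ x y : Z, x ≠ y → ∃ f ∈ A, f x ≠ f y) : (reluSpan A).topologicalClosure = ⊤ := by
  -- Exponentials turn sums into products, so their span is already an algebra, and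
  -- Stone–Weierstrass applies to it.
  let M : Submonoid C(Z, ℝ) :=
    { carrier := expComp '' (A : Set C(Z, ℝ))
      mul_mem' := by
        rintro _ _ ⟨f, hf, rfl⟩ ⟨g, hg, rfl⟩
        exact ⟨f + g, add_mem hf hg, by ext z; simp [expComp, Real.exp_add]⟩
      one_mem' := ⟨0, zero_mem _, by ext z; simp [expComp]⟩ }
  let S : Subalgebra ℝ C(Z, ℝ) := Algebra.adjoin ℝ (M : Set C(Z, ℝ))
  have hS : S.SeparatesPoints := by
    intro x y hxy
    obtain ⟨f, hf, hne⟩ := hsep x y hxy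
    exact ⟨_, ⟨expComp f, Algebra.subset_adjoin ⟨f, hf, rfl⟩, rfl⟩,
      fun e => hne (Real.exp_injective e)⟩
  have htop := ContinuousMap.subalgebra_topologicalClosure_eq_top_of_separatesPoints S hS
  have hle : (S : Set C(Z, ℝ)) ⊆ (reluSpan A).topologicalClosure := by
    have : Subalgebra.toSubmodule S = Submodule.span ℝ (M : Set C(Z, ℝ)) := by
      rw [Algebra.adjoin_eq_span, Submonoid.closure_eq]
    intro f hf
    have hf' : f ∈ Submodule.span ℝ (M : Set C(Z, ℝ)) := this ▸ hf
    refine Submodule.span_le.2 ?_ hf'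
    rintro _ ⟨g, hg, rfl⟩
    exact expComp_mem_closure h1 hg
  refine eq_top_iff.2 fun f _ => ?_
  have hf : f ∈ S.topologicalClosure := htop ▸ Algebra.mem_top
  have := closure_minimal hle (Submodule.isClosed_topologicalClosure _)
  exact this hf

end Density

/-- A continuous function on a compact space that is determined by a family of continuous features
is approximated by a rectified network with one hidden layer that reads finitely many features. -/
theorem exists_relu_net_approx {X ι : Type*} [TopologicalSpace X] [CompactSpace X]
    (f : ι → C(X, ℝ)) (u : C(X, ℝ)) (h : ∀ p q, (∀ i, f i p = f i q) → u p = u q) {ε : ℝ}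
    (hε : 0 < ε) : ∃ (n : ℕ) (V : Fin n → ℝ) (W : Fin n → ι →₀ ℝ) (b : Fin n → ℝ),
      ∀ p, |∑ s, V s * relu ((W s).sum (fun i c => c * f i p) + b s) - u p| ≤ ε := by
  let code : X → ι → ℝ := fun p i => f i p
  have hcode : Continuous code := continuous_pi fun i => (f i).continuous
  -- `u` descends to the image of the features, a compact space whose points are separated by the
  -- coordinates. The descent is continuous because the map onto the image is closed.
  let Z := Set.range code
  have : CompactSpace Z := isCompact_iff_compactSpace.1 (isCompact_range hcode)
  let π : C(X, Z) := ⟨Set.rangeFactorization code, hcode.subtype_mk _⟩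
  have hπ : Topology.IsQuotientMap π :=
    (π.continuous.isClosedMap).isQuotientMap π.continuous Set.rangeFactorization_surjective
  have hfac : Function.FactorsThrough u π := fun p q e => h p q fun i =>
    congrFun (congrArg Subtype.val e) i
  let u' : C(Z, ℝ) := hπ.lift u hfac
  have hu' : ∀ p, u' (π p) = u p := fun p =>
    congrFun (congrArg DFunLike.coe (hπ.lift_comp u hfac)) p
  let co : ι → C(Z, ℝ) := fun i =>
    ⟨fun z => z.1 i, (continuous_apply i).comp continuous_subtype_val⟩
  -- Affine functions of finitely many features, the inputs of the hidden layer.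
  let T : ((ι →₀ ℝ) × ℝ) →ₗ[ℝ] C(Z, ℝ) :=
    (Finsupp.linearCombination ℝ co).coprod (LinearMap.toSpanSingleton ℝ _ 1)
  have hd := reluSpan_topologicalClosure (A := LinearMap.range T) ⟨(0, 1), by simp [T]⟩ (by
    intro x y hxy
    obtain ⟨i, hi⟩ : ∃ i, x.1 i ≠ y.1 i := by
      by_contra! hall; exact hxy (Subtype.ext (funext hall))
    exact ⟨co i, ⟨(Finsupp.single i 1, 0), by simp [T]⟩, hi⟩)
  have hmem : u' ∈ (reluSpan (LinearMap.range T)).topologicalClosure := hd ▸ Submodule.mem_top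
  obtain ⟨g, hg, hdist⟩ := Metric.mem_closure_iff.1 hmem ε hε
  obtain ⟨n, V, r, rfl⟩ := Submodule.mem_span_set'.1 hg
  choose ℓ hℓ hr using fun s => (r s).2
  choose wb hwb using hℓ
  refine ⟨n, V, fun s => (wb s).1, fun s => (wb s).2, fun p => ?_⟩
  have h1 := ContinuousMap.dist_apply_le_dist (f := u')
    (g := ∑ s, V s • (r s : C(Z, ℝ))) (π p)
  rw [Real.dist_eq, abs_sub_comm, hu'] at h1
  refine (le_of_eq ?_).trans (h1.trans hdist.le)
  congr 2
  rw [ContinuousMap.sum_apply]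
  refine Finset.sum_congr rfl fun s _ => ?_
  rw [ContinuousMap.smul_apply, ← hr s, ← hwb s, smul_eq_mul]
  congr 1
  simp only [reluComp, ContinuousMap.coe_mk]
  congr 1
  simp [T, Finsupp.linearCombination_apply, Finsupp.sum, ContinuousMap.sum_apply, co, π, code]
  rfl

namespace PoissonProblem

/-! ### Continuity for a fixed connectivity table -/

/-- The problem with a given table, given positions and a given right-hand side. -/
abbrev ofTable (T : MeshTable) (q : (Fin T.numNodes → Plane) × (Fin T.numNodes → ℝ)) :
    PoissonProblem := { toMeshTable := T, pos := q.1, B := q.2 }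

section Continuity

variable {T : MeshTable} {Q : Set ((Fin T.numNodes → Plane) × (Fin T.numNodes → ℝ))}

lemma continuous_pos (i : Fin T.numNodes) : Continuous fun q : Q => (ofTable T q).pos i :=
  (continuous_apply i).comp (continuous_fst.comp continuous_subtype_val)

lemma continuous_B (i : Fin T.numNodes) : Continuous fun q : Q => (ofTable T q).B i :=
  (continuous_apply i).comp (continuous_snd.comp continuous_subtype_val)

lemma continuous_vertex (a : Fin T.numTri) (r : Fin 3) :
    Continuous fun q : Q => (ofTable T q).vertex a r :=
  continuous_pos (T.tri a r)

lemma continuous_planeCross {X : Type*} [TopologicalSpace X] {f g : X → Plane} (hf : Continuous f)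
    (hg : Continuous g) : Continuous fun x => planeCross (f x) (g x) := by
  unfold planeCross; fun_prop

lemma continuous_planeRot : Continuous planeRot := by
  have h : Continuous fun v : Plane => (![-(v 1), v 0] : Fin 2 → ℝ) := by
    refine continuous_pi fun i => ?_
    fin_cases i
    · simp only [Fin.zero_eta, Matrix.cons_val_zero]; fun_prop
    · simp only [Fin.mk_one, Matrix.cons_val_one]; fun_prop
  exact (PiLp.continuous_toLp 2 _).comp h

lemma continuous_det (a : Fin T.numTri) : Continuous fun q : Q => (ofTable T q).det a :=
  continuous_planeCross ((continuous_vertex a 1).sub (continuous_vertex a 0))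
    ((continuous_vertex a 2).sub (continuous_vertex a 0))

variable (hQ : ∀ q ∈ Q, (ofTable T q).IsMesh)
include hQ

lemma continuous_hatGrad (a : Fin T.numTri) (r : Fin 3) :
    Continuous fun q : Q => (ofTable T q).hatGrad a r :=
  ((continuous_det a).inv₀ fun q => (hQ q q.2).nondegenerate a).smul
    (continuous_planeRot.comp ((continuous_vertex a _).sub (continuous_vertex a _)))

lemma continuous_A : @Continuous Q (Matrix (Fin T.numNodes) (Fin T.numNodes) ℝ) _ _
    fun q => (ofTable T q).A := by
  change Continuous fun (q : Q) (i j : Fin T.numNodes) => (ofTable T q).A i j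
  refine continuous_pi fun i => continuous_pi fun j => ?_
  change Continuous fun q : Q =>
    if T.kind i = NodeKind.dirichlet then (if i = j then (1 : ℝ) else 0)
    else (ofTable T q).stiffness i j
  by_cases hi : T.kind i = NodeKind.dirichlet
  · simp only [hi, if_true]; exact continuous_const
  · simp only [hi, if_false]
    change Continuous fun q : Q => ∑ a, ∑ r, ∑ s, if T.tri a r = i ∧ T.tri a s = j then
      (ofTable T q).area a * inner ℝ ((ofTable T q).hatGrad a r) ((ofTable T q).hatGrad a s) else 0
    refine continuous_finsetSum _ fun a _ => continuous_finsetSum _ fun r _ =>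
      continuous_finsetSum _ fun s _ => ?_
    split_ifs
    · exact ((continuous_det a).abs.div_const 2).mul
        ((continuous_hatGrad hQ a r).inner (continuous_hatGrad hQ a s))
    · exact continuous_const

lemma continuous_solution (i : Fin T.numNodes) :
    Continuous fun q : Q => (ofTable T q).solution i := by
  have hA := continuous_A hQ
  -- Cramer's formula expresses the solution through polynomials in the entries of `A` and `B` and a
  -- determinant that never vanishes.
  have h : ∀ q : Q, (ofTable T q).solution i =
      ((ofTable T q).A.det)⁻¹ * ∑ j, (ofTable T q).A.adjugate i j * (ofTable T q).B j := by
    intro q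
    rw [solution, Matrix.inv_def, Ring.inverse_eq_inv', Matrix.smul_mulVec, Pi.smul_apply,
      smul_eq_mul]
    rfl
  simp only [h]
  refine (hA.matrix_det.inv₀ fun q : Q => (hQ q.1 q.2).det_A_ne_zero).mul ?_
  change Continuous fun q : Q => ∑ j : Fin T.numNodes, _
  exact continuous_finsetSum _ fun j _ =>
    (hA.matrix_adjugate.matrix_elem i j).mul (continuous_B j)

/-- The normalization is continuous because the sum of the two edge normals never vanishes. -/
lemma continuous_normal {i : Fin T.numNodes} (hi : T.kind i ≠ NodeKind.interior) :
    Continuous fun q : Q => (ofTable T q).normal i := by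
  have hs : Continuous fun q : Q => ∑ e ∈ (ofTable T q).boundaryEdgesAt i,
      (ofTable T q).edgeNormal e.1 e.2 := by
    -- The boundary edges depend on the table only, so the index set may be taken at any data, here
    -- zero.
    change Continuous fun q : Q => ∑ e ∈ (ofTable T 0).boundaryEdgesAt i, _
    refine continuous_finsetSum _ fun e _ => ?_
    have hg := continuous_hatGrad hQ e.1 e.2
    refine (Continuous.smul (hg.norm.inv₀ fun q => ?_) hg).neg
    rw [norm_ne_zero_iff]
    have hd := (hQ q q.2).nondegenerate e.1
    rw [hatGrad, smul_ne_zero_iff]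
    refine ⟨inv_ne_zero hd, ?_⟩
    rw [← norm_ne_zero_iff, planeRot_norm, norm_ne_zero_iff, sub_ne_zero]
    intro he
    exact (fin3_succ_ne e.2).2.2 ((hQ q q.2).vertex_injective _ he).symm
  exact (hs.norm.inv₀ fun q => norm_ne_zero_iff.2 ((hQ q q.2).normalSum_ne_zero hi)).smul hs

lemma continuous_nodeData (i : Fin T.numNodes) (x : NodeIdx) :
    Continuous fun q : Q => (ofTable T q).nodeData i x := by
  rcases x with c | c | c | c
  · have := continuous_pos (Q := Q) i
    change Continuous fun q : Q => (ofTable T q).pos i c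
    fun_prop
  · change Continuous fun q : Q => (ofTable T q).B i * (ofTable T 0).oneHot i c
    exact (continuous_B i).mul continuous_const
  · change Continuous fun _ : Q => (ofTable T 0).oneHot i c
    exact continuous_const
  · change Continuous fun q : Q =>
      if T.kind i = NodeKind.neumann then (ofTable T q).normal i c else 0
    by_cases hi : T.kind i = NodeKind.neumann
    · simp only [hi, if_true]
      exact (EuclideanSpace.proj (𝕜 := ℝ) c).continuous.comp
        (continuous_normal hQ (i := i) (by rw [hi]; decide))
    · simp only [hi, if_false]; exact continuous_const

lemma continuous_edgeSum (w : NodeIdx ⊕ NodeIdx → ℝ) (b : ℝ) (i : Fin T.numNodes) :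
    Continuous fun q : Q => (ofTable T q).edgeSum w b i := by
  change Continuous fun q : Q => ∑ j ∈ (ofTable T 0).nbrFinset i, _
  refine continuous_finsetSum _ fun j _ => continuous_relu.comp (Continuous.add ?_ continuous_const)
  refine continuous_finsetSum _ fun x _ => continuous_const.mul ?_
  rcases x with x | x
  exacts [continuous_nodeData hQ i x, continuous_nodeData hQ j x]

lemma continuous_feature (l : ℝ) (w : NodeIdx ⊕ NodeIdx → ℝ) (b : ℝ) (i : Fin T.numNodes) :
    Continuous fun q : Q => (ofTable T q).feature l w b i := by
  by_cases hi : T.kind i ≠ NodeKind.dirichlet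
  · have : ∀ q : Q, (ofTable T q).feature l w b i = ∑ j : (ofTable T 0).Free,
        (ofTable T 0).propagator l ⟨i, hi⟩ j * (ofTable T q).edgeSum w b j :=
      fun q => dif_pos hi
    simp only [this]
    exact continuous_finsetSum _ fun j _ => continuous_const.mul (continuous_edgeSum hQ w b j)
  · have : ∀ q : Q, (ofTable T q).feature l w b i = 0 := fun q => dif_neg hi
    simp only [this]
    exact continuous_const

end Continuity

/-! ### Finitely many tables -/

lemma IsMesh.numTri_le {G : PoissonProblem} (hG : G.IsMesh) : G.numTri ≤ 2 ^ G.numNodes := by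
  have : Function.Injective fun a => Set.range (G.tri a) := fun a b h => by
    by_contra hne; exact hG.distinct a b hne h
  simpa using Fintype.card_le_of_injective _ this

instance : Finite NodeKind :=
  Finite.of_injective (fun k : NodeKind => match k with
    | NodeKind.interior => (0 : Fin 3)
    | NodeKind.dirichlet => 1
    | NodeKind.neumann => 2) (by intro a b; cases a <;> cases b <;> simp)

lemma finite_tables (n t : ℕ) : {T : MeshTable | T.numNodes ≤ n ∧ T.numTri ≤ t}.Finite := by
  let S := Σ (N : Fin (n + 1)) (k : Fin (t + 1)),
    (Fin k → Fin 3 → Fin N) × (Fin N → NodeKind)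
  refine (Set.finite_range fun s : S => (⟨s.1, s.2.1, s.2.2.1, s.2.2.2⟩ : MeshTable)).subset ?_
  rintro ⟨N, k, tri, kind⟩ ⟨h1, h2⟩
  exact ⟨⟨⟨N, Nat.lt_succ_of_le h1⟩, ⟨k, Nat.lt_succ_of_le h2⟩, tri, kind⟩, rfl⟩

/-- The static data and the solutions of a compact family are a continuous image of a compact space,
so that the data are bounded and finitely many features determine the solution approximately. -/
theorem exists_decoder {𝒟 : Set PoissonProblem} (hmesh : ∀ G ∈ 𝒟, G.IsMesh)
    (hcompact : IsCompactFamily 𝒟) {l : ℝ} (hl : 0 < l) (hN : ∀ G ∈ 𝒟, l * G.numNodes < 1)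
    {ε : ℝ} (hε : 0 < ε) :
    (∃ R : ℝ, ∀ G ∈ 𝒟, ∀ i x, |G.nodeData i x| ≤ R) ∧
    ∃ (F : Finset ((NodeIdx ⊕ NodeIdx → ℝ) × ℝ)) (n : ℕ) (V : Fin n → ℝ)
      (W : Fin n → NodeIdx ⊕ F → ℝ) (b : Fin n → ℝ), ∀ G ∈ 𝒟, ∀ i,
      |∑ s, V s * relu (W s ⬝ᵥ Sum.elim (G.nodeData i)
        (fun k : F => G.feature l k.1.1 k.1.2 i) + b s) - G.solution i| ≤ ε := by
  classical
  obtain ⟨⟨n₀, hn₀⟩, hQ⟩ := hcompact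
  let Q : (T : MeshTable) → Set ((Fin T.numNodes → Plane) × (Fin T.numNodes → ℝ)) :=
    fun T => {q | ofTable T q ∈ 𝒟}
  have hQm : ∀ T, ∀ q ∈ Q T, (ofTable T q).IsMesh := fun T q hq => hmesh _ hq
  let S : Set MeshTable := {T | (Q T).Nonempty}
  -- A bound on the number of nodes bounds the number of triangles, which leaves finitely many
  -- tables.
  have hS : S.Finite := (finite_tables n₀ (2 ^ n₀)).subset fun T ⟨q, hq⟩ =>
    ⟨hn₀ _ hq, (hQm T q hq).numTri_le.trans (Nat.pow_le_pow_right two_pos (hn₀ _ hq))⟩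
  have : Finite S := hS
  have : ∀ T : S, CompactSpace (Q T) := fun T => isCompact_iff_compactSpace.1 (hQ T)
  -- All pairs of a problem and a node form one compact space, so that one decoder serves the whole
  -- family.
  let X := Σ T : S, Q T × Fin T.1.numNodes
  let Gx : X → PoissonProblem := fun p => ofTable p.1.1 p.2.1
  have hGx : ∀ p : X, Gx p ∈ 𝒟 := fun p => p.2.1.2
  have hcont : ∀ φ : (T : MeshTable) → (q : Q T) → Fin T.numNodes → ℝ,
      (∀ T i, Continuous fun q => φ T q i) → Continuous fun p : X => φ p.1.1 p.2.1 p.2.2 := by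
    intro φ h
    refine continuous_sigma fun T => ?_
    refine continuous_prod_of_discrete_right.2 fun i => ?_
    exact h T i
  let ι := NodeIdx ⊕ ((NodeIdx ⊕ NodeIdx → ℝ) × ℝ)
  let f : ι → C(X, ℝ) := fun c => match c with
    | Sum.inl x => ⟨fun p => (Gx p).nodeData p.2.2 x,
        hcont (fun T q i => (ofTable T q).nodeData i x) fun T i => continuous_nodeData (hQm T) i x⟩
    | Sum.inr k => ⟨fun p => (Gx p).feature l k.1 k.2 p.2.2,
        hcont (fun T q i => (ofTable T q).feature l k.1 k.2 i)
          fun T i => continuous_feature (hQm T) l k.1 k.2 i⟩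
  let u : C(X, ℝ) := ⟨fun p => (Gx p).solution p.2.2,
    hcont (fun T q i => (ofTable T q).solution i) fun T i => continuous_solution (hQm T) i⟩
  have hpt : ∀ G ∈ 𝒟, ∀ i : Fin G.numNodes, ∃ p : X, Gx p = G ∧ HEq p.2.2 i :=
    fun G hG i => ⟨⟨⟨G.toMeshTable, ⟨(G.pos, G.B), hG⟩⟩, ⟨(G.pos, G.B), hG⟩, i⟩, rfl, HEq.rfl⟩
  constructor
  · refine ⟨∑ x, ‖f (Sum.inl x)‖, fun G hG i x => ?_⟩
    obtain ⟨p, rfl, hi⟩ := hpt G hG i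
    obtain rfl := eq_of_heq hi
    exact ((f (Sum.inl x)).norm_coe_le_norm p).trans
      (Finset.single_le_sum (f := fun x => ‖f (Sum.inl x)‖) (fun x _ => norm_nonneg _)
        (Finset.mem_univ x))
  have hsep : ∀ p q : X, (∀ c, f c p = f c q) → u p = u q := by
    intro p q h
    have hd : (Gx p).nodeData p.2.2 = (Gx q).nodeData q.2.2 := funext fun x => h (Sum.inl x)
    have hk := kind_eq_of_nodeData hd
    change (Gx p).solution p.2.2 = (Gx q).solution q.2.2
    by_cases hp : (Gx p).kind p.2.2 = NodeKind.dirichlet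
    · rw [(hmesh _ (hGx p)).solution_dirichlet hp,
        (hmesh _ (hGx q)).solution_dirichlet (hk ▸ hp), B_eq_of_nodeData hd]
    · exact (hmesh _ (hGx p)).solution_eq_of_feature (hmesh _ (hGx q)) hl (hN _ (hGx p))
        (hN _ (hGx q)) (i := ⟨_, hp⟩) (i' := ⟨_, hk ▸ hp⟩) hd fun w b => h (Sum.inr (w, b))
  obtain ⟨n, V, W, b, h⟩ := exists_relu_net_approx f u hsep hε
  -- The propagated features that some hidden unit reads.
  let F := (Finset.univ.biUnion fun s => (W s).support).toRight
  refine ⟨F, n, V, fun s => Sum.elim (fun x => W s (Sum.inl x)) (fun k => W s (Sum.inr k.1)), b,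
    fun G hG i => ?_⟩
  obtain ⟨p, rfl, hi⟩ := hpt G hG i
  obtain rfl := eq_of_heq hi
  have e : ∀ s, (W s).sum (fun c t => t * f c p) =
      Sum.elim (fun x => W s (Sum.inl x)) (fun k : F => W s (Sum.inr k.1)) ⬝ᵥ
        Sum.elim ((Gx p).nodeData p.2.2) fun k : F => (Gx p).feature l k.1.1 k.1.2 p.2.2 := by
    intro s
    rw [Finsupp.sum_of_support_subset (s := Finset.univ.disjSum F)]
    · rw [Finset.sum_disjSum, ← Finset.sum_coe_sort F]
      simp [dotProduct, Fintype.sum_sum_type, f]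
    · intro c hc
      rcases c with x | k
      · simp
      · have : Sum.inr k ∈ Finset.univ.biUnion fun s => (W s).support :=
          Finset.mem_biUnion.2 ⟨s, Finset.mem_univ s, hc⟩
        simpa [F] using this
    · simp
  have := h p
  simp only [e] at this
  exact this

end PoissonProblem

/-! ### Layer normalization -/

/-- Mean of a feature vector. -/
def lnMean {d : ℕ} (z : Fin d → ℝ) : ℝ := (1 / (d : ℝ)) * ∑ c, z c

/-- Variance of a feature vector. -/
def lnVar {d : ℕ} (z : Fin d → ℝ) : ℝ := (1 / (d : ℝ)) * ∑ c, (z c - lnMean z) ^ 2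

/-- The denominator of the layer normalization. -/
def lnScale (η : ℝ) {d : ℕ} (z : Fin d → ℝ) : ℝ := √(lnVar z + η)

section LayerNorm

variable {d : ℕ} {η : ℝ}

lemma layerNorm_apply (g : ℝ) (z : Fin d → ℝ) (c : Fin d) :
    layerNorm η (fun _ => g) 0 z c = g * ((z c - lnMean z) / lnScale η z) := add_zero _

lemma lnMean_sub (z z' : Fin d → ℝ) : lnMean (z - z') = lnMean z - lnMean z' := by
  simp [lnMean, mul_sub]

lemma abs_lnMean_le (z : Fin d → ℝ) : |lnMean z| ≤ ‖z‖ := by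
  rcases Nat.eq_zero_or_pos d with rfl | hd
  · simp [lnMean]
  have hd' : (0 : ℝ) < d := by exact_mod_cast hd
  rw [lnMean, abs_mul, abs_of_pos (by positivity), one_div, inv_mul_le_iff₀ hd']
  calc |∑ c, z c| ≤ ∑ c, |z c| := Finset.abs_sum_le_sum_abs _ _
    _ ≤ ∑ _c : Fin d, ‖z‖ := Finset.sum_le_sum fun c _ => norm_le_pi_norm z c
    _ = d * ‖z‖ := by simp

lemma lnVar_nonneg (z : Fin d → ℝ) : 0 ≤ lnVar z := by
  unfold lnVar; positivity

lemma lnVar_eq (hd : 0 < d) (z : Fin d → ℝ) :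
    lnVar z = (1 / (d : ℝ)) * ∑ c, z c ^ 2 - lnMean z ^ 2 := by
  have hd' : (d : ℝ) ≠ 0 := by exact_mod_cast hd.ne'
  have h1 : ∑ c, z c = d * lnMean z := by rw [lnMean]; field_simp
  have h2 : ∑ c, (z c - lnMean z) ^ 2 = ∑ c, z c ^ 2 - d * lnMean z ^ 2 := by
    simp only [sub_sq, Finset.sum_add_distrib, Finset.sum_sub_distrib, Finset.sum_const,
      Finset.card_univ, Fintype.card_fin, nsmul_eq_mul]
    rw [← Finset.sum_mul, ← Finset.mul_sum, h1]; ring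
  rw [lnVar, h2]; field_simp

lemma lnVar_le_meanSq (hd : 0 < d) (z : Fin d → ℝ) : lnVar z ≤ (1 / (d : ℝ)) * ∑ c, z c ^ 2 := by
  rw [lnVar_eq hd]; nlinarith [sq_nonneg (lnMean z)]

lemma lnVar_le_norm_sq (hd : 0 < d) (z : Fin d → ℝ) : lnVar z ≤ ‖z‖ ^ 2 := by
  have hd' : (0 : ℝ) < d := by exact_mod_cast hd
  refine (lnVar_le_meanSq hd z).trans ?_
  rw [one_div, inv_mul_le_iff₀ hd']
  calc ∑ c, z c ^ 2 ≤ ∑ _c : Fin d, ‖z‖ ^ 2 := Finset.sum_le_sum fun c _ =>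
        sq_le_sq' (neg_le_of_abs_le (norm_le_pi_norm z c)) (le_of_abs_le (norm_le_pi_norm z c))
    _ = d * ‖z‖ ^ 2 := by simp

/-- Applied to the constant slot and the reference slot, whose gap keeps the scale away from zero.
-/
lemma le_lnVar (z : Fin d → ℝ) {c c' : Fin d} (h : c ≠ c') :
    (z c - z c') ^ 2 / (2 * d) ≤ lnVar z := by
  have hd' : (0 : ℝ) < d := by exact_mod_cast c.pos
  have h1 : (z c - lnMean z) ^ 2 + (z c' - lnMean z) ^ 2 ≤ ∑ c, (z c - lnMean z) ^ 2 := by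
    rw [← Finset.sum_pair h (f := fun c => (z c - lnMean z) ^ 2)]
    exact Finset.sum_le_univ_sum_of_nonneg fun c => sq_nonneg _
  rw [lnVar, div_le_iff₀ (by positivity)]
  have h2 : 1 / (d : ℝ) * (∑ c, (z c - lnMean z) ^ 2) * (2 * d) =
      2 * ∑ c, (z c - lnMean z) ^ 2 := by
    field_simp
  rw [h2]
  nlinarith [sq_nonneg (z c + z c' - 2 * lnMean z)]

lemma sq_sub_lnMean_le (z : Fin d → ℝ) (c : Fin d) : (z c - lnMean z) ^ 2 ≤ d * lnVar z := by
  have hd' : (d : ℝ) ≠ 0 := by exact_mod_cast c.pos.ne'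
  have : d * lnVar z = ∑ c, (z c - lnMean z) ^ 2 := by rw [lnVar]; field_simp
  rw [this]
  exact Finset.single_le_sum (f := fun c => (z c - lnMean z) ^ 2) (fun c _ => sq_nonneg _)
    (Finset.mem_univ c)

/-- Each squared deviation is at most `d` times the variance, so the gain bounds the output whatever
the input. A vanishing scale is harmless, as the quotient is then `0`. -/
lemma abs_layerNorm_le (hη : 0 ≤ η) {g : ℝ} (hg : 0 ≤ g) (z : Fin d → ℝ) (c : Fin d) :
    |layerNorm η (fun _ => g) 0 z c| ≤ g * d := by
  have hd' : (1 : ℝ) ≤ d := by exact_mod_cast c.pos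
  rw [layerNorm_apply, abs_mul, abs_of_nonneg hg]
  refine mul_le_mul_of_nonneg_left ?_ hg
  rw [abs_div, abs_of_nonneg (a := lnScale η z) (Real.sqrt_nonneg _)]
  refine div_le_of_le_mul₀ (Real.sqrt_nonneg _) (by linarith) ?_
  refine abs_le_of_sq_le_sq ?_ (mul_nonneg (by linarith) (Real.sqrt_nonneg _))
  have hv := lnVar_nonneg z
  rw [mul_pow, lnScale, Real.sq_sqrt (by linarith)]
  refine (sq_sub_lnMean_le z c).trans ?_
  have : (d : ℝ) ≤ d ^ 2 := by nlinarith
  calc (d : ℝ) * lnVar z ≤ d ^ 2 * lnVar z := by gcongr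
    _ ≤ d ^ 2 * (lnVar z + η) := by gcongr; linarith

/-- The scale is the Euclidean norm of the vector formed by `√η` and the deviations divided by `√d`.
The reverse triangle inequality applies, and the constant entry drops out of the difference. -/
lemma lnScale_sub_le (hη : 0 ≤ η) (hd : 0 < d) (z z' : Fin d → ℝ) :
    |lnScale η z - lnScale η z'| ≤ ‖z - z'‖ := by
  have hd' : (0 : ℝ) < d := by exact_mod_cast hd
  let X : (Fin d → ℝ) → EuclideanSpace ℝ (Option (Fin d)) := fun z =>
    WithLp.toLp 2 fun o => o.elim √η fun c => (z c - lnMean z) / √d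
  have hX : ∀ z, ‖X z‖ = lnScale η z := fun z => by
    rw [EuclideanSpace.norm_eq, lnScale, Fintype.sum_option, add_comm, lnVar, Finset.mul_sum]
    congr 2
    · refine Finset.sum_congr rfl fun c _ => ?_
      simp only [X, Option.elim, Real.norm_eq_abs, sq_abs]
      rw [div_pow, Real.sq_sqrt hd'.le]; ring
    · simp [X, Real.sq_sqrt hη]
  have hsub : ‖X z - X z'‖ ^ 2 = lnVar (z - z') := by
    rw [EuclideanSpace.norm_sq_eq, Fintype.sum_option, lnVar, Finset.mul_sum]
    have : ‖(X z - X z') none‖ ^ 2 = 0 := by simp [X]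
    rw [this, zero_add]
    refine Finset.sum_congr rfl fun c _ => ?_
    simp only [X, Option.elim, Real.norm_eq_abs, sq_abs, PiLp.sub_apply, Pi.sub_apply, lnMean_sub]
    rw [← sub_div, div_pow, Real.sq_sqrt hd'.le]; ring
  rw [← hX, ← hX]
  refine (abs_norm_sub_norm_le _ _).trans (abs_le_of_sq_le_sq' ?_ (norm_nonneg _)).2
  rw [hsub]
  exact lnVar_le_norm_sq hd _

end LayerNorm

/-! ### The scaled hyperbolic tangent -/

lemma hasDerivAt_tanh (x : ℝ) : HasDerivAt Real.tanh (1 / Real.cosh x ^ 2) x := by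
  have h := (Real.hasDerivAt_sinh x).div (Real.hasDerivAt_cosh x) (Real.cosh_pos x).ne'
  have e : Real.tanh = fun y => Real.sinh y / Real.cosh y := funext Real.tanh_eq_sinh_div_cosh
  have e' : Real.cosh x * Real.cosh x - Real.sinh x * Real.sinh x = 1 := by
    linarith [Real.cosh_sq x]
  rw [e'] at h
  rw [e]
  exact h

lemma abs_tanh_sub_le (x y : ℝ) : |Real.tanh x - Real.tanh y| ≤ |x - y| := by
  have := Convex.norm_image_sub_le_of_norm_hasDerivWithin_le (f := Real.tanh) (C := 1)
    (fun x _ => (hasDerivAt_tanh x).hasDerivWithinAt) (fun x _ => ?_) convex_univ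
    (Set.mem_univ y) (Set.mem_univ x)
  · simpa using this
  · have := Real.one_le_cosh x
    rw [Real.norm_of_nonneg (by positivity)]
    exact div_le_one_of_le₀ (one_le_pow₀ this) (by positivity)

/-- The hyperbolic tangent, rescaled to approximate the identity. -/
def scaledTanh (δ t : ℝ) : ℝ := Real.tanh (δ * t) / δ

lemma abs_scaledTanh_sub_le {δ : ℝ} (hδ : 0 < δ) (x y : ℝ) :
    |scaledTanh δ x - scaledTanh δ y| ≤ |x - y| := by
  rw [scaledTanh, scaledTanh, ← sub_div, abs_div, abs_of_pos hδ, div_le_iff₀ hδ]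
  refine (abs_tanh_sub_le _ _).trans_eq ?_
  rw [← mul_sub, abs_mul, abs_of_pos hδ, mul_comm]

lemma exists_scaledTanh_approx (R ε : ℝ) (hε : 0 < ε) :
    ∃ δ, 0 < δ ∧ ∀ t, |t| ≤ R → |scaledTanh δ t - t| ≤ ε := by
  set R' := |R| + 1
  have hR : 0 < R' := by positivity
  -- The derivative of tanh at `0` is `1`, so `tanh (δ * t)` differs from `δ * t` by a small
  -- multiple of `δ`.
  have h := (hasDerivAt_tanh 0).isLittleO
  have h2 := h.def (c := ε / R') (by positivity)
  obtain ⟨r, hr, h3⟩ := Metric.eventually_nhds_iff.1 h2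
  refine ⟨r / (2 * R'), by positivity, fun t ht => ?_⟩
  set δ := r / (2 * R') with hδ
  have hδ0 : 0 < δ := by positivity
  have ht' : |t| ≤ R' := ht.trans ((le_abs_self R).trans (by simp [R']))
  have hlt : |δ * t| < r := by
    rw [abs_mul, abs_of_pos hδ0]
    calc δ * |t| ≤ δ * R' := by gcongr
      _ = r / 2 := by rw [hδ]; field_simp
      _ < r := by linarith
  have h4 := h3 (y := δ * t) (by simpa using hlt)
  simp at h4
  have : scaledTanh δ t - t = (Real.tanh (δ * t) - δ * t) / δ := by
    rw [scaledTanh]; field_simp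
  rw [this, abs_div, abs_of_pos hδ0, div_le_iff₀ hδ0]
  refine h4.trans ?_
  rw [abs_of_pos hδ0]
  calc ε / R' * (δ * |t|) ≤ ε / R' * (δ * R') := by gcongr
    _ = ε * δ := by field_simp

/-! ### Attracting fixed points -/

/-- A map that contracts a gauge on an absorbing closed set has a globally attracting fixed
point. -/
lemma exists_attracting_fixedPoint {E : Type*} [MetricSpace E] [CompleteSpace E] [Nonempty E]
    (h : E → E) (V : E → E → ℝ) {c C : ℝ} (hc : 0 < c) (hV : ∀ x y, c * dist x y ≤ V x y)
    (hV' : ∀ x y, V x y ≤ C * dist x y) {Ω : Set E} (hΩ : IsClosed Ω)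
    (hinv : ∀ x ∈ Ω, h x ∈ Ω) (habs : ∀ x, ∃ k, h^[k] x ∈ Ω)
    (hcon : ∀ x ∈ Ω, ∀ y ∈ Ω, V (h x) (h y) ≤ 1 / 2 * V x y) :
    ∃ x₀ ∈ Ω, (∀ x, h x = x ↔ x = x₀) ∧
      ∀ x, Filter.Tendsto (fun k => h^[k] x) Filter.atTop (nhds x₀) := by
  have hit : ∀ x ∈ Ω, ∀ k, h^[k] x ∈ Ω := by
    intro x hx k
    induction k with
    | zero => exact hx
    | succ k ih => rw [Function.iterate_succ_apply']; exact hinv _ ih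
  have hVk : ∀ x ∈ Ω, ∀ y ∈ Ω, ∀ k, V (h^[k] x) (h^[k] y) ≤ (1 / 2) ^ k * V x y := by
    intro x hx y hy k
    induction k with
    | zero => simp
    | succ k ih =>
      rw [Function.iterate_succ_apply', Function.iterate_succ_apply', pow_succ']
      have := hcon _ (hit x hx k) _ (hit y hy k)
      linarith
  have hdk : ∀ x ∈ Ω, ∀ y ∈ Ω, ∀ k, dist (h^[k] x) (h^[k] y) ≤ V x y / c * (1 / 2) ^ k := by
    intro x hx y hy k
    have h1 := (hV _ _).trans (hVk x hx y hy k)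
    rw [div_mul_eq_mul_div, le_div_iff₀ hc]; linarith
  have hlim0 : ∀ a : ℝ,
      Filter.Tendsto (fun k : ℕ => a * (1 / 2 : ℝ) ^ k) Filter.atTop (nhds 0) := by
    intro a
    simpa using (tendsto_pow_atTop_nhds_zero_of_lt_one (r := (1 / 2 : ℝ)) (by norm_num)
      (by norm_num)).const_mul a
  obtain ⟨y⟩ := ‹Nonempty E›
  obtain ⟨k₀, hk₀⟩ := habs y
  set x := h^[k₀] y
  have hcs : CauchySeq fun k => h^[k] x := by
    refine cauchySeq_of_le_geometric (1 / 2) (V x (h x) / c) (by norm_num) fun k => ?_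
    have := hdk x hk₀ (h x) (hinv x hk₀) k
    rwa [← Function.iterate_succ_apply] at this
  obtain ⟨x₀, hx₀⟩ := cauchySeq_tendsto_of_complete hcs
  have hmem : x₀ ∈ Ω := hΩ.mem_of_tendsto hx₀ (Filter.Eventually.of_forall fun k => hit x hk₀ k)
  have hfix : h x₀ = x₀ := by
    -- Continuity of `h` is not assumed; along the orbit it follows from the contraction of the
    -- gauge and its comparison with the distance.
    have h1 : Filter.Tendsto (fun k => h (h^[k] x)) Filter.atTop (nhds (h x₀)) := by
      rw [tendsto_iff_dist_tendsto_zero] at hx₀ ⊢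
      refine squeeze_zero (fun _ => dist_nonneg) (g := fun k => C / c * dist (h^[k] x) x₀)
        (fun k => ?_) (by simpa using hx₀.const_mul (C / c))
      have h2 := hV (h (h^[k] x)) (h x₀)
      have h3 := hcon _ (hit x hk₀ k) _ hmem
      have h4 := hV' (h^[k] x) x₀
      have h5 := hV (h^[k] x) x₀
      have h6 : 0 ≤ c * dist (h^[k] x) x₀ := by positivity
      rw [div_mul_eq_mul_div, le_div_iff₀ hc]
      linarith
    have h2 := hx₀.comp (Filter.tendsto_add_atTop_nat 1)
    refine tendsto_nhds_unique h1 (h2.congr fun k => ?_)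
    simp [Function.iterate_succ_apply']
  have hfixk : ∀ k, h^[k] x₀ = x₀ := fun k => Function.iterate_fixed hfix k
  have hatt : ∀ x, Filter.Tendsto (fun k => h^[k] x) Filter.atTop (nhds x₀) := by
    intro x
    obtain ⟨k, hk⟩ := habs x
    rw [← Filter.tendsto_add_atTop_iff_nat k, tendsto_iff_dist_tendsto_zero]
    refine squeeze_zero (fun _ => dist_nonneg) (fun j => ?_) (hlim0 (V (h^[k] x) x₀ / c))
    have := hdk _ hk x₀ hmem j
    rwa [hfixk, ← Function.iterate_add_apply] at this
  refine ⟨x₀, hmem, fun x => ⟨fun hx => ?_, fun hx => hx ▸ hfix⟩, hatt⟩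
  have h1 := hatt x
  simp only [Function.iterate_fixed hx] at h1
  exact tendsto_nhds_unique tendsto_const_nhds h1

/-! ### One cell -/

section Cell

variable {d : ℕ} {J : Type} (e : Option (Option J) ↪ Fin d) {η : ℝ}

/-- The values of the slots of a cell: a zero reference, a large constant, and the features. -/
def slotValue (M : ℝ) (α : J → ℝ) : Option (Option J) → ℝ
  | none => 0
  | some none => M
  | some (some j) => α j

/-- A feature vector with the given slots, zero elsewhere. -/
def cellInput (M : ℝ) (α : J → ℝ) : Fin d → ℝ := Function.extend e (slotValue M α) 0

lemma cellInput_apply (M : ℝ) (α : J → ℝ) (o : Option (Option J)) :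
    cellInput e M α (e o) = slotValue M α o := e.injective.extend_apply _ _ _

lemma cellInput_eq_zero (M : ℝ) (α : J → ℝ) {c : Fin d} (hc : ¬∃ o, e o = c) :
    cellInput e M α c = 0 := Function.extend_apply' _ _ _ hc

lemma norm_cellInput_sub_le {M B : ℝ} {α α' : J → ℝ} (hB : 0 ≤ B) (h : ∀ j, |α j - α' j| ≤ B) :
    ‖cellInput e M α - cellInput e M α'‖ ≤ B := by
  refine (pi_norm_le_iff_of_nonneg hB).2 fun c => ?_
  rw [Pi.sub_apply, Real.norm_eq_abs]
  by_cases hc : ∃ o, e o = c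
  · obtain ⟨o, rfl⟩ := hc
    rw [cellInput_apply, cellInput_apply]
    rcases o with _ | _ | j
    · simpa [slotValue] using hB
    · simpa [slotValue] using hB
    · exact h j
  · rw [cellInput_eq_zero e _ _ hc, cellInput_eq_zero e _ _ hc]; simpa using hB

lemma norm_cellInput_le {M B : ℝ} {α : J → ℝ} (hM : 0 ≤ M) (hB : 0 ≤ B) (h : ∀ j, |α j| ≤ B) :
    ‖cellInput e M α‖ ≤ M + B := by
  refine (pi_norm_le_iff_of_nonneg (by positivity)).2 fun c => ?_
  rw [Real.norm_eq_abs]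
  by_cases hc : ∃ o, e o = c
  · obtain ⟨o, rfl⟩ := hc
    rw [cellInput_apply]
    rcases o with _ | _ | j
    · simp only [slotValue, abs_zero]; positivity
    · simp only [slotValue, abs_of_nonneg hM]; linarith
    · exact (h j).trans (by linarith)
  · rw [cellInput_eq_zero e _ _ hc, abs_zero]; positivity

lemma cellInput_zero (M : ℝ) :
    cellInput e M (0 : J → ℝ) = Pi.single (e (some none)) M := by
  funext c
  by_cases hc : ∃ o, e o = c
  · obtain ⟨o, rfl⟩ := hc
    rw [cellInput_apply]
    rcases o with _ | _ | j <;> simp [slotValue]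
  · rw [cellInput_eq_zero e _ _ hc, Pi.single_eq_of_ne]
    rintro rfl
    exact hc ⟨_, rfl⟩

/-- The scale of a cell all of whose features vanish. -/
def refScale (η M : ℝ) : ℝ := lnScale η (cellInput e M (0 : J → ℝ))

/-- Raising `M` raises the scale at least in proportion; this is how `κ` is made as large as the
estimates need. -/
lemma le_refScale (hη : 0 ≤ η) {M : ℝ} : M ≤ 2 * d * refScale e η M := by
  have hd : (1 : ℝ) ≤ d := by exact_mod_cast (e none).pos
  have hne : e (some none) ≠ e none := fun h => by simpa using e.injective h
  have h := le_lnVar (cellInput e M (0 : J → ℝ)) hne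
  rw [cellInput_apply, cellInput_apply] at h
  simp only [slotValue, sub_zero] at h
  have h0 := lnVar_nonneg (cellInput e M (0 : J → ℝ))
  refine le_of_abs_le (abs_le_of_sq_le_sq ?_ (mul_nonneg (by linarith) (Real.sqrt_nonneg _)))
  rw [mul_pow, refScale, lnScale, Real.sq_sqrt (by linarith)]
  rw [div_le_iff₀ (by positivity)] at h
  nlinarith [mul_nonneg (by linarith : (0 : ℝ) ≤ d) h0,
    mul_nonneg (by positivity : (0 : ℝ) ≤ d ^ 2) hη,
    mul_nonneg (mul_nonneg (by linarith : (0 : ℝ) ≤ d) h0) (by linarith : (0 : ℝ) ≤ d - 1)]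

/-- The gap between the constant slot and the reference slot is at least `M - 1` whatever the
features are, so the variance never falls below a quarter of its reference value. -/
lemma half_refScale_le (hη : 0 ≤ η) {M : ℝ} (hM : 4 ≤ M) {χ : ℝ} (hχ : |χ| ≤ 1) {h : Fin d → ℝ}
    (hh : ‖h‖ ≤ 1 / 2) (α : J → ℝ) : refScale e η M / 2 ≤ lnScale η (χ • h + cellInput e M α) := by
  have hd : 0 < d := (e none).pos
  have hd' : (0 : ℝ) < d := by exact_mod_cast hd
  have hne : e (some none) ≠ e none := fun h => by simpa using e.injective h
  have h1 := le_lnVar (χ • h + cellInput e M α) hne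
  simp only [Pi.add_apply, Pi.smul_apply, cellInput_apply, slotValue, smul_eq_mul, add_zero] at h1
  have hc : ∀ c, |χ * h c| ≤ 1 / 2 := fun c => by
    rw [abs_mul]
    calc |χ| * |h c| ≤ 1 * |h c| := by gcongr
      _ ≤ 1 / 2 := by rw [one_mul]; exact (norm_le_pi_norm h c).trans hh
  have h2 := abs_le.1 (hc (e (some none)))
  have h3 := abs_le.1 (hc (e none))
  have h4 : M ^ 2 / 2 ≤ (χ * h (e (some none)) + M - χ * h (e none)) ^ 2 := by
    have : M - 1 ≤ χ * h (e (some none)) + M - χ * h (e none) := by linarith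
    nlinarith
  have h5 : M ^ 2 / (4 * d) ≤ lnVar (χ • h + cellInput e M α) := by
    refine le_trans ?_ h1
    rw [div_le_div_iff₀ (by positivity) (by positivity)]
    nlinarith
  have h6 := lnVar_le_meanSq hd (cellInput e M (0 : J → ℝ))
  have h7 : ∑ c, cellInput e M (0 : J → ℝ) c ^ 2 = M ^ 2 := by
    rw [cellInput_zero, Finset.sum_eq_single (e (some none))]
    · simp
    · intro c _ hc; simp [hc]
    · simp
  rw [h7] at h6
  have h0 := lnVar_nonneg (cellInput e M (0 : J → ℝ))
  refine Real.le_sqrt_of_sq_le ?_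
  rw [div_pow, refScale, lnScale, Real.sq_sqrt (by linarith)]
  have h8 : 1 / (d : ℝ) * M ^ 2 = 4 * (M ^ 2 / (4 * d)) := by field_simp
  rw [h8] at h6
  linarith

lemma abs_scaled_sub_le {κ σ σ' o o' : ℝ} (hκ : 0 < κ) (hσ : κ / 2 ≤ σ) (hσ' : κ / 2 ≤ σ') :
    |κ * (o / σ) - κ * (o' / σ')| ≤ 2 * |o - o'| + 4 / κ * |σ - σ'| * |o'| := by
  have h1 : 0 < σ := by linarith
  have h2 : 0 < σ' := by linarith
  have e : κ * (o / σ) - κ * (o' / σ') = κ / σ * (o - o') + κ / (σ * σ') * (σ' - σ) * o' := by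
    field_simp; ring
  have e1 : κ / σ ≤ 2 := by rw [div_le_iff₀ h1]; linarith
  have e2 : κ / (σ * σ') ≤ 4 / κ := by
    rw [div_le_div_iff₀ (by positivity) hκ]
    nlinarith [mul_le_mul hσ hσ' (by linarith) h1.le]
  rw [e]
  refine (abs_add_le _ _).trans (add_le_add ?_ ?_)
  · rw [abs_mul, abs_of_pos (by positivity)]; gcongr
  · rw [abs_mul, abs_mul, abs_of_pos (a := κ / (σ * σ')) (by positivity), abs_sub_comm σ']; gcongr

end Cell

/-! ### The latent dynamics -/

/-- A system of cells: static features `ξ`, propagated features that are updated by `P`, and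
residual connections at the cells with `χ = 1`. -/
structure CellSystem (Ξ K I : Type) [Fintype Ξ] [Fintype K] [Fintype I] (Rξ S₀ Lp : ℝ) where
  χ : I → ℝ
  τ : I → ℝ → ℝ
  ξ : I → Ξ → ℝ
  P : (I → Ξ → ℝ) → (I → K → ℝ) → I → K → ℝ
  abs_χ_le : ∀ i, |χ i| ≤ 1
  τ_zero : ∀ i, τ i 0 = 0
  abs_τ_sub_le : ∀ i x y, |τ i x - τ i y| ≤ |x - y|
  abs_ξ_le : ∀ i x, |ξ i x| ≤ Rξ
  norm_P_zero_le : ‖P 0 0‖ ≤ S₀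
  norm_P_sub_le : ∀ a b a' b', ‖P a b - P a' b'‖ ≤ Lp * ‖a - a'‖ + 1 / 8 * ‖b - b'‖

/-- The constants of the latent dynamics and the inequalities that make it contractive. -/
structure CellConstants {Ξ K : Type} {d : ℕ} (e : Option (Option (Ξ ⊕ K)) ↪ Fin d)
    (η Rξ S₀ Lp : ℝ) where
  M : ℝ
  g : ℝ
  s : ℝ
  κ : ℝ
  R : ℝ
  η_nonneg : 0 ≤ η
  Rξ_nonneg : 0 ≤ Rξ
  S₀_nonneg : 0 ≤ S₀
  Lp_nonneg : 0 ≤ Lp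
  four_le_M : 4 ≤ M
  κ_eq : κ = refScale e η M
  κ_pos : 0 < κ
  g_pos : 0 < g
  -- The factor that undoes the gain and the reference scale when a slot is read.
  s_eq : s = κ / g
  gd_le : g * d ≤ 1 / 4
  M_le : M ≤ 2 * d * κ
  -- `R - 1` bounds every target on the absorbing region; the spare `1` covers the residual term.
  R_eq : R = Rξ + (S₀ + Lp * (2 * (1 + Rξ))) + 4 * (1 + (S₀ + Lp * (2 * (1 + Rξ)))) + 1
  -- The last two inequalities make the variation of the scale and the residual term small
  -- perturbations of the propagation.
  κ_ge : 8 * R * (6 * Lp + 1) ≤ κ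
  s_ge : 4 * (12 + 16 * d) * (24 * Lp + 5) ≤ s

namespace CellSystem

variable {Ξ K I : Type} [Fintype Ξ] [Fintype K] [Fintype I] {Rξ S₀ Lp : ℝ} {d : ℕ}
  {e : Option (Option (Ξ ⊕ K)) ↪ Fin d} {η : ℝ}

/-- Readout of the static features. -/
def readStatic (e : Option (Option (Ξ ⊕ K)) ↪ Fin d) (s : ℝ) (H : I → Fin d → ℝ) : I → Ξ → ℝ :=
  fun i x => s * (H i (e (some (some (Sum.inl x)))) - H i (e none))

/-- Readout of the propagated features. -/
def readProp (e : Option (Option (Ξ ⊕ K)) ↪ Fin d) (s : ℝ) (H : I → Fin d → ℝ) : I → K → ℝ :=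
  fun i k => s * (H i (e (some (some (Sum.inr k)))) - H i (e none))

variable (S : CellSystem Ξ K I Rξ S₀ Lp) (c : CellConstants e η Rξ S₀ Lp)

/-- The feature values written by the update. -/
def target (H : I → Fin d → ℝ) (i : I) : Ξ ⊕ K → ℝ :=
  Sum.elim (fun x => S.τ i (S.ξ i x))
    (fun k => S.τ i (S.P (readStatic e c.s H) (readProp e c.s H) i k))

/-- The feature vector before normalization. -/
def preact (H : I → Fin d → ℝ) (i : I) : Fin d → ℝ :=
  S.χ i • H i + cellInput e c.M (S.target c H i)

/-- One step of the dynamics. -/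
def step (H : I → Fin d → ℝ) (i : I) : Fin d → ℝ :=
  layerNorm η (fun _ => c.g) 0 (S.preact c H i)

section Basic

omit [Fintype Ξ] [Fintype K] in
lemma s_pos : 0 < c.s := by rw [c.s_eq]; exact div_pos c.κ_pos c.g_pos

lemma norm_step_le (H : I → Fin d → ℝ) : ‖S.step c H‖ ≤ c.g * d := by
  have h0 : 0 ≤ c.g * d := mul_nonneg c.g_pos.le (Nat.cast_nonneg _)
  refine (pi_norm_le_iff_of_nonneg h0).2 fun i => (pi_norm_le_iff_of_nonneg h0).2 fun j => ?_
  exact abs_layerNorm_le c.η_nonneg c.g_pos.le _ _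

lemma abs_apply_le (H : I → Fin d → ℝ) (i : I) (j : Fin d) : |H i j| ≤ ‖H‖ :=
  (norm_le_pi_norm (H i) j).trans (norm_le_pi_norm H i)

lemma half_le_scale {H : I → Fin d → ℝ} (hH : ‖H‖ ≤ 1 / 4) (i : I) :
    c.κ / 2 ≤ lnScale η (S.preact c H i) := by
  rw [c.κ_eq]
  exact half_refScale_le e c.η_nonneg c.four_le_M (S.abs_χ_le i)
    ((norm_le_pi_norm H i).trans (hH.trans (by norm_num))) _

/-- A feature before normalization, relative to the reference slot. -/
def diff (H : I → Fin d → ℝ) (i : I) (j : Ξ ⊕ K) : ℝ :=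
  S.χ i * (H i (e (some (some j))) - H i (e none)) + S.target c H i j

/-- Subtracting the reference slot cancels the mean, and `s * g = κ` absorbs the gain. What remains
is the feature times the ratio of the reference scale to the actual one. -/
lemma read_step (H : I → Fin d → ℝ) (i : I) (j : Ξ ⊕ K) :
    c.s * (S.step c H i (e (some (some j))) - S.step c H i (e none)) =
      c.κ * (S.diff c H i j / lnScale η (S.preact c H i)) := by
  have hg := c.g_pos.ne'
  rw [step, layerNorm_apply, layerNorm_apply, c.s_eq]
  have : S.diff c H i j = S.preact c H i (e (some (some j))) - S.preact c H i (e none) := by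
    simp only [diff, preact, Pi.add_apply, Pi.smul_apply, cellInput_apply, slotValue, smul_eq_mul]
    ring
  rw [this]
  field_simp
  ring

lemma abs_χ_mul_le (H : I → Fin d → ℝ) (i : I) (j j' : Fin d) :
    |S.χ i * (H i j - H i j')| ≤ 2 * ‖H‖ := by
  rw [abs_mul]
  calc |S.χ i| * |H i j - H i j'| ≤ 1 * (|H i j| + |H i j'|) := by
        gcongr
        · exact S.abs_χ_le i
        · exact abs_sub _ _
    _ ≤ 2 * ‖H‖ := by
        have := abs_apply_le H i j; have := abs_apply_le H i j'; linarith

lemma abs_τ_le (i : I) (x : ℝ) : |S.τ i x| ≤ |x| := by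
  simpa [S.τ_zero] using S.abs_τ_sub_le i x 0

lemma norm_P_le (a : I → Ξ → ℝ) (b : I → K → ℝ) : ‖S.P a b‖ ≤ S₀ + Lp * ‖a‖ + 1 / 8 * ‖b‖ := by
  have h1 := S.norm_P_sub_le a b 0 0
  have h2 := norm_le_norm_add_norm_sub' (S.P a b) (S.P 0 0)
  have h3 := S.norm_P_zero_le
  simp only [sub_zero] at h1
  linarith

lemma abs_target_inl_le (H : I → Fin d → ℝ) (i : I) (x : Ξ) :
    |S.target c H i (Sum.inl x)| ≤ Rξ :=
  (S.abs_τ_le i _).trans (S.abs_ξ_le i x)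

lemma abs_target_inr_le (H : I → Fin d → ℝ) (i : I) (k : K) : |S.target c H i (Sum.inr k)| ≤
    S₀ + Lp * ‖readStatic e c.s H‖ + 1 / 8 * ‖readProp e c.s H‖ :=
  (S.abs_τ_le i _).trans (((norm_le_pi_norm (S.P _ _ i) k).trans (norm_le_pi_norm _ i)).trans
    (S.norm_P_le _ _))

lemma abs_read_step_le {H : I → Fin d → ℝ} (hH : ‖H‖ ≤ 1 / 4) (i : I) (j : Ξ ⊕ K) {B : ℝ}
    (hB : |S.target c H i j| ≤ B) :
    |c.s * (S.step c H i (e (some (some j))) - S.step c H i (e none))| ≤ 2 * (1 + B) := by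
  rw [read_step]
  have h1 := S.half_le_scale c hH i
  have hκ := c.κ_pos
  have hσ : 0 < lnScale η (S.preact c H i) := by linarith
  have h2 : |S.diff c H i j| ≤ 1 + B := by
    refine (abs_add_le _ _).trans ?_
    have := S.abs_χ_mul_le H i (e (some (some j))) (e none)
    linarith
  rw [abs_mul, abs_div, abs_of_pos hκ, abs_of_pos hσ, ← mul_div_assoc, div_le_iff₀ hσ]
  have h3 : 0 ≤ 1 + B := (abs_nonneg _).trans h2
  calc c.κ * |S.diff c H i j| ≤ (2 * lnScale η (S.preact c H i)) * (1 + B) := by gcongr; linarith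
    _ = _ := by ring

lemma norm_readStatic_step_le {H : I → Fin d → ℝ} (hH : ‖H‖ ≤ 1 / 4) :
    ‖readStatic e c.s (S.step c H)‖ ≤ 2 * (1 + Rξ) := by
  have h0 : 0 ≤ 2 * (1 + Rξ) := by have := c.Rξ_nonneg; linarith
  refine (pi_norm_le_iff_of_nonneg h0).2 fun i => (pi_norm_le_iff_of_nonneg h0).2 fun x => ?_
  exact S.abs_read_step_le c hH i (Sum.inl x) (S.abs_target_inl_le c H i x)

/-- The factor `2` is the worst ratio of scales; together with the damping `1 / 8` it leaves the
slope `1 / 4` in the propagated readout. -/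
lemma norm_readProp_step_le {H : I → Fin d → ℝ} (hH : ‖H‖ ≤ 1 / 4) :
    ‖readProp e c.s (S.step c H)‖ ≤
      2 * (1 + (S₀ + Lp * ‖readStatic e c.s H‖ + 1 / 8 * ‖readProp e c.s H‖)) := by
  have h1 := c.S₀_nonneg
  have h2 := mul_nonneg c.Lp_nonneg (norm_nonneg (readStatic e c.s H))
  have h3 := norm_nonneg (readProp e c.s H)
  have h0 : 0 ≤ 2 * (1 + (S₀ + Lp * ‖readStatic e c.s H‖ + 1 / 8 * ‖readProp e c.s H‖)) := by
    linarith
  refine (pi_norm_le_iff_of_nonneg h0).2 fun i => (pi_norm_le_iff_of_nonneg h0).2 fun k => ?_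
  exact S.abs_read_step_le c hH i (Sum.inr k) (S.abs_target_inr_le c H i k)

end Basic

/-- The absorbing region. -/
def region : Set (I → Fin d → ℝ) := {H | ‖H‖ ≤ c.g * d ∧ ‖readStatic e c.s H‖ ≤ 2 * (1 + Rξ) ∧
  ‖readProp e c.s H‖ ≤ 4 * (1 + (S₀ + Lp * (2 * (1 + Rξ))))}

omit [Fintype Ξ] [Fintype K] [Fintype I] in
lemma continuous_readStatic (s : ℝ) :
    Continuous (readStatic e s : (I → Fin d → ℝ) → I → Ξ → ℝ) := by
  unfold readStatic; fun_prop

omit [Fintype Ξ] [Fintype K] [Fintype I] in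
lemma continuous_readProp (s : ℝ) :
    Continuous (readProp e s : (I → Fin d → ℝ) → I → K → ℝ) := by
  unfold readProp; fun_prop

lemma isClosed_region : IsClosed (region c : Set (I → Fin d → ℝ)) :=
  ((isClosed_le continuous_norm continuous_const).inter
    ((isClosed_le (continuous_readStatic _).norm continuous_const).inter
      (isClosed_le (continuous_readProp _).norm continuous_const)))

omit [Fintype Ξ] [Fintype K] in
lemma one_add_nonneg (c : CellConstants e η Rξ S₀ Lp) : 0 ≤ S₀ + Lp * (2 * (1 + Rξ)) := by
  have := c.Rξ_nonneg
  have := c.S₀_nonneg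
  have := mul_nonneg c.Lp_nonneg (by linarith : 0 ≤ 2 * (1 + Rξ))
  linarith

lemma step_mem_region {H : I → Fin d → ℝ} (hH : H ∈ region c) : S.step c H ∈ region c := by
  obtain ⟨h1, h2, h3⟩ := hH
  have h4 := h1.trans c.gd_le
  refine ⟨S.norm_step_le c H, S.norm_readStatic_step_le c h4, ?_⟩
  refine (S.norm_readProp_step_le c h4).trans ?_
  have := mul_le_mul_of_nonneg_left h2 c.Lp_nonneg
  have := one_add_nonneg c
  linarith

/-- One step makes the state small and a second one bounds the static readout. From then on the
bound of the propagated readout obeys an affine recursion of slope `1 / 4`. -/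
lemma exists_iterate_mem_region (H : I → Fin d → ℝ) : ∃ k, (S.step c)^[k] H ∈ region c := by
  set A := S₀ + Lp * (2 * (1 + Rξ)) with hA
  have hA0 : 0 ≤ A := one_add_nonneg c
  set H₂ := S.step c (S.step c H) with hH₂
  have hsmall : ∀ k, ‖(S.step c)^[k] H₂‖ ≤ c.g * d ∧
      ‖readStatic e c.s ((S.step c)^[k] H₂)‖ ≤ 2 * (1 + Rξ) := by
    intro k
    induction k with
    | zero => exact ⟨S.norm_step_le c _,
        S.norm_readStatic_step_le c ((S.norm_step_le c _).trans c.gd_le)⟩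
    | succ k ih =>
      rw [Function.iterate_succ_apply']
      exact ⟨S.norm_step_le c _, S.norm_readStatic_step_le c (ih.1.trans c.gd_le)⟩
  -- `3 * (1 + A)` exceeds the fixed point `8 / 3 * (1 + A)` of the recursion `x ↦ 2 * (1 + A) + x /
  -- 4`.
  have hprop : ∀ k, ‖readProp e c.s ((S.step c)^[k] H₂)‖ ≤
      3 * (1 + A) + ‖readProp e c.s H₂‖ * (1 / 4) ^ k := by
    intro k
    induction k with
    | zero => simp; linarith
    | succ k ih =>
      rw [Function.iterate_succ_apply', pow_succ]
      refine (S.norm_readProp_step_le c ((hsmall k).1.trans c.gd_le)).trans ?_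
      have := mul_le_mul_of_nonneg_left (hsmall k).2 c.Lp_nonneg
      linarith
  obtain ⟨k, hk⟩ : ∃ k : ℕ, ‖readProp e c.s H₂‖ * (1 / 4) ^ k < 1 := by
    have := (tendsto_pow_atTop_nhds_zero_of_lt_one (r := (1 / 4 : ℝ)) (by norm_num)
      (by norm_num)).const_mul ‖readProp e c.s H₂‖
    rw [mul_zero] at this
    exact (this.eventually (gt_mem_nhds one_pos)).exists
  refine ⟨k + 2, ?_⟩
  rw [Function.iterate_add_apply]
  change (S.step c)^[k] H₂ ∈ region c
  refine ⟨(hsmall k).1, (hsmall k).2, (hprop k).trans ?_⟩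
  linarith

lemma abs_target_le {H : I → Fin d → ℝ} (hH : H ∈ region c) (i : I) (j : Ξ ⊕ K) :
    |S.target c H i j| ≤ c.R - 1 := by
  have h0 := one_add_nonneg c
  have h1 := c.Rξ_nonneg
  rw [c.R_eq]
  rcases j with x | k
  · refine (S.abs_target_inl_le c H i x).trans ?_; linarith
  · refine (S.abs_target_inr_le c H i k).trans ?_
    have := mul_le_mul_of_nonneg_left hH.2.1 c.Lp_nonneg
    have := hH.2.2
    linarith

lemma abs_diff_le {H : I → Fin d → ℝ} (hH : H ∈ region c) (i : I) (j : Ξ ⊕ K) :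
    |S.diff c H i j| ≤ c.R := by
  refine (abs_add_le _ _).trans ?_
  have h1 := S.abs_χ_mul_le H i (e (some (some j))) (e none)
  have h2 := S.abs_target_le c hH i j
  have h3 := hH.1.trans c.gd_le
  linarith

lemma norm_preact_sub_ref_le {H : I → Fin d → ℝ} (hH : H ∈ region c) (i : I) :
    ‖S.preact c H i - cellInput e c.M 0‖ ≤ c.R := by
  rw [preact, add_sub_assoc]
  refine (norm_add_le _ _).trans ?_
  have h0 := one_add_nonneg c
  have h1 := c.Rξ_nonneg
  have hR := c.R_eq
  have h2 := norm_cellInput_sub_le e (M := c.M) (α := S.target c H i) (α' := 0) (B := c.R - 1)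
    (by linarith) (fun j => by simpa using S.abs_target_le c hH i j)
  have h3 : ‖S.χ i • H i‖ ≤ 1 := by
    rw [norm_smul]
    have h4 := (norm_le_pi_norm H i).trans (hH.1.trans c.gd_le)
    have h5 := S.abs_χ_le i
    rw [Real.norm_eq_abs]
    nlinarith [abs_nonneg (S.χ i), norm_nonneg (H i)]
  linarith

lemma norm_preact_le {H : I → Fin d → ℝ} (hH : H ∈ region c) (i : I) :
    ‖S.preact c H i‖ ≤ c.M + c.R := by
  have h1 := S.norm_preact_sub_ref_le c hH i
  have h2 := norm_cellInput_le e (M := c.M) (B := 0) (α := (0 : Ξ ⊕ K → ℝ))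
    (by have := c.four_le_M; linarith) le_rfl (by simp)
  have h3 := norm_le_norm_add_norm_sub' (S.preact c H i) (cellInput e c.M 0)
  linarith

/-- The gauge contracted by the dynamics. -/
def gauge (H H' : I → Fin d → ℝ) : ℝ :=
  6 * Lp * ‖readStatic e c.s H - readStatic e c.s H'‖ +
    ‖readProp e c.s H - readProp e c.s H'‖ + (2 * (12 + 16 * (d : ℝ)))⁻¹ * (c.s * ‖H - H'‖)

/-- Static targets do not depend on the state, so static differences are renewed only through the
residual term and the scale. Propagated differences keep a quarter of themselves and receive `2 *
(Lp * D)`, which the weight `6 * Lp` on the static part absorbs. The new latent difference times `s`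
is of the order of `Γ`, and as `s` is large, the contribution of `Δ` to the readouts is absorbed by
the last term of the gauge. -/
lemma gauge_step_le {H H' : I → Fin d → ℝ} (hH : H ∈ region c) (hH' : H' ∈ region c) :
    gauge c (S.step c H) (S.step c H') ≤ 1 / 2 * gauge c H H' := by
  set D := ‖readStatic e c.s H - readStatic e c.s H'‖ with hD
  set E := ‖readProp e c.s H - readProp e c.s H'‖ with hE
  set Δ := ‖H - H'‖ with hΔ
  -- `Γ` bounds the change of a vector before normalization, and hence that of its mean and its
  -- scale.
  set Γ := Δ + (Lp * D + 1 / 8 * E) with hΓ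
  have hκ := c.κ_pos
  have hLp := c.Lp_nonneg
  have hD0 : 0 ≤ D := norm_nonneg _
  have hE0 : 0 ≤ E := norm_nonneg _
  have hΔ0 : 0 ≤ Δ := norm_nonneg _
  have hR0 : 0 ≤ c.R := by
    have := one_add_nonneg c; have := c.Rξ_nonneg; rw [c.R_eq]; linarith
  have hLD : 0 ≤ Lp * D := by positivity
  have hΓ0 : 0 ≤ Γ := by positivity
  have hd : (1 : ℝ) ≤ d := by exact_mod_cast (e none).pos
  have hχ : ∀ i j j', |S.χ i * (H i j - H i j') - S.χ i * (H' i j - H' i j')| ≤ 2 * Δ := by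
    intro i j j'
    have := S.abs_χ_mul_le (H - H') i j j'
    rw [← mul_sub]
    convert this using 3
    simp only [Pi.sub_apply]; ring
  have ht : ∀ i j, |S.target c H i j - S.target c H' i j| ≤ Lp * D + 1 / 8 * E := by
    intro i j
    rcases j with x | k
    · simp only [target, Sum.elim_inl, sub_self, abs_zero]; positivity
    · refine (S.abs_τ_sub_le i _ _).trans ?_
      refine le_trans ?_ (S.norm_P_sub_le _ _ _ _)
      exact (norm_le_pi_norm ((S.P _ _ - S.P _ _) i) k).trans (norm_le_pi_norm _ i)
  have hz : ∀ i, ‖S.preact c H i - S.preact c H' i‖ ≤ Γ := by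
    intro i
    have : S.preact c H i - S.preact c H' i = S.χ i • (H i - H' i) +
        (cellInput e c.M (S.target c H i) - cellInput e c.M (S.target c H' i)) := by
      simp only [preact, smul_sub]; abel
    rw [this]
    refine (norm_add_le _ _).trans (add_le_add ?_
      (norm_cellInput_sub_le e (by positivity) (ht i)))
    rw [norm_smul, Real.norm_eq_abs]
    calc |S.χ i| * ‖H i - H' i‖ ≤ 1 * ‖(H - H') i‖ := by
          gcongr
          · exact S.abs_χ_le i
          · rfl
      _ ≤ Δ := by rw [one_mul]; exact norm_le_pi_norm _ i
  have hσ : ∀ i, |lnScale η (S.preact c H i) - lnScale η (S.preact c H' i)| ≤ Γ := fun i =>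
    (lnScale_sub_le c.η_nonneg (e none).pos _ _).trans (hz i)
  have hs1 := fun i => S.half_le_scale c (hH.1.trans c.gd_le) i
  have hs2 := fun i => S.half_le_scale c (hH'.1.trans c.gd_le) i
  have hread : ∀ i j B, |S.diff c H i j - S.diff c H' i j| ≤ B →
      |c.s * (S.step c H i (e (some (some j))) - S.step c H i (e none)) -
        c.s * (S.step c H' i (e (some (some j))) - S.step c H' i (e none))| ≤
        2 * B + 4 / c.κ * Γ * c.R := by
    intro i j B hB
    rw [read_step, read_step]
    refine (abs_scaled_sub_le hκ (hs1 i) (hs2 i)).trans ?_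
    have := S.abs_diff_le c hH' i j
    have := hσ i
    gcongr
  -- The relative effect of the varying scale, small because `κ` is large against `R`.
  set ρ := 4 / c.κ * c.R with hρ
  have hρΓ : 4 / c.κ * Γ * c.R = ρ * Γ := by rw [hρ]; ring
  rw [hρΓ] at hread
  have hρ0 : 0 ≤ ρ := by positivity
  have n1 : ‖readStatic e c.s (S.step c H) - readStatic e c.s (S.step c H')‖ ≤ 4 * Δ + ρ * Γ := by
    have h0 : 0 ≤ 4 * Δ + ρ * Γ := by positivity
    refine (pi_norm_le_iff_of_nonneg h0).2 fun i => (pi_norm_le_iff_of_nonneg h0).2 fun x => ?_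
    refine (hread i (Sum.inl x) (2 * Δ) ?_).trans (by linarith)
    have : S.diff c H i (Sum.inl x) - S.diff c H' i (Sum.inl x) =
        S.χ i * (H i (e (some (some (Sum.inl x)))) - H i (e none)) -
        S.χ i * (H' i (e (some (some (Sum.inl x)))) - H' i (e none)) := by
      simp only [diff, target, Sum.elim_inl]; ring
    rw [this]; exact hχ _ _ _
  have n2 : ‖readProp e c.s (S.step c H) - readProp e c.s (S.step c H')‖ ≤
      4 * Δ + 2 * (Lp * D) + 1 / 4 * E + ρ * Γ := by
    have h0 : 0 ≤ 4 * Δ + 2 * (Lp * D) + 1 / 4 * E + ρ * Γ := by positivity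
    refine (pi_norm_le_iff_of_nonneg h0).2 fun i => (pi_norm_le_iff_of_nonneg h0).2 fun k => ?_
    refine (hread i (Sum.inr k) (2 * Δ + (Lp * D + 1 / 8 * E)) ?_).trans (by linarith)
    have : S.diff c H i (Sum.inr k) - S.diff c H' i (Sum.inr k) =
        (S.χ i * (H i (e (some (some (Sum.inr k)))) - H i (e none)) -
        S.χ i * (H' i (e (some (some (Sum.inr k)))) - H' i (e none))) +
        (S.target c H i (Sum.inr k) - S.target c H' i (Sum.inr k)) := by
      simp only [diff]; ring
    rw [this]
    exact (abs_add_le _ _).trans (add_le_add (hχ _ _ _) (ht _ _))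
  have n3 : c.s * ‖S.step c H - S.step c H'‖ ≤ (12 + 16 * d) * Γ := by
    have hq : 0 ≤ (12 + 16 * (d : ℝ)) * Γ := by positivity
    have hs := s_pos c
    rw [mul_comm, ← le_div_iff₀ hs]
    have h0 : 0 ≤ (12 + 16 * (d : ℝ)) * Γ / c.s := div_nonneg hq hs.le
    refine (pi_norm_le_iff_of_nonneg h0).2 fun i => (pi_norm_le_iff_of_nonneg h0).2 fun j => ?_
    rw [le_div_iff₀ hs, mul_comm, Real.norm_eq_abs]
    have hg := c.g_pos
    have e1 : ∀ H, c.s * S.step c H i j =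
        c.κ * ((S.preact c H i j - lnMean (S.preact c H i)) / lnScale η (S.preact c H i)) := by
      intro H
      rw [step, layerNorm_apply, c.s_eq]; field_simp
    have e2 : c.s * |(S.step c H - S.step c H') i j| =
        |c.s * S.step c H i j - c.s * S.step c H' i j| := by
      rw [← mul_sub, abs_mul, abs_of_pos hs]; rfl
    rw [e2, e1, e1]
    refine (abs_scaled_sub_le hκ (hs1 i) (hs2 i)).trans ?_
    have hm := abs_lnMean_le (S.preact c H i - S.preact c H' i)
    rw [lnMean_sub] at hm
    have hc : |S.preact c H i j - S.preact c H' i j| ≤ Γ :=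
      (norm_le_pi_norm (S.preact c H i - S.preact c H' i) j).trans (hz i)
    have b1 : |S.preact c H i j - lnMean (S.preact c H i) -
        (S.preact c H' i j - lnMean (S.preact c H' i))| ≤ 2 * Γ := by
      rw [sub_sub_sub_comm]
      exact (abs_sub _ _).trans (by linarith [hz i])
    have b2 : |S.preact c H' i j - lnMean (S.preact c H' i)| ≤ 2 * (c.M + c.R) := by
      refine (abs_sub _ _).trans ?_
      have h1 := abs_lnMean_le (S.preact c H' i)
      have h2 := norm_le_pi_norm (S.preact c H' i) j
      have h3 := S.norm_preact_le c hH' i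
      rw [Real.norm_eq_abs] at h2
      linarith
    have b3 : 4 / c.κ * Γ * (2 * (c.M + c.R)) ≤ (8 + 16 * d) * Γ := by
      have hMR : c.M + c.R ≤ (1 + 2 * d) * c.κ := by
        have h1 := c.M_le
        have h2 := c.κ_ge
        nlinarith [mul_nonneg hR0 hLp]
      have : 4 / c.κ * Γ * (2 * (c.M + c.R)) = 8 * Γ * (c.M + c.R) / c.κ := by field_simp; ring
      rw [this, div_le_iff₀ hκ]
      calc 8 * Γ * (c.M + c.R) ≤ 8 * Γ * ((1 + 2 * d) * c.κ) := by gcongr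
        _ = _ := by ring
    have hMR0 : 0 ≤ 2 * (c.M + c.R) := by have := c.four_le_M; linarith
    calc _ ≤ 2 * (2 * Γ) + 4 / c.κ * Γ * (2 * (c.M + c.R)) := by
          have := hσ i
          gcongr
      _ ≤ _ := by linarith
  have hρ1 : (6 * Lp + 1) * ρ ≤ 1 / 2 := by
    have h2 := c.κ_ge
    rw [hρ, div_mul_eq_mul_div, ← mul_div_assoc, div_le_iff₀ hκ]
    linarith
  have hq0 : (0 : ℝ) < 12 + 16 * d := by positivity
  have n3' : (2 * (12 + 16 * (d : ℝ)))⁻¹ * (c.s * ‖S.step c H - S.step c H'‖) ≤ 1 / 2 * Γ := by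
    calc _ ≤ (2 * (12 + 16 * (d : ℝ)))⁻¹ * ((12 + 16 * d) * Γ) := by gcongr
      _ = 1 / 2 * Γ := by field_simp
  have hsΔ : 2 * (24 * Lp + 5) * Δ ≤ (2 * (12 + 16 * (d : ℝ)))⁻¹ * (c.s * Δ) := by
    rw [← mul_assoc]
    refine mul_le_mul_of_nonneg_right ?_ hΔ0
    rw [inv_mul_eq_div, le_div_iff₀ (by positivity)]
    have := c.s_ge
    linarith
  have n1' := mul_le_mul_of_nonneg_left n1 (by positivity : 0 ≤ 6 * Lp)
  have hρΓ1 : (6 * Lp + 1) * ρ * Γ ≤ 1 / 2 * Γ := mul_le_mul_of_nonneg_right hρ1 hΓ0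
  rw [gauge, gauge, ← hD, ← hE, ← hΔ]
  have hexp : 6 * Lp * (4 * Δ + ρ * Γ) = 24 * (Lp * Δ) + 6 * Lp * ρ * Γ := by ring
  have hexp2 : (6 * Lp + 1) * ρ * Γ = 6 * Lp * ρ * Γ + ρ * Γ := by ring
  have hexp3 : 2 * (24 * Lp + 5) * Δ = 48 * (Lp * Δ) + 10 * Δ := by ring
  have hexp4 : 1 / 2 * (6 * Lp * D + E + (2 * (12 + 16 * (d : ℝ)))⁻¹ * (c.s * Δ)) =
    3 * (Lp * D) + 1 / 2 * E + 1 / 2 * ((2 * (12 + 16 * (d : ℝ)))⁻¹ * (c.s * Δ)) := by ring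
  rw [hexp4]
  rw [hexp] at n1'
  rw [hexp2] at hρΓ1
  rw [hexp3] at hsΔ
  linarith

end CellSystem

/-! ### The attracting fixed point and the accuracy of its readouts. -/

namespace CellSystem

variable {Ξ K I : Type} [Fintype Ξ] [Fintype K] [Fintype I] {Rξ S₀ Lp : ℝ} {d : ℕ}
  {e : Option (Option (Ξ ⊕ K)) ↪ Fin d} {η : ℝ}
  (S : CellSystem Ξ K I Rξ S₀ Lp) (c : CellConstants e η Rξ S₀ Lp)

lemma abs_sub_sub_sub_le (H H' : I → Fin d → ℝ) {s : ℝ} (hs : 0 ≤ s) (i : I) (j j' : Fin d) :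
    |s * (H i j - H i j') - s * (H' i j - H' i j')| ≤ 2 * s * ‖H - H'‖ := by
  have h1 := abs_apply_le (H - H') i j
  have h2 := abs_apply_le (H - H') i j'
  have : s * (H i j - H i j') - s * (H' i j - H' i j') =
      s * ((H - H') i j - (H - H') i j') := by simp only [Pi.sub_apply]; ring
  rw [this, abs_mul, abs_of_nonneg hs]
  calc s * |(H - H') i j - (H - H') i j'| ≤ s * (‖H - H'‖ + ‖H - H'‖) := by
        gcongr; exact (abs_sub _ _).trans (add_le_add h1 h2)
    _ = _ := by ring

omit [Fintype K] in
lemma norm_readStatic_sub_le (H H' : I → Fin d → ℝ) :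
    ‖readStatic e c.s H - readStatic e c.s H'‖ ≤ 2 * c.s * ‖H - H'‖ := by
  have hs := (s_pos c).le
  have h0 : 0 ≤ 2 * c.s * ‖H - H'‖ := by positivity
  exact (pi_norm_le_iff_of_nonneg h0).2 fun i => (pi_norm_le_iff_of_nonneg h0).2 fun x =>
    abs_sub_sub_sub_le H H' hs i _ _

omit [Fintype Ξ] in
lemma norm_readProp_sub_le (H H' : I → Fin d → ℝ) :
    ‖readProp e c.s H - readProp e c.s H'‖ ≤ 2 * c.s * ‖H - H'‖ := by
  have hs := (s_pos c).le
  have h0 : 0 ≤ 2 * c.s * ‖H - H'‖ := by positivity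
  exact (pi_norm_le_iff_of_nonneg h0).2 fun i => (pi_norm_le_iff_of_nonneg h0).2 fun x =>
    abs_sub_sub_sub_le H H' hs i _ _

theorem exists_fixedPoint : ∃ H₀ ∈ region c, (∀ H, S.step c H = H ↔ H = H₀) ∧
    ∀ H, Filter.Tendsto (fun k => (S.step c)^[k] H) Filter.atTop (nhds H₀) := by
  have hs := s_pos c
  have hLp := c.Lp_nonneg
  refine exists_attracting_fixedPoint (S.step c) (gauge c)
    (c := (2 * (12 + 16 * (d : ℝ)))⁻¹ * c.s)
    (C := 6 * Lp * (2 * c.s) + 2 * c.s + (2 * (12 + 16 * (d : ℝ)))⁻¹ * c.s) (by positivity)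
    (fun H H' => ?_) (fun H H' => ?_) (isClosed_region c) (fun H hH => S.step_mem_region c hH)
    (S.exists_iterate_mem_region c) (fun H hH H' hH' => S.gauge_step_le c hH hH')
  · rw [gauge, dist_eq_norm, mul_assoc]
    exact le_add_of_nonneg_left (by positivity)
  · have h1 := mul_le_mul_of_nonneg_left (norm_readStatic_sub_le c H H')
      (by positivity : 0 ≤ 6 * Lp)
    have h2 := norm_readProp_sub_le c H H'
    rw [gauge, dist_eq_norm]
    linarith

lemma abs_P_read_le {H : I → Fin d → ℝ} (hH : H ∈ region c) (i : I) (k : K) :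
    |S.P (readStatic e c.s H) (readProp e c.s H) i k| ≤ c.R := by
  have h0 := one_add_nonneg c
  have h1 := c.Rξ_nonneg
  have h2 := (norm_le_pi_norm (S.P (readStatic e c.s H) (readProp e c.s H) i) k).trans
    ((norm_le_pi_norm _ i).trans (S.norm_P_le _ _))
  have h3 := mul_le_mul_of_nonneg_left hH.2.1 c.Lp_nonneg
  have h4 := hH.2.2
  rw [Real.norm_eq_abs] at h2
  rw [c.R_eq]
  linarith

/-- There are two errors: the actual scale differs from `κ` by at most `R`, and the residual term is
at most `2 * (g * d)` because the state is small. -/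
lemma abs_read_sub_target_le {H : I → Fin d → ℝ} (hH : H ∈ region c) (i : I) (j : Ξ ⊕ K) :
    |c.s * (S.step c H i (e (some (some j))) - S.step c H i (e none)) - S.target c H i j| ≤
      2 * c.R ^ 2 / c.κ + 2 * (c.g * d) := by
  have hκ := c.κ_pos
  have hσ := S.half_le_scale c (hH.1.trans c.gd_le) i
  have hσ0 : 0 < lnScale η (S.preact c H i) := by linarith
  have hR : 0 ≤ c.R := (abs_nonneg _).trans (S.abs_diff_le c hH i j)
  have h1 : |c.κ - lnScale η (S.preact c H i)| ≤ c.R := by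
    rw [c.κ_eq, abs_sub_comm]
    exact (lnScale_sub_le c.η_nonneg (e none).pos _ _).trans (S.norm_preact_sub_ref_le c hH i)
  rw [read_step]
  have h2 : c.κ * (S.diff c H i j / lnScale η (S.preact c H i)) - S.target c H i j =
      (c.κ - lnScale η (S.preact c H i)) * S.diff c H i j / lnScale η (S.preact c H i) +
        S.χ i * (H i (e (some (some j))) - H i (e none)) := by
    have : S.target c H i j =
      S.diff c H i j - S.χ i * (H i (e (some (some j))) - H i (e none)) := by rw [diff]; ring
    rw [this]; field_simp; ring
  rw [h2]
  refine (abs_add_le _ _).trans (add_le_add ?_ ?_)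
  · rw [abs_div, abs_mul, abs_of_pos hσ0, div_le_div_iff₀ hσ0 hκ]
    have h3 := mul_le_mul h1 (S.abs_diff_le c hH i j) (abs_nonneg _) hR
    nlinarith [mul_nonneg hR hR]
  · refine (S.abs_χ_mul_le H i _ _).trans ?_
    have := hH.1
    linarith

/-- At a fixed point the features that are read out are close to the ideal ones. -/
theorem read_fixedPoint_le {H : I → Fin d → ℝ} (hH : H ∈ region c) (hfix : S.step c H = H)
    {t t' : ℝ} (ht : 0 ≤ t)
    (hτ : ∀ i x, |x| ≤ c.R → |S.τ i x - x| ≤ t)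
    (hacc : 2 * c.R ^ 2 / c.κ + 2 * (c.g * d) ≤ t') {b₀ : I → K → ℝ} (hb₀ : S.P S.ξ b₀ = b₀) :
    ‖readStatic e c.s H - S.ξ‖ ≤ t + t' ∧
      ‖readProp e c.s H - b₀‖ ≤ 2 * (1 + Lp) * (t + t') := by
  have hR : 0 ≤ c.R := by
    have := one_add_nonneg c; have := c.Rξ_nonneg; rw [c.R_eq]; linarith
  have hκ := c.κ_pos
  have hg := c.g_pos
  have hLp := c.Lp_nonneg
  have ht' : 0 ≤ t' := le_trans (by positivity) hacc
  have key : ∀ i j v, |v| ≤ c.R → S.target c H i j = S.τ i v →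
      |c.s * (H i (e (some (some j))) - H i (e none)) - v| ≤ t + t' := by
    intro i j v hv hjv
    have h1 := S.abs_read_sub_target_le c hH i j
    rw [hfix, hjv] at h1
    have h2 := abs_add_le (c.s * (H i (e (some (some j))) - H i (e none)) - S.τ i v) (S.τ i v - v)
    rw [sub_add_sub_cancel] at h2
    have := hτ i v hv
    linarith
  have h0 : 0 ≤ t + t' := by positivity
  have hs : ‖readStatic e c.s H - S.ξ‖ ≤ t + t' := by
    refine (pi_norm_le_iff_of_nonneg h0).2 fun i => (pi_norm_le_iff_of_nonneg h0).2 fun x => ?_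
    refine key i (Sum.inl x) (S.ξ i x) ((S.abs_ξ_le i x).trans ?_) rfl
    have := one_add_nonneg c; have := c.Rξ_nonneg; rw [c.R_eq]; linarith
  refine ⟨hs, ?_⟩
  have hp : ‖readProp e c.s H - S.P (readStatic e c.s H) (readProp e c.s H)‖ ≤ t + t' := by
    refine (pi_norm_le_iff_of_nonneg h0).2 fun i => (pi_norm_le_iff_of_nonneg h0).2 fun k => ?_
    exact key i (Sum.inr k) _ (S.abs_P_read_le c hH i k) rfl
  have h1 := S.norm_P_sub_le (readStatic e c.s H) (readProp e c.s H) S.ξ b₀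
  rw [hb₀] at h1
  -- The error `x` of the propagated readout satisfies `x ≤ (1 + Lp) * (t + t') + x / 8`.
  have h2 := norm_add_le (readProp e c.s H - S.P (readStatic e c.s H) (readProp e c.s H))
    (S.P (readStatic e c.s H) (readProp e c.s H) - b₀)
  rw [sub_add_sub_cancel] at h2
  have h3 := mul_le_mul_of_nonneg_left hs hLp
  have h4 := mul_nonneg hLp h0
  linarith

end CellSystem

/-- The order of choice matters: `R` depends on the given bounds only, then `M` is taken large
against `R`, which fixes `κ`, and at last `g` is taken small against the rest. -/
theorem CellConstants.exists_accurate {Ξ K : Type} {d : ℕ}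
    (e : Option (Option (Ξ ⊕ K)) ↪ Fin d) {η Rξ S₀ Lp : ℝ} (hη : 0 ≤ η) (hξ : 0 ≤ Rξ)
    (hS : 0 ≤ S₀) (hL : 0 ≤ Lp) {t g₀ : ℝ} (ht : 0 < t) (hg₀ : 0 < g₀) :
    ∃ c : CellConstants e η Rξ S₀ Lp, c.g ≤ g₀ ∧ 2 * c.R ^ 2 / c.κ + 2 * (c.g * d) ≤ t := by
  have hd : (1 : ℝ) ≤ d := by exact_mod_cast (e none).pos
  have hd0 : (0 : ℝ) < d := by linarith
  obtain ⟨R, hR⟩ : ∃ R : ℝ,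
    R = Rξ + (S₀ + Lp * (2 * (1 + Rξ))) + 4 * (1 + (S₀ + Lp * (2 * (1 + Rξ)))) + 1 := ⟨_, rfl⟩
  have hR0 : 0 ≤ R := by rw [hR]; positivity
  -- The summand `4 * R ^ 2 / t` brings the scale error `2 * R ^ 2 / κ` below `t / 2`; the other
  -- half is left to `g`.
  set M := 4 + 2 * d * (8 * R * (6 * Lp + 1) + 4 * R ^ 2 / t + 1) with hM
  have hM4 : 4 ≤ M := by rw [hM]; exact le_add_of_nonneg_right (by positivity)
  have hMκ := le_refScale e hη (M := M)
  set κ := refScale e η M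
  have hκ : 8 * R * (6 * Lp + 1) + 4 * R ^ 2 / t + 1 ≤ κ := by
    have : 2 * d * (8 * R * (6 * Lp + 1) + 4 * R ^ 2 / t + 1) ≤ 2 * d * κ := by linarith
    exact le_of_mul_le_mul_left this (by positivity)
  have hR1 : 0 ≤ 8 * R * (6 * Lp + 1) := by positivity
  have hR2 : 0 ≤ 4 * R ^ 2 / t := by positivity
  have hκ0 : 0 < κ := by linarith
  set Q : ℝ := 4 * (12 + 16 * d) * (24 * Lp + 5)
  have hQ : 0 < Q := by positivity
  set g : ℝ := min (1 / (4 * d)) (min (κ / Q) (min g₀ (t / (4 * d))))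
  have hg : 0 < g := by positivity
  have g1 : g ≤ 1 / (4 * d) := min_le_left _ _
  have g2 : g ≤ κ / Q := (min_le_right _ _).trans (min_le_left _ _)
  have g3 : g ≤ g₀ := (min_le_right _ _).trans ((min_le_right _ _).trans (min_le_left _ _))
  have g4 : g ≤ t / (4 * d) :=
    (min_le_right _ _).trans ((min_le_right _ _).trans (min_le_right _ _))
  rw [le_div_iff₀ (by positivity)] at g1 g4
  rw [le_div_iff₀ hQ] at g2
  refine ⟨⟨M, g, κ / g, κ, R, hη, hξ, hS, hL, hM4, rfl, hκ0, hg, rfl, by linarith, hMκ, hR,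
    by linarith, ?_⟩, g3, ?_⟩
  · rw [le_div_iff₀ hg]; linarith
  · have : 2 * R ^ 2 / κ ≤ t / 2 := by
      rw [div_le_div_iff₀ hκ0 two_pos]
      have : 4 * R ^ 2 / t ≤ κ := by linarith
      rw [div_le_iff₀ ht] at this
      linarith
    change 2 * R ^ 2 / κ + 2 * (g * d) ≤ t
    linarith

/-! ### Perceptrons with one hidden layer -/

namespace MLP

variable {w : ℕ} {S ι κ : Type} [Fintype S] [Fintype ι]

/-- Hidden neurons outside the embedded `S` get zero outgoing weights, so every larger width works,
whatever `σ 0` is. -/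
lemma exists_eval_eq (hw : Fintype.card S ≤ w) (ℓ : (ι → ℝ) →ₗ[ℝ] (S → ℝ)) (b : S → ℝ)
    (T : (S → ℝ) →ₗ[ℝ] (κ → ℝ)) (c : κ → ℝ) :
    ∃ net : MLP 1 w ι κ, ∀ σ x, net.eval σ x = T (fun s => σ (ℓ x s + b s)) + c := by
  classical
  obtain ⟨f⟩ : Nonempty (S ↪ Fin w) :=
    Function.Embedding.nonempty_of_card_le (by simpa using hw)
  refine ⟨((Matrix.of (Function.extend f (fun s i => ℓ (fun j => if i = j then 1 else 0) s) 0),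
    Function.extend f b 0), (Matrix.of fun k =>
      Function.extend f (fun s => T (fun j => if s = j then 1 else 0) k) 0, c)), fun σ x => ?_⟩
  funext k
  simp only [MLP.eval, Pi.add_apply, Matrix.mulVec, dotProduct, Matrix.of_apply]
  congr 1
  rw [LinearMap.pi_apply_eq_sum_univ T, Finset.sum_apply]
  symm
  refine Fintype.sum_of_injective f f.injective _ _ (fun q hq => ?_) fun s => ?_
  · rw [Function.extend_apply' _ _ _ (by simpa using hq)]; simp
  · simp only [f.injective.extend_apply, Pi.smul_apply, smul_eq_mul]
    rw [LinearMap.pi_apply_eq_sum_univ ℓ x, Finset.sum_apply, mul_comm]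
    congr 3
    refine Finset.sum_congr rfl fun i _ => ?_
    rw [Pi.smul_apply, smul_eq_mul, mul_comm]

lemma exists_eval_affine [Fintype κ] (hw : 2 * Fintype.card κ ≤ w) (T : (ι → ℝ) →ₗ[ℝ] (κ → ℝ))
    (c : κ → ℝ) : ∃ net : MLP 1 w ι κ, ∀ x, net.eval relu x = T x + c := by
  -- Two rectified units per output, by `x = relu x - relu (-x)`.
  obtain ⟨net, h⟩ := exists_eval_eq (S := κ ⊕ κ) (w := w) (by simpa [two_mul] using hw)
    (LinearMap.pi (Sum.elim (fun k => LinearMap.proj k ∘ₗ T) (fun k => -(LinearMap.proj k ∘ₗ T))))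
    0 (LinearMap.funLeft ℝ ℝ Sum.inl - LinearMap.funLeft ℝ ℝ Sum.inr) c
  refine ⟨net, fun x => ?_⟩
  rw [h]
  congr 1
  funext k
  simp only [LinearMap.sub_apply, Pi.sub_apply, LinearMap.funLeft_apply, LinearMap.pi_apply,
    Sum.elim_inl, Sum.elim_inr, LinearMap.neg_apply, LinearMap.comp_apply, LinearMap.proj_apply,
    Pi.zero_apply, add_zero]
  rcases le_total 0 (T x k) with h | h
  · rw [relu_of_nonneg h, relu_of_nonpos (by linarith), sub_zero]
  · rw [relu_of_nonpos h, relu_of_nonneg (by linarith), zero_sub, neg_neg]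

lemma exists_eval_const (c : κ → ℝ) : ∃ net : MLP 1 w ι κ, ∀ σ x, net.eval σ x = c := by
  obtain ⟨net, h⟩ := exists_eval_eq (S := Empty) (w := w) (ι := ι) (by simp) 0 0 0 c
  exact ⟨net, fun σ x => by simp [h]⟩

end MLP

/-! ### Writing into the slots and reading from them, as linear maps. -/

section Slots

variable {d : ℕ} {J : Type} (e : Option (Option J) ↪ Fin d)

/-- Writing a family of features into the slots. -/
def slotMap : (J → ℝ) →ₗ[ℝ] (Fin d → ℝ) where
  toFun := cellInput e 0
  map_add' α β := by
    funext c
    by_cases hc : ∃ o, e o = c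
    · obtain ⟨o, rfl⟩ := hc
      simp only [Pi.add_apply, cellInput_apply]
      rcases o with _ | _ | j <;> simp [slotValue]
    · simp [cellInput_eq_zero e _ _ hc]
  map_smul' a α := by
    funext c
    by_cases hc : ∃ o, e o = c
    · obtain ⟨o, rfl⟩ := hc
      simp only [Pi.smul_apply, cellInput_apply]
      rcases o with _ | _ | j <;> simp [slotValue]
    · simp [cellInput_eq_zero e _ _ hc]

lemma cellInput_eq (M : ℝ) (α : J → ℝ) :
    cellInput e M α = slotMap e α + cellInput e M 0 := by
  funext c
  change cellInput e M α c = cellInput e 0 α c + cellInput e M 0 c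
  by_cases hc : ∃ o, e o = c
  · obtain ⟨o, rfl⟩ := hc
    simp only [cellInput_apply]
    rcases o with _ | _ | j <;> simp [slotValue]
  · simp [cellInput_eq_zero e _ _ hc]

lemma slotMap_slot (α : J → ℝ) (j : J) : slotMap e α (e (some (some j))) = α j :=
  cellInput_apply e 0 α _

/-- Reading the features relative to the reference slot. -/
def readMap (s : ℝ) : (Fin d → ℝ) →ₗ[ℝ] (J → ℝ) :=
  s • (LinearMap.funLeft ℝ ℝ (fun j => e (some (some j))) -
    LinearMap.pi fun _ => LinearMap.proj (e none))

lemma readMap_apply (s : ℝ) (h : Fin d → ℝ) (j : J) :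
    readMap e s h j = s * (h (e (some (some j))) - h (e none)) := rfl

/-- Dirichlet nodes are encoded in this form, so their frozen vectors are read without error. -/
lemma readMap_slotMap {s : ℝ} (hs : s ≠ 0) (α : J → ℝ) :
    readMap e s (slotMap e (s⁻¹ • α)) = α := by
  funext j
  rw [readMap_apply, slotMap_slot]
  have : slotMap e (s⁻¹ • α) (e none) = 0 := cellInput_apply e 0 _ none
  rw [this, sub_zero, Pi.smul_apply, smul_eq_mul, mul_inv_cancel_left₀ hs]

end Slots

/-! ### The weights -/

/-- The static data of a Dirichlet node with value `u` and position `p`. -/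
def dirichletData (u : ℝ) (p : Fin 2 → ℝ) : NodeIdx → ℝ :=
  Sum.elim p (Sum.elim ![0, u, 0] (Sum.elim ![0, 1, 0] 0))

/-- A finite family of rectified affine functions of edge data. -/
abbrev EdgeUnits : Type := Finset ((NodeIdx ⊕ NodeIdx → ℝ) × ℝ)

/-- The specification of the parameters: the values of the perceptrons on which the dynamics
depends. -/
structure PsiGNN.Spec {w d : ℕ} (θ : PsiGNN 1 w d) {F : EdgeUnits}
    (e : Option (Option (NodeIdx ⊕ F)) ↪ Fin d) (l δ M s g : ℝ) {n : ℕ} (V : Fin n → ℝ)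
    (W : Fin n → NodeIdx ⊕ F → ℝ) (b : Fin n → ℝ) : Prop where
  enc : ∀ u p, θ.enc.eval relu (Sum.elim (fun _ => u) p) =
    slotMap e (s⁻¹ • Sum.elim (dirichletData u p) 0)
  dec : ∀ h, θ.dec.eval relu h () = ∑ q, V q * relu (W q ⬝ᵥ readMap e s h + b q)
  msgInI : ∀ h h' r, θ.msgInI.eval relu (Sum.elim h (Sum.elim h' r)) =
    slotMap e (Sum.elim 0 fun k : F => l * readMap e s h' (Sum.inr k) +
      relu (k.1.1 ⬝ᵥ Sum.elim (readMap e s h ∘ Sum.inl) (readMap e s h' ∘ Sum.inl) + k.1.2))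
  msgInN : ∀ h h' r, θ.msgInN.eval relu (Sum.elim h (Sum.elim h' r)) =
    slotMap e (Sum.elim 0 fun k : F => l * readMap e s h' (Sum.inr k) +
      relu (k.1.1 ⬝ᵥ Sum.elim (readMap e s h ∘ Sum.inl) (readMap e s h' ∘ Sum.inl) + k.1.2))
  msgLoop : ∀ h t, θ.msgLoop.eval relu (Sum.elim h t) =
    slotMap e (Sum.elim (Sum.elim 0 (Sum.elim 0 (Sum.elim t 0))) 0)
  upd1 : ∀ x, θ.upd1.eval Real.sigmoid x = 1
  upd2 : ∀ x, θ.upd2.eval Real.sigmoid x = 1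
  upd3 : ∀ h B p m m' m'', θ.upd3.eval Real.tanh
    (Sum.elim h (Sum.elim B (Sum.elim p (Sum.elim m (Sum.elim m' m''))))) =
    cellInput e M (fun j => scaledTanh δ (Sum.elim (Sum.elim p (Sum.elim B (Sum.elim
      (fun r => m'' (e (some (some (Sum.inl (Sum.inr (Sum.inr (Sum.inl r)))))))) 0)))
      (fun k => m' (e (some (some (Sum.inr k))))) j))
  upd4 : ∀ h B p ν m' m'', θ.upd4.eval relu
    (Sum.elim h (Sum.elim B (Sum.elim p (Sum.elim ν (Sum.elim m' m''))))) =
    cellInput e M (Sum.elim (Sum.elim p (Sum.elim B (Sum.elim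
      (fun r => m'' (e (some (some (Sum.inl (Sum.inr (Sum.inr (Sum.inl r)))))))) ν)))
      (fun k => m' (e (some (some (Sum.inr k))))))
  gain : θ.gain = fun _ => g
  bias : θ.bias = 0

/-- The static data of an edge, read from the input of a message. -/
def edgeReadMap {d : ℕ} {Ξ K : Type} (e : Option (Option (Ξ ⊕ K)) ↪ Fin d) (s : ℝ) :
    (MsgIn d → ℝ) →ₗ[ℝ] (Ξ ⊕ Ξ → ℝ) :=
  LinearMap.pi (Sum.elim
    (fun x => LinearMap.proj (Sum.inl x) ∘ₗ readMap e s ∘ₗ LinearMap.funLeft ℝ ℝ Sum.inl)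
    (fun x => LinearMap.proj (Sum.inl x) ∘ₗ readMap e s ∘ₗ
      LinearMap.funLeft ℝ ℝ (Sum.inr ∘ Sum.inl)))

lemma edgeReadMap_apply {d : ℕ} {Ξ K : Type} (e : Option (Option (Ξ ⊕ K)) ↪ Fin d) (s : ℝ)
    (h h' : Fin d → ℝ) (r : Unit → ℝ) : edgeReadMap e s (Sum.elim h (Sum.elim h' r)) =
      Sum.elim (readMap e s h ∘ Sum.inl) (readMap e s h' ∘ Sum.inl) := by
  funext x
  rcases x with x | x <;> rfl

lemma PsiGNN.exists_spec {w d : ℕ} {F : EdgeUnits} (e : Option (Option (NodeIdx ⊕ F)) ↪ Fin d)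
    (l δ M s g : ℝ) {n : ℕ} (V : Fin n → ℝ) (W : Fin n → NodeIdx ⊕ F → ℝ) (b : Fin n → ℝ)
    (hw : n + 2 * d + 3 * Fintype.card F + Fintype.card (NodeIdx ⊕ F) ≤ w) :
    ∃ θ : PsiGNN 1 w d, θ.Spec e l δ M s g V W b := by
  have hd : 2 * Fintype.card (Fin d) ≤ w := by rw [Fintype.card_fin]; omega
  obtain ⟨enc, henc⟩ := MLP.exists_eval_affine (ι := Unit ⊕ Fin 2) hd
    (slotMap e ∘ₗ (s⁻¹ • LinearMap.pi (Sum.elim (Sum.elim (fun r => LinearMap.proj (Sum.inr r))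
      (Sum.elim ![0, LinearMap.proj (Sum.inl ()), 0] 0)) 0)))
    (slotMap e (s⁻¹ • Sum.elim (dirichletData 0 0) 0))
  obtain ⟨dec, hdec⟩ := MLP.exists_eval_eq (S := Fin n) (ι := Fin d) (κ := Unit) (w := w)
    (by rw [Fintype.card_fin]; omega) (Matrix.mulVecLin (Matrix.of W) ∘ₗ readMap e s) b
    (Matrix.mulVecLin (Matrix.of fun _ => V)) 0
  -- For each feature, one unit computes the rectified edge term and a pair of units the signed
  -- linear term.
  obtain ⟨msg, hmsg⟩ := MLP.exists_eval_eq (S := F ⊕ F ⊕ F) (ι := MsgIn d) (κ := Fin d) (w := w)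
    (by simp only [Fintype.card_sum]; omega)
    (LinearMap.pi (Sum.elim
      (fun k : F => LinearMap.proj () ∘ₗ Matrix.mulVecLin (Matrix.of fun _ : Unit => k.1.1) ∘ₗ
        edgeReadMap e s)
      (Sum.elim (fun k => l • LinearMap.proj (Sum.inr k) ∘ₗ readMap e s ∘ₗ
            LinearMap.funLeft ℝ ℝ (Sum.inr ∘ Sum.inl))
        (fun k => -(l • LinearMap.proj (Sum.inr k) ∘ₗ readMap e s ∘ₗ
            LinearMap.funLeft ℝ ℝ (Sum.inr ∘ Sum.inl))))))
    (Sum.elim (fun k => k.1.2) 0)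
    (slotMap e ∘ₗ (LinearMap.pi (Sum.elim 0 (fun k : F =>
      LinearMap.proj (R := ℝ) (φ := fun _ : F ⊕ F ⊕ F => ℝ) (Sum.inl k) +
        (LinearMap.proj (R := ℝ) (φ := fun _ : F ⊕ F ⊕ F => ℝ) (Sum.inr (Sum.inl k)) -
          LinearMap.proj (R := ℝ) (φ := fun _ : F ⊕ F ⊕ F => ℝ) (Sum.inr (Sum.inr k))))) :
        (F ⊕ F ⊕ F → ℝ) →ₗ[ℝ] (NodeIdx ⊕ F → ℝ))) 0
  have hmsg' : ∀ h h' r, msg.eval relu (Sum.elim h (Sum.elim h' r)) =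
      slotMap e (Sum.elim 0 fun k : F => l * readMap e s h' (Sum.inr k) +
      relu (k.1.1 ⬝ᵥ Sum.elim (readMap e s h ∘ Sum.inl) (readMap e s h' ∘ Sum.inl) + k.1.2)) := by
    intro h h' r
    rw [hmsg, add_zero, LinearMap.comp_apply]
    congr 1
    funext j
    rcases j with x | k
    · rfl
    · have hr : ∀ x, relu x - relu (-x) = x := fun x => by
        rcases le_total 0 x with h | h
        · rw [relu_of_nonneg h, relu_of_nonpos (by linarith), sub_zero]
        · rw [relu_of_nonpos h, relu_of_nonneg (by linarith), zero_sub, neg_neg]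
      change relu (k.1.1 ⬝ᵥ edgeReadMap e s (Sum.elim h (Sum.elim h' r)) + k.1.2) +
        (relu (l * readMap e s h' (Sum.inr k) + 0) -
        relu (-(l * readMap e s h' (Sum.inr k)) + 0)) = _
      rw [add_zero, add_zero, hr, add_comm, edgeReadMap_apply]
      rfl
  obtain ⟨loop, hloop⟩ := MLP.exists_eval_affine (ι := Fin d ⊕ Fin 3) hd
    (slotMap e ∘ₗ (LinearMap.pi (Sum.elim (Sum.elim 0 (Sum.elim 0
      (Sum.elim (fun r => LinearMap.proj (Sum.inr r)) 0))) 0))) 0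
  -- Outgoing messages are never read, and both gates are constantly one, so the interior update is
  -- `H + ζ`.
  obtain ⟨zero, -⟩ := MLP.exists_eval_const (w := w) (ι := MsgIn d) (0 : Fin d → ℝ)
  obtain ⟨one, hone⟩ := MLP.exists_eval_const (w := w) (ι := InteriorIn d) (1 : Fin d → ℝ)
  -- The inner factor `δ` and the outer factor `δ⁻¹` keep the tanh layer close to linear. The slots
  -- of the normal get zero at interior nodes.
  obtain ⟨upd3, h3⟩ := MLP.exists_eval_eq (S := NodeIdx ⊕ F) (ι := InteriorIn d) (κ := Fin d)
    (w := w) (by omega)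
    (δ • LinearMap.pi (Sum.elim (Sum.elim (fun r => LinearMap.proj (Sum.inr (Sum.inr (Sum.inl r))))
      (Sum.elim (fun r => LinearMap.proj (Sum.inr (Sum.inl r)))
      (Sum.elim (fun r => LinearMap.proj (Sum.inr (Sum.inr (Sum.inr (Sum.inr (Sum.inr
        (e (some (some (Sum.inl (Sum.inr (Sum.inr (Sum.inl r))))))))))))) 0)))
      (fun k => LinearMap.proj (Sum.inr (Sum.inr (Sum.inr (Sum.inr (Sum.inl
        (e (some (some (Sum.inr k))))))))))))
    0 (slotMap e ∘ₗ (δ⁻¹ • LinearMap.id)) (cellInput e M 0)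
  obtain ⟨upd4, h4⟩ := MLP.exists_eval_affine (ι := NeumannIn d) hd
    (slotMap e ∘ₗ LinearMap.pi (Sum.elim
      (Sum.elim (fun r => LinearMap.proj (Sum.inr (Sum.inr (Sum.inl r))))
      (Sum.elim (fun r => LinearMap.proj (Sum.inr (Sum.inl r)))
      (Sum.elim (fun r => LinearMap.proj (Sum.inr (Sum.inr (Sum.inr (Sum.inr (Sum.inr
        (e (some (some (Sum.inl (Sum.inr (Sum.inr (Sum.inl r)))))))))))))
        (fun r => LinearMap.proj (Sum.inr (Sum.inr (Sum.inr (Sum.inl r))))))))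
      (fun k => LinearMap.proj (Sum.inr (Sum.inr (Sum.inr (Sum.inr (Sum.inl
        (e (some (some (Sum.inr k)))))))))))) (cellInput e M 0)
  refine ⟨⟨enc, dec, zero, msg, msg, loop, one, one, upd3, upd4, fun _ => g, 0⟩,
    fun u p => ?_, fun h => ?_, hmsg', hmsg', fun h t => ?_, fun x => hone _ x, fun x => hone _ x,
    fun h B p m m' m'' => ?_, fun h B p ν m' m'' => ?_, rfl, rfl⟩
  · rw [henc, LinearMap.comp_apply, ← map_add]
    congr 1
    rw [LinearMap.smul_apply, ← smul_add]
    congr 1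
    funext j
    rcases j with (r | r | r | r) | k
    · simp [dirichletData]
    · fin_cases r <;> simp [dirichletData]
    · simp [dirichletData]
    · simp [dirichletData]
    · simp
  · rw [hdec]
    simp only [Pi.add_apply, Pi.zero_apply, add_zero]
    rfl
  · rw [hloop, add_zero, LinearMap.comp_apply]
    congr 1
    funext j
    rcases j with (r | r | r | r) | k <;> rfl
  · rw [h3, LinearMap.comp_apply]
    refine Eq.trans ?_ (cellInput_eq e M _).symm
    congr 2
    funext j
    simp only [LinearMap.smul_apply, LinearMap.id_apply, Pi.smul_apply, smul_eq_mul, Pi.zero_apply,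
      add_zero, scaledTanh]
    rw [inv_mul_eq_div]
    rcases j with (r | r | r | r) | k <;> rfl
  · rw [h4, LinearMap.comp_apply]
    refine Eq.trans ?_ (cellInput_eq e M _).symm
    congr 2
    funext j
    rcases j with (r | r | r | r) | k <;> rfl

/-! ### The dynamics of a problem -/

namespace EdgeUnits

variable (F : EdgeUnits)

/-- Bound for the weights of a family of rectified affine functions. -/
def weightNorm : ℝ := ∑ k : F, ∑ x, |k.1.1 x|

/-- Bound for the biases of a family of rectified affine functions. -/
def biasNorm : ℝ := ∑ k : F, |k.1.2|

lemma weightNorm_nonneg : 0 ≤ F.weightNorm := by unfold weightNorm; positivity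

lemma biasNorm_nonneg : 0 ≤ F.biasNorm := by unfold biasNorm; positivity

lemma abs_bias_le (k : F) : |k.1.2| ≤ F.biasNorm :=
  Finset.single_le_sum (f := fun k : F => |k.1.2|) (fun _ _ => abs_nonneg _) (Finset.mem_univ k)

end EdgeUnits

lemma abs_dotProduct_le {ι : Type*} [Fintype ι] (w v : ι → ℝ) {B : ℝ} (h : ∀ x, |v x| ≤ B) :
    |w ⬝ᵥ v| ≤ (∑ x, |w x|) * B := by
  rw [dotProduct, Finset.sum_mul]
  refine (Finset.abs_sum_le_sum_abs _ _).trans (Finset.sum_le_sum fun x _ => ?_)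
  rw [abs_mul]
  exact mul_le_mul_of_nonneg_left (h x) (abs_nonneg _)

lemma EdgeUnits.abs_weight_dotProduct_le (F : EdgeUnits) (k : F) (v : NodeIdx ⊕ NodeIdx → ℝ)
    {B : ℝ} (hB : 0 ≤ B) (h : ∀ x, |v x| ≤ B) : |k.1.1 ⬝ᵥ v| ≤ F.weightNorm * B := by
  refine (abs_dotProduct_le _ v h).trans (mul_le_mul_of_nonneg_right ?_ hB)
  exact Finset.single_le_sum (f := fun k : F => ∑ x, |k.1.1 x|)
    (fun _ _ => Finset.sum_nonneg fun _ _ => abs_nonneg _) (Finset.mem_univ k)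

lemma abs_relu_sub_le (x y : ℝ) : |relu x - relu y| ≤ |x - y| := by
  simpa [relu] using abs_max_sub_max_le_max x 0 y 0

namespace PoissonProblem

variable (G : PoissonProblem)

open Classical in
/-- Extension of static features from the free nodes to all nodes, by the data of the nodes. -/
def extStatic (a : G.Free → NodeIdx → ℝ) (j : Fin G.numNodes) : NodeIdx → ℝ :=
  if h : G.kind j ≠ NodeKind.dirichlet then a ⟨j, h⟩ else G.nodeData j

open Classical in
/-- Extension of propagated features from the free nodes to all nodes, by zero. -/
def extProp {K : Type} (b : G.Free → K → ℝ) (j : Fin G.numNodes) : K → ℝ :=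
  if h : G.kind j ≠ NodeKind.dirichlet then b ⟨j, h⟩ else 0

/-- One step of the propagation of the features. -/
def propagate (l : ℝ) (F : EdgeUnits) (a : G.Free → NodeIdx → ℝ) (b : G.Free → F → ℝ)
    (i : G.Free) (k : F) : ℝ :=
  ∑ j ∈ G.nbrFinset i, (l * G.extProp b j k +
    relu (k.1.1 ⬝ᵥ Sum.elim (a i) (G.extStatic a j) + k.1.2))

variable {G}

lemma abs_extStatic_sub_le (a a' : G.Free → NodeIdx → ℝ) (j : Fin G.numNodes) (x : NodeIdx) :
    |G.extStatic a j x - G.extStatic a' j x| ≤ ‖a - a'‖ := by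
  unfold extStatic
  split_ifs with h
  · exact (norm_le_pi_norm ((a - a') ⟨j, h⟩) x).trans (norm_le_pi_norm (a - a') _)
  · simp

lemma abs_extProp_sub_le {K : Type} [Fintype K] (b b' : G.Free → K → ℝ) (j : Fin G.numNodes)
    (x : K) : |G.extProp b j x - G.extProp b' j x| ≤ ‖b - b'‖ := by
  unfold extProp
  split_ifs with h
  · exact (norm_le_pi_norm ((b - b') ⟨j, h⟩) x).trans (norm_le_pi_norm (b - b') _)
  · simp

lemma abs_sum_nbrFinset_le {n : ℕ} (hn : G.numNodes ≤ n) (i : Fin G.numNodes)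
    (f : Fin G.numNodes → ℝ) {B : ℝ} (hB : 0 ≤ B) (h : ∀ j, |f j| ≤ B) :
    |∑ j ∈ G.nbrFinset i, f j| ≤ n * B := by
  refine (Finset.abs_sum_le_sum_abs _ _).trans ((Finset.sum_le_sum fun j _ => h j).trans ?_)
  rw [Finset.sum_const, nsmul_eq_mul]
  refine mul_le_mul_of_nonneg_right ?_ hB
  have := (Finset.card_le_univ (G.nbrFinset i)).trans_eq (Fintype.card_fin _)
  exact_mod_cast this.trans hn

/-- There are at most `n` neighbours, each damped by `l`, and `relu` is 1-Lipschitz; the bound `l *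
n ≤ 1 / 8` is the source of the contraction. -/
lemma norm_propagate_sub_le {n : ℕ} (hn : G.numNodes ≤ n) {l : ℝ} (hl : 0 ≤ l)
    (hln : l * n ≤ 1 / 8) (F : EdgeUnits) (a : G.Free → NodeIdx → ℝ) (b : G.Free → F → ℝ)
    (a' : G.Free → NodeIdx → ℝ) (b' : G.Free → F → ℝ) :
    ‖G.propagate l F a b - G.propagate l F a' b'‖ ≤
      n * F.weightNorm * ‖a - a'‖ + 1 / 8 * ‖b - b'‖ := by
  have hw := F.weightNorm_nonneg
  have h0 : 0 ≤ n * F.weightNorm * ‖a - a'‖ + 1 / 8 * ‖b - b'‖ := by positivity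
  refine (pi_norm_le_iff_of_nonneg h0).2 fun i => (pi_norm_le_iff_of_nonneg h0).2 fun k => ?_
  rw [Pi.sub_apply, Pi.sub_apply, propagate, propagate, ← Finset.sum_sub_distrib, Real.norm_eq_abs]
  refine (abs_sum_nbrFinset_le hn i.1 _ (B := l * ‖b - b'‖ + F.weightNorm * ‖a - a'‖)
    (by positivity) fun j => ?_).trans ?_
  · rw [add_sub_add_comm, ← mul_sub]
    refine (abs_add_le _ _).trans (add_le_add ?_ ?_)
    · rw [abs_mul, abs_of_nonneg hl]
      exact mul_le_mul_of_nonneg_left (abs_extProp_sub_le b b' j k) hl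
    · refine (abs_relu_sub_le _ _).trans ?_
      rw [add_sub_add_right_eq_sub, ← dotProduct_sub]
      refine F.abs_weight_dotProduct_le k _ (norm_nonneg _) fun x => ?_
      rcases x with x | x
      · exact (norm_le_pi_norm ((a - a') i) x).trans (norm_le_pi_norm (a - a') _)
      · exact abs_extStatic_sub_le a a' j x
  · have := mul_le_mul_of_nonneg_right hln (norm_nonneg (b - b'))
    linarith

lemma norm_propagate_zero_le {n : ℕ} (hn : G.numNodes ≤ n) (l : ℝ) (F : EdgeUnits) {R : ℝ}
    (hR0 : 0 ≤ R) (hR : ∀ i x, |G.nodeData i x| ≤ R) :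
    ‖G.propagate l F 0 0‖ ≤ n * (F.weightNorm * R + F.biasNorm) := by
  have hw := F.weightNorm_nonneg
  have hb := F.biasNorm_nonneg
  have h0 : 0 ≤ n * (F.weightNorm * R + F.biasNorm) := by positivity
  refine (pi_norm_le_iff_of_nonneg h0).2 fun i => (pi_norm_le_iff_of_nonneg h0).2 fun k => ?_
  refine abs_sum_nbrFinset_le hn i.1 _ (by positivity) fun j => ?_
  have h1 : G.extProp (0 : G.Free → F → ℝ) j k = 0 := by unfold extProp; split_ifs <;> rfl
  rw [h1, mul_zero, zero_add]
  have h2 : ∀ x, |relu x| ≤ |x| := fun x => by simpa [relu] using abs_relu_sub_le x 0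
  refine (h2 _).trans ((abs_add_le _ _).trans (add_le_add ?_ (F.abs_bias_le k)))
  refine F.abs_weight_dotProduct_le k _ hR0 fun x => ?_
  rcases x with x | x
  · simpa using hR0
  · simp only [Sum.elim_inr, extStatic]
    split_ifs
    · simpa using hR0
    · exact hR j x

/-- With exact static data at all nodes the propagation is the one-hop equation of the features. -/
lemma propagate_feature {l : ℝ} (hl : 0 < l) (hN : l * G.numNodes < 1) (F : EdgeUnits) :
    G.propagate l F (fun i => G.nodeData i)
      (fun (i : G.Free) (k : F) => G.feature l k.1.1 k.1.2 i) =
      fun (i : G.Free) (k : F) => G.feature l k.1.1 k.1.2 i := by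
  funext i k
  rw [feature_eq hl hN, propagate]
  refine Finset.sum_congr rfl fun j _ => ?_
  have h1 : G.extProp (fun (i : G.Free) (k : F) => G.feature l k.1.1 k.1.2 i) j k =
      G.feature l k.1.1 k.1.2 j := by
    unfold extProp
    split_ifs with h
    · rfl
    · rw [feature, dif_neg h]; rfl
  have h2 : G.extStatic (fun i => G.nodeData i) j = G.nodeData j := by
    unfold extStatic; split_ifs <;> rfl
  rw [h1, h2, edgeData]

open Classical in
/-- The cells of a problem. -/
def cellSystem (G : PoissonProblem) {n : ℕ} (hn : G.numNodes ≤ n) {l : ℝ} (hl : 0 ≤ l)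
    (hln : l * n ≤ 1 / 8) (F : EdgeUnits) {R : ℝ} (hR0 : 0 ≤ R)
    (hR : ∀ i x, |G.nodeData i x| ≤ R) {δ : ℝ} (hδ : 0 < δ) :
    CellSystem NodeIdx F G.Free R (n * (F.weightNorm * R + F.biasNorm)) (n * F.weightNorm) where
  χ i := if G.kind i = NodeKind.interior then 1 else 0
  τ i x := if G.kind i = NodeKind.interior then scaledTanh δ x else x
  ξ i := G.nodeData i
  P := G.propagate l F
  abs_χ_le i := by split_ifs <;> simp
  τ_zero i := by split_ifs <;> simp [scaledTanh]
  abs_τ_sub_le i x y := by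
    split_ifs
    · exact abs_scaledTanh_sub_le hδ x y
    · rfl
  abs_ξ_le i := hR i
  norm_P_zero_le := norm_propagate_zero_le hn l F hR0 hR
  norm_P_sub_le a b a' b' := norm_propagate_sub_le hn hl hln F a b a' b'

end PoissonProblem

namespace PsiGNN

open PoissonProblem CellSystem

variable {w d : ℕ} {θ : PsiGNN 1 w d} {F : EdgeUnits} {e : Option (Option (NodeIdx ⊕ F)) ↪ Fin d}
  {l δ M s g : ℝ} {m : ℕ} {V : Fin m → ℝ} {W : Fin m → NodeIdx ⊕ F → ℝ} {b : Fin m → ℝ}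
  {G : PoissonProblem} {U₀ : Fin G.numNodes → ℝ}

/-- The latent vectors of the free nodes. -/
def latent (H : LatentState G d) : G.Free → Fin d → ℝ := fun i c => H (i, c)

lemma dirichletData_eq {j : Fin G.numNodes} (hj : G.kind j = NodeKind.dirichlet) :
    dirichletData (G.B j) (G.pos j) = G.nodeData j := by
  funext x
  rcases x with x | x | x | x
  · rfl
  · fin_cases x <;> simp [dirichletData, nodeData, bVec, oneHot, hj]
  · fin_cases x <;> simp [dirichletData, nodeData, oneHot, hj]
  · simp [dirichletData, nodeData, hj]

/-- At a Dirichlet node the encoder writes the static data divided by `s`, with the prescribed value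
`U₀ j` as `b`. Its propagated slots hold zero, in agreement with the extension by zero. -/
lemma Spec.read_combine (hθ : θ.Spec e l δ M s g V W b) (hs : s ≠ 0) (hU : G.MeetsDirichlet U₀)
    (H : LatentState G d) (j : Fin G.numNodes) : readMap e s (θ.combine G U₀ H j) =
      Sum.elim (G.extStatic (readStatic e s (latent H)) j)
        (G.extProp (readProp e s (latent H)) j) := by
  by_cases hj : G.kind j = NodeKind.dirichlet
  · rw [combine, dif_pos hj, encode, hθ.enc, readMap_slotMap e hs, hU j hj, dirichletData_eq hj,
      extStatic, dif_neg (not_not.2 hj), extProp, dif_neg (not_not.2 hj)]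
  · rw [combine, dif_neg hj, extStatic, dif_pos hj, extProp, dif_pos hj]
    funext x
    rcases x with x | x <;> rfl

lemma Spec.aggregate_slot (hθ : θ.Spec e l δ M s g V W b) (hs : s ≠ 0)
    (hU : G.MeetsDirichlet U₀) (H : LatentState G d) (i : G.Free) {Φ : MLP 1 w (MsgIn d) (Fin d)}
    (hΦ : ∀ h h' r, Φ.eval relu (Sum.elim h (Sum.elim h' r)) =
      slotMap e (Sum.elim 0 fun k : F => l * readMap e s h' (Sum.inr k) +
        relu (k.1.1 ⬝ᵥ Sum.elim (readMap e s h ∘ Sum.inl) (readMap e s h' ∘ Sum.inl) + k.1.2)))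
    (k : F) : aggregate G Φ (θ.combine G U₀ H) i (e (some (some (Sum.inr k)))) =
      G.propagate l F (readStatic e s (latent H)) (readProp e s (latent H)) i k := by
  rw [aggregate, Finset.sum_apply, propagate]
  refine Finset.sum_congr rfl fun j _ => ?_
  rw [hΦ, slotMap_slot, Sum.elim_inr, hθ.read_combine hs hU, hθ.read_combine hs hU,
    Sum.elim_inr, Sum.elim_comp_inl, Sum.elim_comp_inl]
  rw [extStatic, dif_pos i.2]

lemma Spec.loopMsg_slot (hθ : θ.Spec e l δ M s g V W b) (K : Fin G.numNodes → Fin d → ℝ)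
    (i : Fin G.numNodes) (r : Fin 3) :
    θ.loopMsg G K i (e (some (some (Sum.inl (Sum.inr (Sum.inr (Sum.inl r))))))) = G.oneHot i r := by
  rw [loopMsg, hθ.msgLoop, slotMap_slot]; rfl

/-- The processor of the network is one step of the dynamics of the cells. -/
theorem Spec.latent_process {η R : ℝ}
    {n : ℕ} (hn : G.numNodes ≤ n) (hl : 0 ≤ l) (hln : l * n ≤ 1 / 8) (hR0 : 0 ≤ R)
    (hR : ∀ i x, |G.nodeData i x| ≤ R) (hδ : 0 < δ)
    (c : CellConstants e η R (n * (F.weightNorm * R + F.biasNorm)) (n * F.weightNorm))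
    (hθ : θ.Spec e l δ c.M c.s c.g V W b) (hU : G.MeetsDirichlet U₀) (H : LatentState G d) :
    latent (θ.process G η U₀ H) =
      (G.cellSystem hn hl hln F hR0 hR hδ).step c (latent H) := by
  have hs := (s_pos c).ne'
  funext i q
  change layerNorm η θ.gain θ.bias _ q = layerNorm η _ 0 _ q
  rw [hθ.gain, hθ.bias]
  congr 1
  have hK : θ.combine G U₀ H i = latent H i := by rw [combine, dif_neg i.2]; rfl
  rw [preact]
  -- An interior cell keeps the residual `H` and passes its target through tanh; the Neumann
  -- perceptron writes its target directly, hence `χ = 0` there.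
  by_cases hi : G.kind i = NodeKind.interior
  · rw [if_pos hi, interiorUpdate]
    simp only [hθ.upd1, hθ.upd2, one_mul, hθ.upd3, hK]
    congr 1
    · simp [cellSystem, hi]
    · congr 1
      funext j
      simp only [target, cellSystem, hi, if_true]
      rcases j with (r | r | r | r) | k
      · rfl
      · rfl
      · simp only [Sum.elim_inl, Sum.elim_inr, hθ.loopMsg_slot]; rfl
      · simp [nodeData, hi]
      · simp only [Sum.elim_inr]
        rw [hθ.aggregate_slot hs hU H i hθ.msgInI k]
  · have hi' : G.kind i = NodeKind.neumann := by
      have := i.2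
      rcases h : G.kind i with _ | _ | _ <;> simp_all
    rw [if_neg hi, neumannUpdate, hθ.upd4]
    have hχ : (G.cellSystem hn hl hln F hR0 hR hδ).χ i = 0 := by simp [cellSystem, hi]
    rw [hχ, zero_smul, zero_add]
    congr 1
    funext j
    simp only [target, cellSystem, hi, if_false]
    rcases j with (r | r | r | r) | k
    · rfl
    · rfl
    · simp only [Sum.elim_inl, Sum.elim_inr, hθ.loopMsg_slot]; rfl
    · simp [nodeData, hi']
    · simp only [Sum.elim_inr]
      rw [hθ.aggregate_slot hs hU H i hθ.msgInN k]

end PsiGNN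

/-! ### The universal approximation theorem -/

lemma EuclideanSpace.norm_le_of_abs_le {ι : Type*} [Fintype ι] (v : EuclideanSpace ℝ ι) {m : ℕ}
    (hm : Fintype.card ι ≤ m) {B : ℝ} (hB : 0 ≤ B) (h : ∀ i, |v i| ≤ B) : ‖v‖ ≤ (m + 1) * B := by
  rw [EuclideanSpace.norm_eq]
  refine Real.sqrt_le_iff.2 ⟨by positivity, ?_⟩
  have hm' : (Fintype.card ι : ℝ) ≤ m := by exact_mod_cast hm
  calc ∑ i, ‖v i‖ ^ 2 ≤ ∑ _i : ι, B ^ 2 := Finset.sum_le_sum fun i _ =>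
        pow_le_pow_left₀ (norm_nonneg _) (h i) 2
    _ = Fintype.card ι * B ^ 2 := by simp
    _ ≤ ((m : ℝ) + 1) ^ 2 * B ^ 2 := by
        refine mul_le_mul_of_nonneg_right ?_ (sq_nonneg B)
        nlinarith [(Nat.cast_nonneg m : (0 : ℝ) ≤ m)]
    _ = _ := by ring

section ReluNet

variable {m : ℕ} {J : Type*} [Fintype J] (V : Fin m → ℝ) (W : Fin m → J → ℝ) (b : Fin m → ℝ)

/-- A perceptron with one hidden layer of rectified linear units. -/
def reluNet (x : J → ℝ) : ℝ := ∑ q, V q * relu (W q ⬝ᵥ x + b q)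

/-- A Lipschitz constant of `reluNet V W b`. -/
def reluNetLip : ℝ := ∑ q, |V q| * ∑ x, |W q x|

lemma reluNetLip_nonneg : 0 ≤ reluNetLip V W := by unfold reluNetLip; positivity

lemma abs_reluNet_sub_le (x y : J → ℝ) {B : ℝ} (h : ∀ j, |x j - y j| ≤ B) :
    |reluNet V W b x - reluNet V W b y| ≤ reluNetLip V W * B := by
  rw [reluNet, reluNet, ← Finset.sum_sub_distrib, reluNetLip, Finset.sum_mul]
  refine (Finset.abs_sum_le_sum_abs _ _).trans (Finset.sum_le_sum fun q _ => ?_)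
  rw [← mul_sub, abs_mul, mul_assoc]
  refine mul_le_mul_of_nonneg_left ?_ (abs_nonneg _)
  refine (abs_relu_sub_le _ _).trans ?_
  rw [add_sub_add_right_eq_sub, ← dotProduct_sub]
  exact abs_dotProduct_le _ _ h

end ReluNet

namespace PsiGNN

open PoissonProblem CellSystem

variable {w d : ℕ} {θ : PsiGNN 1 w d} {F : EdgeUnits} {e : Option (Option (NodeIdx ⊕ F)) ↪ Fin d}
  {l δ M s g : ℝ} {m : ℕ} {V : Fin m → ℝ} {W : Fin m → NodeIdx ⊕ F → ℝ} {b : Fin m → ℝ}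
  {G : PoissonProblem} {U₀ : Fin G.numNodes → ℝ}

lemma Spec.decode_apply (hθ : θ.Spec e l δ M s g V W b) (hs : s ≠ 0) (hU : G.MeetsDirichlet U₀)
    (H : LatentState G d) (i : Fin G.numNodes) : θ.decode G U₀ H i =
      reluNet V W b (Sum.elim (G.extStatic (readStatic e s (latent H)) i)
        (G.extProp (readProp e s (latent H)) i)) := by
  change θ.dec.eval relu (θ.combine G U₀ H i) () = _
  rw [hθ.dec, hθ.read_combine hs hU, reluNet]

lemma Spec.abs_decode_sub_le (hθ : θ.Spec e l δ M s g V W b) (hs : s ≠ 0)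
    (hU : G.MeetsDirichlet U₀) (H : LatentState G d) (i : Fin G.numNodes)
    (a : G.Free → NodeIdx → ℝ) (p : G.Free → F → ℝ) {B : ℝ}
    (ha : ‖readStatic e s (latent H) - a‖ ≤ B) (hp : ‖readProp e s (latent H) - p‖ ≤ B) :
    |θ.decode G U₀ H i - reluNet V W b (Sum.elim (G.extStatic a i) (G.extProp p i))| ≤
      reluNetLip V W * B := by
  rw [hθ.decode_apply hs hU]
  refine abs_reluNet_sub_le V W b _ _ fun j => ?_
  rcases j with x | k
  · exact (abs_extStatic_sub_le _ _ _ _).trans ha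
  · exact (abs_extProp_sub_le _ _ _ _).trans hp

/-- For a single problem, the processor maps into a small ball, attracts every state to a unique
fixed point, and the decoded fixed point approximates the solution. -/
theorem Spec.exists_fixedPoint {η R t t' ε' : ℝ} {n : ℕ} (hn : G.numNodes ≤ n) (hl : 0 < l)
    (hln : l * n ≤ 1 / 8) (hR0 : 0 ≤ R) (hR : ∀ i x, |G.nodeData i x| ≤ R) (hδ : 0 < δ)
    (c : CellConstants e η R (n * (F.weightNorm * R + F.biasNorm)) (n * F.weightNorm))
    (hθ : θ.Spec e l δ c.M c.s c.g V W b) (hU : G.MeetsDirichlet U₀) (ht : 0 ≤ t)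
    (hτ : ∀ x, |x| ≤ c.R → |scaledTanh δ x - x| ≤ t)
    (hacc : 2 * c.R ^ 2 / c.κ + 2 * (c.g * d) ≤ t')
    (hdec : ∀ i, |reluNet V W b (Sum.elim (G.nodeData i)
        (fun k : F => G.feature l k.1.1 k.1.2 i)) - G.solution i| ≤ ε') :
    ∃ H₀ : LatentState G d, (∀ H, θ.process G η U₀ H = H ↔ H = H₀) ∧
      (∀ i, |θ.decode G U₀ H₀ i - G.solution i| ≤
        reluNetLip V W * ((3 + 2 * (n * F.weightNorm)) * (t + t')) + ε') ∧
      ∀ H, ∀ r > 0, ∃ k₀, ∀ k ≥ k₀, ∀ i,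
        |θ.decode G U₀ ((θ.process G η U₀)^[k] H) i - θ.decode G U₀ H₀ i| ≤ r := by
  have hs := s_pos c
  have hN : l * G.numNodes < 1 := by
    have : l * G.numNodes ≤ l * n := by gcongr
    linarith
  set S := G.cellSystem hn hl.le hln F hR0 hR hδ with hS
  have hstep : ∀ H, latent (θ.process G η U₀ H) = S.step c (latent H) := fun H =>
    hθ.latent_process hn hl.le hln hR0 hR hδ c hU H
  have hinj : ∀ H H' : LatentState G d, latent H = latent H' → H = H' := fun H H' h => by
    ext p; exact congrFun (congrFun h p.1) p.2
  obtain ⟨X, hX, hfix, hlim⟩ := S.exists_fixedPoint c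
  let H₀ : LatentState G d := WithLp.toLp 2 fun p => X p.1 p.2
  have hH₀ : latent H₀ = X := rfl
  refine ⟨H₀, fun H => ?_, fun i => ?_, fun H r hr => ?_⟩
  · constructor
    · intro h
      refine hinj _ _ ((hfix _).1 ?_)
      rw [← hstep, h]
    · intro h
      refine hinj _ _ ?_
      rw [hstep, h, hH₀, (hfix X).2 rfl]
  · have hκ := c.κ_pos
    have hg := c.g_pos
    have ht' : 0 ≤ t' := le_trans (by positivity) hacc
    have hLp := c.Lp_nonneg
    obtain ⟨h1, h2⟩ := S.read_fixedPoint_le c hX ((hfix X).2 rfl) ht (fun i x hx => by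
      simp only [hS, cellSystem]
      split_ifs
      · exact hτ x hx
      · simpa using ht) hacc (b₀ := fun i k => G.feature l k.1.1 k.1.2 i)
      (propagate_feature hl hN F)
    have h0 : 0 ≤ t + t' := by positivity
    have h3 := mul_nonneg hLp h0
    have h4 := hθ.abs_decode_sub_le hs.ne' hU H₀ i S.ξ (fun i k => G.feature l k.1.1 k.1.2 i)
      (B := (3 + 2 * (n * F.weightNorm)) * (t + t')) (by rw [hH₀]; linarith)
      (by rw [hH₀]; linarith)
    have e1 : G.extStatic S.ξ i = G.nodeData i := by
      unfold extStatic; split_ifs <;> rfl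
    have e2 : G.extProp (fun (i : G.Free) (k : F) => G.feature l k.1.1 k.1.2 i) i =
        fun k : F => G.feature l k.1.1 k.1.2 i := by
      unfold extProp
      split_ifs with h
      · rfl
      · funext k; rw [feature, dif_neg h]; rfl
    rw [e1, e2] at h4
    exact (abs_sub_le _ _ _).trans (add_le_add h4 (hdec i))
  · have hit : ∀ k, latent ((θ.process G η U₀)^[k] H) = (S.step c)^[k] (latent H) := fun k =>
      (Function.Semiconj.iterate_right (f := latent) hstep k) H
    have hC := reluNetLip_nonneg V W
    -- Each readout is Lipschitz in the state with constant `2 * s`, and the decoder contributes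
    -- `reluNetLip`; the added `1` keeps `q` positive.
    set q := (reluNetLip V W + 1) * (2 * c.s) with hq
    have hq0 : 0 < q := by positivity
    obtain ⟨k₀, hk₀⟩ := Metric.tendsto_atTop.1 (hlim (latent H)) (r / q) (by positivity)
    refine ⟨k₀, fun k hk i => ?_⟩
    have h1 := (hk₀ k hk).le
    rw [dist_eq_norm, ← hit, le_div_iff₀ hq0, ← hH₀] at h1
    have h2 := norm_readStatic_sub_le c (latent ((θ.process G η U₀)^[k] H)) (latent H₀)
    have h3 := norm_readProp_sub_le c (latent ((θ.process G η U₀)^[k] H)) (latent H₀)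
    rw [hθ.decode_apply hs.ne' hU H₀]
    refine (hθ.abs_decode_sub_le hs.ne' hU _ i _ _ h2 h3).trans ?_
    refine le_trans ?_ h1
    have h4 := norm_nonneg (latent ((θ.process G η U₀)^[k] H) - latent H₀)
    rw [hq]
    nlinarith [mul_nonneg hs.le h4]

lemma Spec.abs_process_le {η R : ℝ} {n : ℕ} (hn : G.numNodes ≤ n) (hl : 0 ≤ l)
    (hln : l * n ≤ 1 / 8) (hR0 : 0 ≤ R) (hR : ∀ i x, |G.nodeData i x| ≤ R) (hδ : 0 < δ)
    (c : CellConstants e η R (n * (F.weightNorm * R + F.biasNorm)) (n * F.weightNorm))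
    (hθ : θ.Spec e l δ c.M c.s c.g V W b) (hU : G.MeetsDirichlet U₀) (H : LatentState G d)
    (p : G.Free × Fin d) : |θ.process G η U₀ H p| ≤ c.g * d := by
  have h := hθ.latent_process hn hl hln hR0 hR hδ c hU H
  change |latent (θ.process G η U₀ H) p.1 p.2| ≤ _
  exact (abs_apply_le _ _ _).trans (by rw [h]; exact norm_step_le _ c _)

end PsiGNN

theorem mainTheorem1 (𝒟 : Set PoissonProblem) (hmesh : ∀ G ∈ 𝒟, G.IsMesh)
    (hcompact : PoissonProblem.IsCompactFamily 𝒟) (η : ℝ) (hη : 0 ≤ η) (ε : ℝ) (hε : 0 < ε) :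
    ∃ L d₀ : ℕ, ∀ d ≥ d₀, ∃ w₀ : ℕ, ∀ w ≥ w₀, ∃ θ : PsiGNN L w d, ∃ μ : ℝ, 0 ≤ μ ∧ μ < 1 ∧
      ∀ G ∈ 𝒟, ∀ U₀ : Fin G.numNodes → ℝ, G.MeetsDirichlet U₀ →
        (∀ H H' : LatentState G d, √ε < dist H H' →
          dist (θ.process G η U₀ H) (θ.process G η U₀ H') ≤ μ * dist H H') ∧
        ∃ Hstar : LatentState G d, ∃ Ustar : EuclideanSpace ℝ (Fin G.numNodes),
          (∀ H, θ.process G η U₀ H = H ↔ H = Hstar) ∧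
          (∀ H, ∀ k : ℕ,
            dist ((θ.process G η U₀)^[k] H) Hstar ≤ max (μ ^ k * dist H Hstar) √ε) ∧
          (∀ H, ∃ k₀ : ℕ, ∀ k ≥ k₀,
            dist ((θ.process G η U₀)^[k] H) Hstar ≤ √ε ∧
            ‖θ.decode G U₀ ((θ.process G η U₀)^[k] H) - Ustar‖ ≤ ε + √ε) ∧
          (∀ U, G.IsResidualMinimizer U ↔ U = Ustar) ∧
          ‖θ.decode G U₀ Hstar - Ustar‖ ≤ ε := by
  obtain ⟨n, hn⟩ := hcompact.1
  have hsε : 0 < √ε := Real.sqrt_pos.2 hε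
  -- One damping for the whole family, small enough for every admissible number of nodes.
  obtain ⟨l, hl⟩ : ∃ l : ℝ, l = 1 / (8 * (n + 1)) := ⟨_, rfl⟩
  have hl0 : 0 < l := by rw [hl]; positivity
  have hln : l * n ≤ 1 / 8 := by
    rw [hl, div_mul_eq_mul_div, div_le_div_iff₀ (by positivity) (by positivity)]; linarith
  have hlN : ∀ G ∈ 𝒟, l * G.numNodes < 1 := fun G hG => by
    have : (G.numNodes : ℝ) ≤ n := by exact_mod_cast hn G hG
    have : l * G.numNodes ≤ l * n := by gcongr
    linarith
  -- At each node `ε'` is spent on the decoder and `ε'` on the readouts; passing to the Euclidean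
  -- norm costs a factor of at most `n + 1`.
  obtain ⟨ε', hε'⟩ : ∃ ε' : ℝ, ε' = ε / (2 * (n + 1)) := ⟨_, rfl⟩
  have hε'0 : 0 < ε' := by rw [hε']; positivity
  obtain ⟨⟨R₁, hR₁⟩, F, m, V, W, b, hdec⟩ :=
    PoissonProblem.exists_decoder hmesh hcompact hl0 hlN hε'0
  set R := max R₁ 0
  have hR0 : 0 ≤ R := le_max_right _ _
  have hR : ∀ G ∈ 𝒟, ∀ i x, |G.nodeData i x| ≤ R := fun G hG i x =>
    (hR₁ G hG i x).trans (le_max_left _ _)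
  have hw0 := EdgeUnits.weightNorm_nonneg F
  have hb0 := EdgeUnits.biasNorm_nonneg F
  have hC := reluNetLip_nonneg V W
  obtain ⟨t, ht⟩ : ∃ t : ℝ,
    t = ε' / ((reluNetLip V W + 1) * (2 * (3 + 2 * (n * EdgeUnits.weightNorm F)))) := ⟨_, rfl⟩
  have ht0 : 0 < t := by rw [ht]; positivity
  have htot : reluNetLip V W * ((3 + 2 * (n * EdgeUnits.weightNorm F)) * (t + t)) ≤ ε' := by
    have h1 : (reluNetLip V W + 1) * ((3 + 2 * (n * EdgeUnits.weightNorm F)) * (t + t)) = ε' := by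
      rw [ht]; field_simp; ring
    rw [← h1]
    gcongr
    linarith
  refine ⟨1, Fintype.card (Option (Option (NodeIdx ⊕ F))), fun d hd => ?_⟩
  obtain ⟨e⟩ : Nonempty (Option (Option (NodeIdx ⊕ F)) ↪ Fin d) :=
    Function.Embedding.nonempty_of_card_le (by simpa using hd)
  have hd0 : (0 : ℝ) < d := by exact_mod_cast (e none).pos
  -- The bound on the gain confines the outputs of the processor: `(n * d + 1) * (2 * (g * d)) ≤ √ε
  -- / 2`.
  obtain ⟨c, hcg, hacc⟩ := CellConstants.exists_accurate e hη hR0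
    (by positivity : 0 ≤ n * (EdgeUnits.weightNorm F * R + EdgeUnits.biasNorm F))
    (by positivity : 0 ≤ n * EdgeUnits.weightNorm F) ht0
    (by positivity : 0 < √ε / (4 * d * (n * d + 1)))
  obtain ⟨δ, hδ, hτ⟩ := exists_scaledTanh_approx c.R t ht0
  refine ⟨m + 2 * d + 3 * Fintype.card F + Fintype.card (NodeIdx ⊕ F), fun w hw => ?_⟩
  obtain ⟨θ, hθ⟩ := PsiGNN.exists_spec e l δ c.M c.s c.g V W b hw
  -- Outputs are within `√ε / 2` of each other, so `1 / 2` is a contraction factor for states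
  -- farther apart than `√ε`.
  refine ⟨θ, 1 / 2, by norm_num, by norm_num, fun G hG U₀ hU => ?_⟩
  have hclose : ∀ H H', dist (θ.process G η U₀ H) (θ.process G η U₀ H') ≤ √ε / 2 := by
    intro H H'
    have hcard : Fintype.card (G.Free × Fin d) ≤ n * d := by
      rw [Fintype.card_prod, Fintype.card_fin]
      exact Nat.mul_le_mul_right d ((Fintype.card_subtype_le _).trans (by simpa using hn G hG))
    have hg := c.g_pos
    rw [dist_eq_norm]
    refine (EuclideanSpace.norm_le_of_abs_le _ hcard (B := 2 * (c.g * d)) (by positivity)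
      fun p => ?_).trans ?_
    · have h1 := hθ.abs_process_le (hn G hG) hl0.le hln hR0 (hR G hG) hδ c hU H p
      have h2 := hθ.abs_process_le (hn G hG) hl0.le hln hR0 (hR G hG) hδ c hU H' p
      rw [PiLp.sub_apply]
      linarith [abs_sub (θ.process G η U₀ H p) (θ.process G η U₀ H' p)]
    · rw [le_div_iff₀ (by positivity)] at hcg
      push_cast
      linarith
  obtain ⟨H₀, hfix, happ, hlim⟩ := hθ.exists_fixedPoint (hn G hG) hl0 hln hR0 (hR G hG) hδ c hU
    ht0.le hτ hacc (hdec G hG)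
  have hnorm : ∀ (v : EuclideanSpace ℝ (Fin G.numNodes)) (B : ℝ), 0 ≤ B → (∀ i, |v i| ≤ B) →
      ‖v‖ ≤ (n + 1) * B := fun v B hB h =>
    EuclideanSpace.norm_le_of_abs_le v (by simpa using hn G hG) hB h
  have hdist : ∀ H k, dist ((θ.process G η U₀)^[k + 1] H) H₀ ≤ √ε := by
    intro H k
    -- The fixed point is itself an output of the processor.
    rw [Function.iterate_succ_apply', ← (hfix H₀).2 rfl]
    exact (hclose _ _).trans (by linarith)
  have hfinal : ‖θ.decode G U₀ H₀ - WithLp.toLp 2 G.solution‖ ≤ ε := by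
    refine (hnorm _ (2 * ε') (by positivity) fun i => ?_).trans_eq ?_
    · exact (happ i).trans (by linarith)
    · rw [hε']; field_simp
  refine ⟨fun H H' h => (hclose H H').trans (by linarith), H₀, WithLp.toLp 2 G.solution, hfix,
    fun H k => ?_, fun H => ?_, fun U => (hmesh G hG).isResidualMinimizer_iff U, hfinal⟩
  · rcases k with _ | k
    · simp
    · exact (hdist H k).trans (le_max_right _ _)
  · obtain ⟨k₀, hk₀⟩ := hlim H (√ε / (n + 1)) (by positivity)
    refine ⟨k₀ + 1, fun k hk => ⟨?_, ?_⟩⟩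
    · obtain ⟨k, rfl⟩ : ∃ k', k = k' + 1 := ⟨k - 1, by omega⟩
      exact hdist H k
    · have h1 := hnorm (θ.decode G U₀ ((θ.process G η U₀)^[k] H) - θ.decode G U₀ H₀) _
        (by positivity) (fun i => hk₀ k (by omega) i)
      rw [mul_div_cancel₀ _ (by positivity)] at h1
      have h2 := norm_add_le (θ.decode G U₀ ((θ.process G η U₀)^[k] H) - θ.decode G U₀ H₀)
        (θ.decode G U₀ H₀ - WithLp.toLp 2 G.solution)
      rw [sub_add_sub_cancel] at h2
      linarith

end
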